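/- **Setting.** Let $d\ge 1$, $\Sigma_0=\{X=(x,x_{d+1})\in\mathbb R^{d+1}: x_{d+1}\ge 0\}$, $\Gamma_0=\mathbb R^d\times\{0\}$, and $Q=\{x_{d+1}>0\}\times(0,\infty)$. The one-phase Hele-Shaw problem is $\Delta U=0$ in $\{U>0\}$, $U=1$ on $\Gamma_0$, with $\partial\{U>0\}$ moving with outward normal velocity $V=\partial^+_\nu U$ ($\nu$ the unit normal pointing into $\{U>0\}$). For $U$ defined on $\Sigma_0\times I$, the set $\{U>0\}$ is a subset of $\Sigma_0\times I$, and its interior $\{U>0\}^0$ and boundary $\partial\{U>0\}$ are relative to $\Sigma_0\times I$. **Kim's notion.** A non-negative upper semicontinuous $U:\Sigma_0\times[0,\infty)\to\mathbb R$ is a *Kim subsolution* with initial data $U_0$ if: (i) $U(\cdot,0)=U_0$ and $U\le 1$ on $\Gamma_0$; (ii) $\overline{\{U>0\}}\cap\{t=0\}=\overline{\{X:U(X,0)>0\}}$; (iii) $\overline{\{U>0\}}\cap\{t\le T\}$ is bounded for every $T\ge0$; (iv) whenever $\Phi\in C^{2,1}_{X,t}(Q)$ and $U-\Phi$ restricted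 to $\overline{\{U>0\}}\cap\{t\le t_0\}\cap Q$ has a local maximum at a point $(X_0,t_0)$ of this set, then $-\Delta\Phi(X_0,t_0)\le 0$ if $U(X_0,t_0)>0$, and $\min(-\Delta\Phi,\ \partial_t\Phi-|\nabla\Phi|^2)(X_0,t_0)\le 0$ if $(X_0,t_0)\in\partial\{U>0\}$ and $U(X_0,t_0)=0$. A non-negative lower semicontinuous $U:\Sigma_0\times[0,\infty)\to\mathbb R$ is a *Kim supersolution* with initial data $U_0$ if: (i) $U(\cdot,0)=U_0$ and $U\ge1$ on $\Gamma_0$; (ii) whenever $\Phi\in C^{2,1}_{X,t}(Q)$ and $U-\Phi$ restricted to $\overline{\{U>0\}}\cap\{t\le t_0\}\cap Q$ has a local minimum at a point $(X_0,t_0)$ of this set, then $-\Delta\Phi(X_0,t_0)\ge0$ if $U(X_0,t_0)>0$, and $\max(-\Delta\Phi,\ \partial_t\Phi-|\nabla\Phi|^2)(X_0,t_0)\ge0$ if $(X_0,t_0)\in\partial\{U>0\}$, $\nabla\Phi(X_0,t_0)\ne0$ and $\{\Phi>0\}\cap\{U>0\}\cap B\ne\emptyset$ for every ball $B$ centered at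 $(X_0,t_0)$. **Test interfaces.** A *test interface* in $[a,b]$ is a closed smooth hypersurface $S\subset\Sigma_0\times[a,b]$ (locally the zero set of a smooth function with non-vanishing spatial gradient) such that each slice $S(t)$ has positive distance from $\Gamma_0$ and $\{x_{d+1}>0\}\setminus S(t)$ is the disjoint union of two connected open sets $S(t)^+$ and $S(t)^-$, with $\Gamma_0\subset\overline{S(t)^+}$; near each of its points $S$ separates $S^+$ from $S^-$. $V_S$ denotes its normal velocity, in the direction out of $S^+$, and $\nu$ its unit spatial normal pointing into $S^+$. $U_S$ is the function that for each $t\in[a,b]$ is the bounded solution, continuous on $\overline{S(t)^+}$, of $\Delta U_S=0$ in $S(t)^+$, $U_S=0$ on $S(t)$, $U_S=1$ on $\Gamma_0$. Let $U:\Sigma_0\times[a,b]\to\mathbb R$, and let $S$ be a test interface in $[t_0-\tau,t_0]\subset[a,b]$, $\tau>0$, with $(X_0,t_0)\in\partial\{U>0\}\cap S$. Then $S$ *touches $U$ from above* at $(X_0,t_0)$ if $\{U>0\}\cap\{t_0-\tau\le t\le t_0\}\subset\overline{S^+}$ and $S(t_0)^-$ is unbounded; $S$ *touches $U$ from below* at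 $(X_0,t_0)$ if $S^+\subset\{U>0\}$. An upper (resp. lower) semicontinuous $U:\Sigma_0\times[a,b]\to\mathbb R$ is a *viscosity subsolution* (resp. *supersolution*) in $[a,b]$ in the sense of test interfaces if: $U\le1$ (resp. $U\ge 1$) on $\Gamma_0$; at every $(X,t)\in\{U>0\}^0$ with $x_{d+1}>0$ and $a<t\le b$, every $\varphi$ of class $C^2$ near $X$ such that $U(\cdot,t)-\varphi$ has a local maximum (resp. minimum) at $X$ satisfies $\Delta\varphi(X)\ge0$ (resp. $\le0$); and whenever a test interface $S$ touches $U$ from above (resp. from below) at $(X_0,t_0)$, the one-sided derivative $\partial^+_\nu U_S(X_0,t_0)=\lim_{s\to0^+}\frac{U_S(X_0+s\nu,t_0)-U_S(X_0,t_0)}{s}$ exists and $V_S(X_0,t_0)\le\partial^+_\nu U_S(X_0,t_0)$ (resp. $\ge$). **Lemma.** Let $0\le a<b$. If $U$ is a Kim subsolution (resp. Kim supersolution) of the one-phase Hele-Shaw problem, with some initial data $U_0$, then $U$ restricted to $\Sigma_0\times[a,b]$ is a viscosity subsolution (resp. supersolution) in $[a,b]$ in the sense of test interfaces. -/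

import Mathlib

open Set Filter Topology
open scoped ContDiff InnerProductSpace Gradient Laplacian

namespace HeleShaw

/-- The physical space `ℝ^{d+1}`; a point is `X = (x, x_{d+1})`. -/
abbrev Space (d : ℕ) : Type := EuclideanSpace ℝ (Fin (d + 1))

/-- The height coordinate `x_{d+1}`. -/
def height {d : ℕ} (X : Space d) : ℝ := X (Fin.last d)

/-- The open upper half space `{x_{d+1} > 0}`. -/
def openHalf (d : ℕ) : Set (Space d) := {X | 0 < height X}

/-- The closed upper half space `{x_{d+1} ≥ 0}`, on which the unknown `U(·,t)` lives. -/
def closedHalf (d : ℕ) : Set (Space d) := {X | 0 ≤ height X}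

/-- The fixed boundary `Γ₀ = ℝ^d × {0}`. -/
def bottom (d : ℕ) : Set (Space d) := {X | height X = 0}

/-- `Σ₀ × I`, with the fixed boundary included, for a set `I` of times. -/
def cylinder (d : ℕ) (I : Set ℝ) : Set (Space d × ℝ) := closedHalf d ×ˢ I

/-- The open space-time domain `Q = {x_{d+1} > 0} × (0,∞)`. -/
def openCylinder (d : ℕ) : Set (Space d × ℝ) := openHalf d ×ˢ Ioi 0

/-- The set `{U > 0}` of a function `U` on `Σ₀ × I`. -/
def positivitySet {d : ℕ} (I : Set ℝ) (U : Space d × ℝ → ℝ) : Set (Space d × ℝ) :=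
  {p | p ∈ cylinder d I ∧ 0 < U p}

/-- Interior of `A ⊆ D` relative to `D`. -/
def relInterior {α : Type*} [TopologicalSpace α] (D A : Set α) : Set α :=
  {p | p ∈ D ∧ A ∈ 𝓝[D] p}

/-- Boundary of `A ⊆ D` relative to the closed set `D`. -/
def relBoundary {α : Type*} [TopologicalSpace α] (D A : Set α) : Set α :=
  closure A ∩ closure (D \ A)

/-- The free boundary `∂{U > 0}` of a function `U` on `Σ₀ × I`. -/
def freeBoundary {d : ℕ} (I : Set ℝ) (U : Space d × ℝ → ℝ) : Set (Space d × ℝ) :=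
  relBoundary (cylinder d I) (positivitySet I U)

/-- The time slice `Φ(·,t)`. -/
def slice {d : ℕ} (Φ : Space d × ℝ → ℝ) (t : ℝ) : Space d → ℝ := fun X => Φ (X, t)

/-- The time derivative `∂ₜΦ`. -/
noncomputable def timeDeriv {d : ℕ} (Φ : Space d × ℝ → ℝ) (p : Space d × ℝ) : ℝ :=
  deriv (fun t => Φ (p.1, t)) p.2

/-- The spatial gradient `∇Φ`. -/
noncomputable def spaceGrad {d : ℕ} (Φ : Space d × ℝ → ℝ) (p : Space d × ℝ) : Space d :=
  ∇ (slice Φ p.2) p.1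

/-- The spatial Laplacian `ΔΦ`. -/
noncomputable def spaceLaplacian {d : ℕ} (Φ : Space d × ℝ → ℝ) (p : Space d × ℝ) : ℝ :=
  Δ (slice Φ p.2) p.1

/-- `Φ ∈ C^{2,1}_{X,t}(O)` for an open set `O` of space-time: twice differentiable in space and
once in time, all these derivatives being continuous in space-time. -/
structure IsC21On {d : ℕ} (Φ : Space d × ℝ → ℝ) (O : Set (Space d × ℝ)) : Prop where
  contDiff_space : ∀ p ∈ O, ContDiffAt ℝ 2 (slice Φ p.2) p.1
  differentiable_time : ∀ p ∈ O, DifferentiableAt ℝ (fun t => Φ (p.1, t)) p.2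
  continuousOn : ContinuousOn Φ O
  continuousOn_fderiv : ContinuousOn (fun p => fderiv ℝ (slice Φ p.2) p.1) O
  continuousOn_fderiv_two : ContinuousOn (fun p => fderiv ℝ (fderiv ℝ (slice Φ p.2)) p.1) O
  continuousOn_timeDeriv : ContinuousOn (timeDeriv Φ) O

/-! ### Kim's viscosity sub- and supersolutions -/

/-- The set `closure {U > 0} ∩ {t ≤ t₀} ∩ Q` on which test functions are compared with `U`. -/
def kimTestSet {d : ℕ} (U : Space d × ℝ → ℝ) (t₀ : ℝ) : Set (Space d × ℝ) :=
  closure (positivitySet (Ici 0) U) ∩ {p | p.2 ≤ t₀} ∩ openCylinder d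

/-- Kim's viscosity subsolutions of the one-phase Hele-Shaw problem on `Σ₀ × [0,∞)` with initial
data `U₀`. -/
structure IsKimSubsolution {d : ℕ} (U₀ : Space d → ℝ) (U : Space d × ℝ → ℝ) : Prop where
  nonneg : ∀ p ∈ cylinder d (Ici 0), 0 ≤ U p
  usc : UpperSemicontinuousOn U (cylinder d (Ici 0))
  initial : ∀ X ∈ closedHalf d, U (X, 0) = U₀ X
  le_bottom : ∀ X ∈ bottom d, ∀ t, 0 ≤ t → U (X, t) ≤ 1
  initial_support : {X | (X, (0 : ℝ)) ∈ closure (positivitySet (Ici 0) U)} =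
    closure {X | X ∈ closedHalf d ∧ 0 < U (X, 0)}
  bounded_support : ∀ T : ℝ, 0 ≤ T →
    Bornology.IsBounded (closure (positivitySet (Ici 0) U) ∩ {p | p.2 ≤ T})
  test : ∀ Φ : Space d × ℝ → ℝ, IsC21On Φ (openCylinder d) →
    ∀ p₀ ∈ kimTestSet U p₀.2, IsLocalMaxOn (fun p => U p - Φ p) (kimTestSet U p₀.2) p₀ →
      (0 < U p₀ → -spaceLaplacian Φ p₀ ≤ 0) ∧
      (p₀ ∈ freeBoundary (Ici 0) U → U p₀ = 0 →
        min (-spaceLaplacian Φ p₀) (timeDeriv Φ p₀ - ‖spaceGrad Φ p₀‖ ^ 2) ≤ 0)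

/-- Kim's viscosity supersolutions of the one-phase Hele-Shaw problem on `Σ₀ × [0,∞)` with initial
data `U₀`. -/
structure IsKimSupersolution {d : ℕ} (U₀ : Space d → ℝ) (U : Space d × ℝ → ℝ) : Prop where
  nonneg : ∀ p ∈ cylinder d (Ici 0), 0 ≤ U p
  lsc : LowerSemicontinuousOn U (cylinder d (Ici 0))
  initial : ∀ X ∈ closedHalf d, U (X, 0) = U₀ X
  ge_bottom : ∀ X ∈ bottom d, ∀ t, 0 ≤ t → 1 ≤ U (X, t)
  test : ∀ Φ : Space d × ℝ → ℝ, IsC21On Φ (openCylinder d) →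
    ∀ p₀ ∈ kimTestSet U p₀.2, IsLocalMinOn (fun p => U p - Φ p) (kimTestSet U p₀.2) p₀ →
      (0 < U p₀ → 0 ≤ -spaceLaplacian Φ p₀) ∧
      (p₀ ∈ freeBoundary (Ici 0) U → spaceGrad Φ p₀ ≠ 0 →
        (∀ r > 0, ({p | 0 < Φ p} ∩ positivitySet (Ici 0) U ∩ Metric.ball p₀ r).Nonempty) →
        0 ≤ max (-spaceLaplacian Φ p₀) (timeDeriv Φ p₀ - ‖spaceGrad Φ p₀‖ ^ 2))

/-! ### Test interfaces -/

/-- `φ` is a smooth local defining function near `p` for the moving hypersurface `S` over the times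
`[a,b]`, positive on `S⁺` and negative on `S⁻`, with nonvanishing spatial gradient (so that each
time slice is a smooth hypersurface too). -/
def IsLocalDefiningFunction {d : ℕ} (a b : ℝ) (S : Set (Space d × ℝ)) (pos neg : ℝ → Set (Space d))
    (p : Space d × ℝ) (φ : Space d × ℝ → ℝ) : Prop :=
  ∃ O : Set (Space d × ℝ), IsOpen O ∧ p ∈ O ∧ ContDiffOn ℝ ∞ φ O ∧
    ∀ q ∈ O, spaceGrad φ q ≠ 0 ∧
      (q.2 ∈ Icc a b →
        (q ∈ S ↔ φ q = 0) ∧ (q.1 ∈ pos q.2 ↔ 0 < φ q) ∧ (q.1 ∈ neg q.2 ↔ φ q < 0))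

/-- A (one-phase) test interface in `[a,b]`: a smooth hypersurface `S` of space-time, each time slice
of which stays away from `Γ₀` and separates the half space into two connected open sets `S(t)⁺`,
`S(t)⁻`, with `Γ₀` in the closure of `S(t)⁺`. -/
structure TestInterface (d : ℕ) (a b : ℝ) where
  /-- The hypersurface. -/
  carrier : Set (Space d × ℝ)
  /-- The region `S(t)⁺`. -/
  pos : ℝ → Set (Space d)
  /-- The region `S(t)⁻`. -/
  neg : ℝ → Set (Space d)
  subset : carrier ⊆ cylinder d (Icc a b)
  isClosed : IsClosed carrier
  smooth : ∀ p ∈ carrier, ∃ φ, IsLocalDefiningFunction a b carrier pos neg p φ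
  away : ∀ t ∈ Icc a b, ∃ δ > 0, ∀ X, (X, t) ∈ carrier → δ ≤ height X
  isOpen_pos : ∀ t ∈ Icc a b, IsOpen (pos t)
  isOpen_neg : ∀ t ∈ Icc a b, IsOpen (neg t)
  connected_pos : ∀ t ∈ Icc a b, IsConnected (pos t)
  connected_neg : ∀ t ∈ Icc a b, IsConnected (neg t)
  disjoint : ∀ t ∈ Icc a b, Disjoint (pos t) (neg t)
  separates : ∀ t ∈ Icc a b, openHalf d \ {X | (X, t) ∈ carrier} = pos t ∪ neg t
  bottom_subset : ∀ t ∈ Icc a b, bottom d ⊆ closure (pos t)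

namespace TestInterface

variable {d : ℕ} {a b : ℝ}

/-- `φ` is a smooth local defining function of the interface near `p`. -/
def IsDefiningAt (S : TestInterface d a b) (p : Space d × ℝ) (φ : Space d × ℝ → ℝ) : Prop :=
  IsLocalDefiningFunction a b S.carrier S.pos S.neg p φ

/-- `V` is the normal velocity `V_S` of the interface at `p`, in the direction pointing out of `S⁺`
(so that `V > 0` where `S⁺` expands): `V = ∂ₜφ / |∇φ|` for a local defining function `φ`. -/
def HasNormalVelocity (S : TestInterface d a b) (p : Space d × ℝ) (V : ℝ) : Prop :=
  ∃ φ, S.IsDefiningAt p φ ∧ V = timeDeriv φ p / ‖spaceGrad φ p‖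

/-- `ν` is the unit normal of the time slice of the interface at `p` that points into `S⁺`. -/
def HasInwardNormal (S : TestInterface d a b) (p : Space d × ℝ) (ν : Space d) : Prop :=
  ∃ φ, S.IsDefiningAt p φ ∧ ν = (‖spaceGrad φ p‖)⁻¹ • spaceGrad φ p

/-- `W` is the function `U_S`: for each time `t`, the bounded solution of `ΔW = 0` in `S(t)⁺`,
`W = 0` on `S(t)`, `W = 1` on `Γ₀`, continuous up to the boundary. -/
structure IsPotential (S : TestInterface d a b) (W : Space d × ℝ → ℝ) : Prop where
  harmonic : ∀ t ∈ Icc a b, InnerProductSpace.HarmonicOnNhd (slice W t) (S.pos t)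
  continuousOn : ∀ t ∈ Icc a b, ContinuousOn (slice W t) (closure (S.pos t))
  bounded : ∀ t ∈ Icc a b, ∃ C : ℝ, ∀ X ∈ S.pos t, |W (X, t)| ≤ C
  eq_zero : ∀ p ∈ S.carrier, W p = 0
  eq_one : ∀ t ∈ Icc a b, ∀ X ∈ bottom d, W (X, t) = 1

/-- `L = ∂⁺_ν W(p)` is the one-sided derivative of `W(·,t)` in the direction `ν`. -/
def HasOneSidedDeriv (W : Space d × ℝ → ℝ) (p : Space d × ℝ) (ν : Space d) (L : ℝ) : Prop :=
  Tendsto (fun s : ℝ => (W (p.1 + s • ν, p.2) - W p) / s) (𝓝[>] 0) (𝓝 L)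

end TestInterface

/-- The test interface `S` in `[t₀ - τ, t₀]` touches `U : Σ₀ × [a,b] → ℝ` from above at `(X₀,t₀)`:
`{U > 0} ∩ {t₀ - τ ≤ t ≤ t₀} ⊆ closure S⁺` (slicewise) and `(X₀,t₀) ∈ ∂{U > 0} ∩ S`. The region
`S(t₀)⁻` is required to be unbounded, that is, not to be a bounded hole. -/
structure TouchesFromAbove {d : ℕ} (a b : ℝ) (U : Space d × ℝ → ℝ) {τ t₀ : ℝ}
    (S : TestInterface d (t₀ - τ) t₀) (X₀ : Space d) : Prop where
  subset : ∀ t ∈ Icc (t₀ - τ) t₀, ∀ X ∈ closedHalf d, 0 < U (X, t) → X ∈ closure (S.pos t)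
  mem_freeBoundary : (X₀, t₀) ∈ freeBoundary (Icc a b) U
  mem_carrier : (X₀, t₀) ∈ S.carrier
  unbounded : ¬ Bornology.IsBounded (S.neg t₀)

/-- The test interface `S` in `[t₀ - τ, t₀]` touches `U : Σ₀ × [a,b] → ℝ` from below at `(X₀,t₀)`:
`S⁺ ∩ {t₀ - τ ≤ t ≤ t₀} ⊆ {U > 0}` and `(X₀,t₀) ∈ ∂{U > 0} ∩ S`. -/
structure TouchesFromBelow {d : ℕ} (a b : ℝ) (U : Space d × ℝ → ℝ) {τ t₀ : ℝ}
    (S : TestInterface d (t₀ - τ) t₀) (X₀ : Space d) : Prop where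
  subset : ∀ t ∈ Icc (t₀ - τ) t₀, ∀ X ∈ S.pos t, 0 < U (X, t)
  mem_freeBoundary : (X₀, t₀) ∈ freeBoundary (Icc a b) U
  mem_carrier : (X₀, t₀) ∈ S.carrier

/-! ### Viscosity sub- and supersolutions through test interfaces -/

/-- The points of `{U > 0}⁰` at which the interior equation is tested: `X` is not on `Γ₀` and `t` is
not the initial time. -/
def interiorPositivity {d : ℕ} (a b : ℝ) (U : Space d × ℝ → ℝ) : Set (Space d × ℝ) :=
  relInterior (cylinder d (Icc a b)) (positivitySet (Icc a b) U) ∩ openHalf d ×ˢ Ioc a b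

/-- Viscosity subsolution in `[a,b]` of the one-phase Hele-Shaw problem `ΔU = 0` in `{U > 0}`,
`V = ∂⁺_ν U` on `∂{U > 0}`, in the sense of test interfaces. -/
structure IsViscositySubsolution {d : ℕ} (a b : ℝ) (U : Space d × ℝ → ℝ) : Prop where
  usc : UpperSemicontinuousOn U (cylinder d (Icc a b))
  le_bottom : ∀ X ∈ bottom d, ∀ t ∈ Icc a b, U (X, t) ≤ 1
  interior_eq : ∀ p ∈ interiorPositivity a b U, ∀ φ : Space d → ℝ, ContDiffAt ℝ 2 φ p.1 →
    IsLocalMax (fun X => U (X, p.2) - φ X) p.1 → 0 ≤ Δ φ p.1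
  test : ∀ τ t₀ : ℝ, 0 < τ → a ≤ t₀ - τ → t₀ ≤ b → ∀ (S : TestInterface d (t₀ - τ) t₀)
    (X₀ : Space d), TouchesFromAbove a b U S X₀ →
    ∀ W, S.IsPotential W → ∀ V ν, S.HasNormalVelocity (X₀, t₀) V → S.HasInwardNormal (X₀, t₀) ν →
    ∃ L, TestInterface.HasOneSidedDeriv W (X₀, t₀) ν L ∧ V ≤ L

/-- Viscosity supersolution in `[a,b]` of the one-phase Hele-Shaw problem `ΔU = 0` in `{U > 0}`,
`V = ∂⁺_ν U` on `∂{U > 0}`, in the sense of test interfaces. -/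
structure IsViscositySupersolution {d : ℕ} (a b : ℝ) (U : Space d × ℝ → ℝ) : Prop where
  lsc : LowerSemicontinuousOn U (cylinder d (Icc a b))
  ge_bottom : ∀ X ∈ bottom d, ∀ t ∈ Icc a b, 1 ≤ U (X, t)
  interior_eq : ∀ p ∈ interiorPositivity a b U, ∀ φ : Space d → ℝ, ContDiffAt ℝ 2 φ p.1 →
    IsLocalMin (fun X => U (X, p.2) - φ X) p.1 → Δ φ p.1 ≤ 0
  test : ∀ τ t₀ : ℝ, 0 < τ → a ≤ t₀ - τ → t₀ ≤ b → ∀ (S : TestInterface d (t₀ - τ) t₀)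
    (X₀ : Space d), TouchesFromBelow a b U S X₀ →
    ∀ W, S.IsPotential W → ∀ V ν, S.HasNormalVelocity (X₀, t₀) V → S.HasInwardNormal (X₀, t₀) ν →
    ∃ L, TestInterface.HasOneSidedDeriv W (X₀, t₀) ν L ∧ L ≤ V

end HeleShaw

/-! Both halves argue by contradiction at the contact point (X₀, t₀). Write ℓ = ⟪X - X₀, ν⟫, and let
L be the slope at X₀ of the potential W of the interface at time t₀. If the velocity law fails,
Kim's definition is tested with Φ = m (ℓ - V' (t₀ - t)) ± A (‖X - X₀‖² - (d + 2) ℓ²), for which ΔΦ =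
∓2A, while ∂ₜΦ = m V' and |∇Φ| = m at the contact point. For a subsolution take the sign + and L < m
< V' < V; for a supersolution take the sign - and V < V' < m < L', where L' is a slope that U is
known to have from below. Then both entries of Kim's min (max) have the forbidden sign, so it
remains to show that Φ lies on the correct side of U near (X₀, t₀) in the past.

Off the positive (resp. negative) side of the interface Φ has a definite sign, because its zero
level moves at a speed strictly different from V and falls behind the interface on the right side.
At time t₀, on a small sphere about X₀, the comparison follows from U ≤ W (resp. a lower slope of U)
and the strict inequality between slopes. Semicontinuity carries this lateral inequality to slightly
earlier times, and there the maximum principle on each time slice gives the comparison inside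
(`exists_le_paraboloid`, `exists_paraboloid_le`).

Four ingredients support this. Penalization in time turns Kim's space-time test into viscosity sub-
or superharmonicity of each time slice (`isSubharmonicAt_slice`). A Phragmén-Lindelöf principle in
the half space compares U with W at time t₀. The slope of W exists without any boundary regularity
theory: the interface lies between two paraboloids, and a quantitative Hopf lemma shows that the
supremum of the slopes of lower linear bounds is attained as a limit along the normal
(`exists_slope`). Finally, Taylor expansion of a defining function locates both sides of the
interface near (X₀, t₀).

Subsolutions need one more argument. Kim's test set at time t₀ contains limits of positive points
from later times, which could lie across the interface. Bounded support, unboundedness and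
connectedness of S(t₀)⁻ rule this out (`notMem_closure_of_mem_neg`). For supersolutions the test
needs m > 0; if L ≤ 0, Hopf's lemma for U supplies a positive slope. -/

namespace HeleShaw

/-! ### Second-order calculus along lines, quadratic functions, viscosity subharmonicity. -/

section Calculus

variable {E : Type*} [NormedAddCommGroup E] [InnerProductSpace ℝ E]

theorem hasDerivAt_line {F : Type*} [NormedAddCommGroup F] [NormedSpace ℝ F] {f : E → F} {x v : E}
    {t : ℝ} (hf : DifferentiableAt ℝ f (x + t • v)) :
    HasDerivAt (fun s : ℝ => f (x + s • v)) (fderiv ℝ f (x + t • v) v) t := by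
  have h : HasDerivAt (fun s : ℝ => x + s • v) v t := by
    simpa using ((hasDerivAt_id t).smul_const v).const_add x
  exact hf.hasFDerivAt.comp_hasDerivAt t h

theorem tendsto_line (x v : E) : Tendsto (fun s : ℝ => x + s • v) (𝓝 0) (𝓝 x) := by
  have : Continuous fun s : ℝ => x + s • v := by fun_prop
  simpa using this.tendsto 0

theorem eventually_deriv_line {f : E → ℝ} {x : E} (v : E) (hf : ContDiffAt ℝ 2 f x) :
    deriv (fun s : ℝ => f (x + s • v)) =ᶠ[𝓝 0] fun s => fderiv ℝ f (x + s • v) v := by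
  have h1 : ∀ᶠ y in 𝓝 x, DifferentiableAt ℝ f y := by
    filter_upwards [hf.eventually (by simp)] with y hy
    exact hy.differentiableAt (by simp)
  filter_upwards [(tendsto_line x v).eventually h1] with s hs
  exact (hasDerivAt_line hs).deriv

theorem hasDerivAt_fderiv_line {f : E → ℝ} {x : E} (v : E) (hf : ContDiffAt ℝ 2 f x) :
    HasDerivAt (fun s : ℝ => fderiv ℝ f (x + s • v) v) (fderiv ℝ (fderiv ℝ f) x v v) 0 := by
  have hx : x + (0 : ℝ) • v = x := by simp
  have h2 : DifferentiableAt ℝ (fderiv ℝ f) (x + (0 : ℝ) • v) := by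
    rw [hx]
    exact (hf.fderiv_right (m := 1) (by norm_num)).differentiableAt (by simp)
  have h3 := hasDerivAt_line h2
  rw [hx] at h3
  have h4 := (ContinuousLinearMap.apply ℝ ℝ v).hasFDerivAt.comp_hasDerivAt (0 : ℝ) h3
  exact h4

theorem deriv_deriv_line {f : E → ℝ} {x : E} (v : E) (hf : ContDiffAt ℝ 2 f x) :
    deriv (deriv (fun s : ℝ => f (x + s • v))) 0 = iteratedFDeriv ℝ 2 f x ![v, v] := by
  rw [(eventually_deriv_line v hf).deriv_eq, iteratedFDeriv_two_apply,
    (hasDerivAt_fderiv_line v hf).deriv]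
  rfl

variable [FiniteDimensional ℝ E]

/-- Reduces every later Laplacian computation to one-variable second derivatives. -/
theorem laplacian_eq_sum_lines {f : E → ℝ} {x : E} (hf : ContDiffAt ℝ 2 f x) :
    Δ f x = ∑ i, deriv (deriv (fun s : ℝ => f (x + s • stdOrthonormalBasis ℝ E i))) 0 := by
  rw [InnerProductSpace.laplacian_eq_iteratedFDeriv_stdOrthonormalBasis]
  exact Finset.sum_congr rfl fun i _ => (deriv_deriv_line _ hf).symm

/-- A positive second derivative would make the point a local minimum too, so `g` would be locally
constant and its second derivative zero. -/
theorem deriv_deriv_nonpos_of_isLocalMax {g : ℝ → ℝ} {t : ℝ} (hg : ContinuousAt g t)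
    (h : IsLocalMax g t) : deriv (deriv g) t ≤ 0 := by
  by_contra! hpos
  have hmin := isLocalMin_of_deriv_deriv_pos hpos h.deriv_eq_zero hg
  have hc : g =ᶠ[𝓝 t] fun _ => g t := by
    filter_upwards [hmin, h] with s h1 h2 using le_antisymm h2 h1
  rw [hc.deriv.deriv_eq] at hpos
  simp at hpos

theorem laplacian_nonpos_of_isLocalMax {f : E → ℝ} {x : E} (hf : ContDiffAt ℝ 2 f x)
    (h : IsLocalMax f x) : Δ f x ≤ 0 := by
  rw [laplacian_eq_sum_lines hf]
  refine Finset.sum_nonpos fun i _ => deriv_deriv_nonpos_of_isLocalMax ?_ ?_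
  · have h1 : ContinuousAt f (x + (0 : ℝ) • stdOrthonormalBasis ℝ E i) := by
      simpa using hf.continuousAt
    have h2 : ContinuousAt (fun s : ℝ => x + s • stdOrthonormalBasis ℝ E i) 0 := by fun_prop
    exact ContinuousAt.comp (f := fun s : ℝ => x + s • stdOrthonormalBasis ℝ E i) h1 h2
  · have := (tendsto_line x (stdOrthonormalBasis ℝ E i)).eventually h
    filter_upwards [this] with s hs
    simpa using hs

/-- The function `X ↦ a + m ⟪X - p, ν⟫ + A ‖X - p‖² + B ⟪X - p, ν⟫²`. -/
noncomputable def quad (p ν : E) (a m A B : ℝ) (X : E) : ℝ :=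
  a + m * ⟪X - p, ν⟫_ℝ + A * ‖X - p‖ ^ 2 + B * ⟪X - p, ν⟫_ℝ ^ 2

omit [FiniteDimensional ℝ E] in
theorem contDiff_quad (p ν : E) (a m A B : ℝ) {k : WithTop ℕ∞} : ContDiff ℝ k (quad p ν a m A B) := by
  unfold quad
  have h1 : ContDiff ℝ k fun X : E => ⟪X - p, ν⟫_ℝ :=
    (contDiff_id.sub contDiff_const).inner ℝ contDiff_const
  have h2 : ContDiff ℝ k fun X : E => ‖X - p‖ ^ 2 := (contDiff_id.sub contDiff_const).norm_sq ℝ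
  exact ((contDiff_const.add (contDiff_const.mul h1)).add (contDiff_const.mul h2)).add
    (contDiff_const.mul (h1.pow 2))

omit [FiniteDimensional ℝ E] in
theorem hasFDerivAt_quad (p ν : E) (a m A B : ℝ) (X : E) :
    HasFDerivAt (quad p ν a m A B)
      (innerSL ℝ ((m + 2 * B * ⟪X - p, ν⟫_ℝ) • ν + (2 * A) • (X - p))) X := by
  have h0 : HasFDerivAt (fun Y : E => Y - p) (ContinuousLinearMap.id ℝ E) X :=
    (hasFDerivAt_id X).sub_const p
  have h1 : HasFDerivAt (fun Y : E => ⟪Y - p, ν⟫_ℝ) (innerSL ℝ ν) X := by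
    have := h0.inner ℝ (hasFDerivAt_const ν X)
    refine this.congr_fderiv ?_
    ext v
    simp [real_inner_comm]
  have h2 := h0.norm_sq
  have := (((h1.const_mul m).const_add a).add (h2.const_mul A)).add ((h1.pow 2).const_mul B)
  refine this.congr_fderiv ?_
  ext v
  simp
  ring

theorem laplacian_quad (p ν : E) (a m A B : ℝ) (X : E) :
    Δ (quad p ν a m A B) X = 2 * Module.finrank ℝ E * A + 2 * B * ‖ν‖ ^ 2 := by
  rw [laplacian_eq_sum_lines (contDiff_quad p ν a m A B).contDiffAt]
  have key : ∀ v : E, ‖v‖ = 1 → deriv (deriv fun s : ℝ => quad p ν a m A B (X + s • v)) 0 =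
      2 * A + 2 * B * ⟪v, ν⟫_ℝ ^ 2 := by
    intro v hv
    have h1 : deriv (fun s : ℝ => quad p ν a m A B (X + s • v)) = fun s =>
        (m * ⟪v, ν⟫_ℝ + 2 * A * ⟪X - p, v⟫_ℝ + 2 * B * ⟪X - p, ν⟫_ℝ * ⟪v, ν⟫_ℝ) +
          (2 * A + 2 * B * ⟪v, ν⟫_ℝ ^ 2) * s := by
      funext s
      rw [(hasDerivAt_line (hasFDerivAt_quad p ν a m A B _).differentiableAt).deriv,
        (hasFDerivAt_quad p ν a m A B _).fderiv]
      have e1 : X + s • v - p = (X - p) + s • v := by abel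
      simp only [innerSL_apply_apply, e1, inner_add_left, inner_smul_left, RCLike.conj_to_real,
        real_inner_self_eq_norm_sq, hv, real_inner_comm v ν]
      ring
    rw [h1]
    have h2 : ∀ α β : ℝ, deriv (fun s : ℝ => α + β * s) 0 = β := by
      intro α β
      simp
    exact h2 _ _
  have h1 : ∑ i, ⟪stdOrthonormalBasis ℝ E i, ν⟫_ℝ ^ 2 = ‖ν‖ ^ 2 := by
    have := (stdOrthonormalBasis ℝ E).sum_sq_norm_inner_right ν
    simpa using this
  rw [Finset.sum_congr rfl fun i _ => key _ ((stdOrthonormalBasis ℝ E).orthonormal.1 i),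
    Finset.sum_add_distrib, Finset.sum_const, ← Finset.mul_sum, h1]
  simp
  ring

/-- Chain rule behind the exponential, logarithmic and radial barriers, all of which are functions
of a quadratic. -/
theorem laplacian_comp {q : E → ℝ} {g : ℝ → ℝ} {x w : E} (hq : ContDiffAt ℝ 2 q x)
    (hg : ContDiffAt ℝ 2 g (q x)) (hw : fderiv ℝ q x = innerSL ℝ w) :
    Δ (fun y => g (q y)) x = deriv (deriv g) (q x) * ‖w‖ ^ 2 + deriv g (q x) * Δ q x := by
  have hgq : ContDiffAt ℝ 2 (fun y => g (q y)) x := hg.comp x hq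
  rw [laplacian_eq_sum_lines hgq, laplacian_eq_sum_lines hq]
  have key : ∀ v : E, deriv (deriv fun s : ℝ => g (q (x + s • v))) 0 =
      deriv (deriv g) (q x) * ⟪w, v⟫_ℝ ^ 2 +
        deriv g (q x) * deriv (deriv fun s : ℝ => q (x + s • v)) 0 := by
    intro v
    have hq1 : ∀ᶠ y in 𝓝 x, DifferentiableAt ℝ q y := by
      filter_upwards [hq.eventually (by simp)] with y hy
      exact hy.differentiableAt (by simp)
    have hg1 : ∀ᶠ y in 𝓝 (q x), DifferentiableAt ℝ g y := by
      filter_upwards [hg.eventually (by simp)] with y hy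
      exact hy.differentiableAt (by simp)
    have hx : x + (0 : ℝ) • v = x := by simp
    have hqc : Tendsto (fun s : ℝ => q (x + s • v)) (𝓝 0) (𝓝 (q x)) :=
      hq.continuousAt.tendsto.comp (tendsto_line x v)
    have e1 : deriv (fun s : ℝ => g (q (x + s • v))) =ᶠ[𝓝 0]
        fun s => deriv g (q (x + s • v)) * deriv (fun s : ℝ => q (x + s • v)) s := by
      filter_upwards [(tendsto_line x v).eventually hq1, hqc.eventually hg1] with s h1 h2
      have h3 := hasDerivAt_line h1
      rw [h3.deriv]
      exact (h2.hasDerivAt.comp s h3).deriv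
    rw [e1.deriv_eq]
    have h3 : HasDerivAt (fun s : ℝ => q (x + s • v)) ⟪w, v⟫_ℝ 0 := by
      have := hasDerivAt_line (f := q) (x := x) (v := v) (t := 0)
        (by rw [hx]; exact hq.differentiableAt (by simp))
      rwa [hx, hw, innerSL_apply_apply] at this
    have h4 : HasDerivAt (deriv g) (deriv (deriv g) (q x)) (q (x + (0 : ℝ) • v)) := by
      rw [hx]
      have : ContDiffAt ℝ 1 (deriv g) (q x) := by
        have h5 := hg.fderiv_right (m := 1) (by norm_num)
        have h6 : deriv g = fun y => fderiv ℝ g y 1 := by funext y; simp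
        rw [h6]
        exact h5.clm_apply contDiffAt_const
      exact (this.differentiableAt (by simp)).hasDerivAt
    have h7 : DifferentiableAt ℝ (deriv (fun s : ℝ => q (x + s • v))) 0 := by
      rw [(eventually_deriv_line v hq).differentiableAt_iff]
      exact (hasDerivAt_fderiv_line v hq).differentiableAt
    have h8 := (h4.comp (0 : ℝ) h3).mul h7.hasDerivAt
    have h9 := h8.deriv
    rw [h3.deriv] at h9
    refine Eq.trans h9 ?_
    simp only [Function.comp, hx]
    ring
  rw [Finset.sum_congr rfl fun i _ => key _, Finset.sum_add_distrib, ← Finset.mul_sum,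
    ← Finset.mul_sum]
  have h1 : ∑ i, ⟪w, stdOrthonormalBasis ℝ E i⟫_ℝ ^ 2 = ‖w‖ ^ 2 := by
    have := (stdOrthonormalBasis ℝ E).sum_sq_norm_inner_left w
    simpa using this
  rw [h1]

theorem laplacian_comp_isometry (σ : E ≃ₗᵢ[ℝ] E) (c : E) {f : E → ℝ} {x : E}
    (hf : ContDiffAt ℝ 2 f (c + σ x)) : Δ (fun y => f (c + σ y)) x = Δ f (c + σ x) := by
  have hσ : ContDiff ℝ 2 fun y : E => c + σ y := contDiff_const.add σ.contDiff
  have hf' : ContDiffAt ℝ 2 (fun y => f (c + σ y)) x := ContDiffAt.comp x hf hσ.contDiffAt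
  rw [InnerProductSpace.laplacian_eq_iteratedFDeriv_orthonormalBasis _ (stdOrthonormalBasis ℝ E),
    InnerProductSpace.laplacian_eq_iteratedFDeriv_orthonormalBasis f
      ((stdOrthonormalBasis ℝ E).map σ)]
  refine Finset.sum_congr rfl fun i _ => ?_
  rw [← deriv_deriv_line _ hf', ← deriv_deriv_line _ hf]
  congr 2
  funext s
  simp [add_assoc]

/-- `f` is subharmonic at `X` in the viscosity sense. -/
def IsSubharmonicAt (f : E → ℝ) (X : E) : Prop :=
  ∀ φ : E → ℝ, ContDiffAt ℝ 2 φ X → IsLocalMax (fun Y => f Y - φ Y) X → 0 ≤ Δ φ X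

theorem isSubharmonicAt_of_laplacian_nonneg {f : E → ℝ} {X : E} (hf : ContDiffAt ℝ 2 f X)
    (h : 0 ≤ Δ f X) : IsSubharmonicAt f X := by
  intro φ hφ hmax
  have h1 := laplacian_nonpos_of_isLocalMax (hf.sub hφ) hmax
  have h2 := hf.laplacian_sub hφ
  have h3 : Δ (fun Y => f Y - φ Y) X = Δ f X - Δ φ X := h2
  rw [h3] at h1
  linarith

theorem isSubharmonicAt_of_harmonicAt {f : E → ℝ} {X : E}
    (hf : InnerProductSpace.HarmonicAt f X) : IsSubharmonicAt f X :=
  isSubharmonicAt_of_laplacian_nonneg hf.1 hf.2.self_of_nhds.ge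

theorem IsSubharmonicAt.congr {f g : E → ℝ} {X : E} (hf : IsSubharmonicAt f X)
    (h : f =ᶠ[𝓝 X] g) : IsSubharmonicAt g X := by
  intro φ hφ hmax
  refine hf φ hφ ?_
  have hX := h.self_of_nhds
  filter_upwards [hmax, h] with Y h1 h2
  rw [h2, hX]
  exact h1

/-- The harmonic summand is moved into the test function, whose Laplacian it does not change. -/
theorem IsSubharmonicAt.add_harmonicAt {f w : E → ℝ} {X : E} (hf : IsSubharmonicAt f X)
    (hw : InnerProductSpace.HarmonicAt w X) : IsSubharmonicAt (fun Y => f Y + w Y) X := by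
  intro φ hφ hmax
  have h1 := hf (fun Y => φ Y - w Y) (hφ.sub hw.1) (by
    filter_upwards [hmax] with Y hY
    linarith)
  have h2 : Δ (fun Y => φ Y - w Y) X = Δ φ X - Δ w X := hφ.laplacian_sub hw.1
  have h3 : Δ w X = 0 := hw.2.self_of_nhds
  linarith

end Calculus

/-! ### Maximum principles for upper semicontinuous functions on compact sets. -/

section Maximum

variable {E : Type*} [TopologicalSpace E]

/-- An upper semicontinuous function on a compact set that is nonpositive off a set where it has no
positive local maximum is nonpositive. -/
theorem nonpos_of_no_positive_max {K : Set E} {f : E → ℝ} (hK : IsCompact K)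
    (hf : UpperSemicontinuousOn f K)
    (hmax : ∀ x ∈ K, 0 < f x → IsMaxOn f K x → False) : ∀ x ∈ K, f x ≤ 0 := by
  by_contra! h
  obtain ⟨x, hx, hpos⟩ := h
  obtain ⟨y, hy, hyM⟩ := hf.exists_isMaxOn ⟨x, hx⟩ hK
  exact hmax y hy (hpos.trans_le (hyM hx)) hyM

/-- The superlevel set {f ≥ 0} is compact, so it has a last time, and that time is strictly before
`t₀`. -/
theorem exists_neg_before {K : Set (E × ℝ)} {f : E × ℝ → ℝ} {t₀ : ℝ} (hK : IsCompact K)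
    (hf : UpperSemicontinuousOn f K) (hle : ∀ p ∈ K, p.2 ≤ t₀)
    (h0 : ∀ p ∈ K, p.2 = t₀ → f p < 0) :
    ∃ σ > 0, ∀ p ∈ K, t₀ - σ ≤ p.2 → f p < 0 := by
  have hc : IsCompact (K ∩ f ⁻¹' Ici 0) := hf.isCompact_inter_preimage_Ici hK 0
  rcases (K ∩ f ⁻¹' Ici 0).eq_empty_or_nonempty with he | hne
  · refine ⟨1, one_pos, fun p hp _ => ?_⟩
    by_contra! h
    exact (he ▸ (⟨hp, h⟩ : p ∈ K ∩ f ⁻¹' Ici 0) : p ∈ (∅ : Set _))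
  · obtain ⟨q, hq, hqM⟩ := hc.exists_isMaxOn hne (continuous_snd.continuousOn)
    have hlt : q.2 < t₀ := by
      rcases (hle q hq.1).lt_or_eq with h | h
      · exact h
      · exact absurd (h0 q hq.1 h) (not_lt.2 hq.2)
    refine ⟨(t₀ - q.2) / 2, by linarith, fun p hp hpt => ?_⟩
    by_contra! h
    have : p.2 ≤ q.2 := hqM (show p ∈ K ∩ f ⁻¹' Ici 0 from ⟨hp, h⟩)
    linarith

end Maximum

/-! ### From space-time tests to subharmonic time slices. -/

section Penalization

variable {E : Type*} [NormedAddCommGroup E] [InnerProductSpace ℝ E] [FiniteDimensional ℝ E]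

/-- Kim's test functions live on all of Q, so a local test function is first cut off by a bump. -/
theorem exists_contDiff_eventuallyEq {φ : E → ℝ} {X : E} (hφ : ContDiffAt ℝ 2 φ X) :
    ∃ ψ : E → ℝ, ContDiff ℝ 2 ψ ∧ ψ =ᶠ[𝓝 X] φ := by
  obtain ⟨ε, hε, hball⟩ := Metric.eventually_nhds_iff_ball.1 (hφ.eventually (by simp))
  let χ : ContDiffBump X := ⟨ε / 4, ε / 2, by positivity, by linarith⟩
  refine ⟨fun Y => χ Y * φ Y, ?_, ?_⟩
  · rw [contDiff_iff_contDiffAt]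
    intro Y
    by_cases hY : Y ∈ Metric.ball X ε
    · exact χ.contDiffAt.mul (hball Y hY)
    · have : (fun Y => χ Y * φ Y) =ᶠ[𝓝 Y] fun _ => 0 := by
        have hd : (Metric.closedBall X (ε / 2))ᶜ ∈ 𝓝 Y := by
          refine Metric.isClosed_closedBall.isOpen_compl.mem_nhds ?_
          simp only [Metric.mem_ball, not_lt, mem_compl_iff, Metric.mem_closedBall, not_le] at hY ⊢
          linarith
        filter_upwards [hd] with Z hZ
        have : χ Z = 0 := χ.zero_of_le_dist (by
          simp only [mem_compl_iff, Metric.mem_closedBall, not_le] at hZ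
          exact hZ.le)
        simp [this]
      exact contDiffAt_const.congr_of_eventuallyEq this
  · filter_upwards [χ.eventuallyEq_one] with Y hY
    simp [hY]

theorem continuous_laplacian {ψ : E → ℝ} (hψ : ContDiff ℝ 2 ψ) : Continuous (Δ ψ) := by
  rw [InnerProductSpace.laplacian_eq_iteratedFDeriv_stdOrthonormalBasis]
  refine continuous_finsetSum _ fun i _ => ?_
  have h := hψ.continuous_iteratedFDeriv (m := 2) le_rfl
  exact (ContinuousMultilinearMap.apply ℝ (fun _ : Fin 2 => E) ℝ _).continuous.comp h

/-- If a function of space-time satisfies the subharmonicity test at the points of `G`, with test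
functions `ψ(X) + c t` and past neighbourhoods only, then its time slices are subharmonic. -/
theorem isSubharmonicAt_slice {f : E × ℝ → ℝ} {X₀ : E} {t₀ r η : ℝ} {G : Set (E × ℝ)} (hr : 0 < r)
    (hη : 0 < η) (hf : UpperSemicontinuousOn f (Metric.closedBall X₀ r ×ˢ Icc (t₀ - r) t₀))
    (hG : ∀ p ∈ Metric.closedBall X₀ r ×ˢ Icc (t₀ - r) t₀, f (X₀, t₀) - η < f p → p ∈ G)
    (htest : ∀ ψ : E → ℝ, ContDiff ℝ 2 ψ → ∀ c : ℝ, ∀ p ∈ G,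
      p ∈ Metric.ball X₀ r ×ˢ Ioc (t₀ - r) t₀ →
      IsLocalMaxOn (fun q => f q - (ψ q.1 + c * q.2)) {q | q.2 ≤ p.2} p → 0 ≤ Δ ψ p.1) :
    IsSubharmonicAt (fun X => f (X, t₀)) X₀ := by
  intro φ₀ hφ₀ hmax₀
  obtain ⟨φ, hφ, hφeq⟩ := exists_contDiff_eventuallyEq hφ₀
  have hφX := hφeq.self_of_nhds
  have hmax : IsLocalMax (fun Y => f (Y, t₀) - φ Y) X₀ := by
    filter_upwards [hmax₀, hφeq] with Y h1 h2
    rw [h2, hφX]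
    exact h1
  have hlap : Δ φ X₀ = Δ φ₀ X₀ :=
    (InnerProductSpace.laplacian_congr_nhds hφeq).self_of_nhds
  rw [← hlap]
  by_contra! hneg
  set n : ℝ := (Module.finrank ℝ E : ℝ) with hn
  have hn0 : 0 ≤ n := by positivity
  -- Adding ε ‖Y - X₀‖² makes the maximum strict; this ε still leaves the Laplacian negative.
  obtain ⟨ε, hε, hεn⟩ : ∃ ε > 0, Δ φ X₀ + 2 * n * ε < 0 := by
    refine ⟨-Δ φ X₀ / (4 * (n + 1)), by apply div_pos <;> linarith, ?_⟩
    have h1 : 2 * n * (-Δ φ X₀ / (4 * (n + 1))) = (n / (n + 1)) * (-Δ φ X₀ / 2) := by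
      field_simp; ring
    have h2 : n / (n + 1) ≤ 1 := by
      rw [div_le_one (by linarith)]; linarith
    rw [h1]
    nlinarith
  let ψ : E → ℝ := fun Y => φ Y + quad X₀ 0 0 0 ε 0 Y
  have hψ : ContDiff ℝ 2 ψ := hφ.add (contDiff_quad _ _ _ _ _ _)
  have hψval : ∀ Y, ψ Y = φ Y + ε * ‖Y - X₀‖ ^ 2 := fun Y => by simp [ψ, quad]
  have hψlap : Δ ψ X₀ < 0 := by
    have h1 : Δ ψ X₀ = Δ φ X₀ + Δ (quad X₀ (0 : E) 0 0 ε 0) X₀ :=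
      hφ.contDiffAt.laplacian_add (contDiff_quad _ _ _ _ _ _).contDiffAt
    rw [h1, laplacian_quad]
    simpa using hεn
  have hev : ∀ᶠ Y in 𝓝 X₀, Δ ψ Y < 0 ∧ f (Y, t₀) - φ Y ≤ f (X₀, t₀) - φ X₀ ∧
      φ X₀ - η < φ Y := by
    refine ((continuous_laplacian hψ).continuousAt.eventually_lt continuousAt_const hψlap).and
      (hmax.and ?_)
    exact (continuousAt_const.eventually_lt hφ.continuous.continuousAt (by linarith))
  obtain ⟨ρ₀, hρ₀, hball⟩ := Metric.eventually_nhds_iff_ball.1 hev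
  obtain ⟨ρ, hρ, hρρ₀, hρr⟩ : ∃ ρ > 0, ρ < ρ₀ ∧ ρ < r :=
    ⟨min ρ₀ r / 2, by positivity, by
      have := min_le_left ρ₀ r
      have : 0 < min ρ₀ r := lt_min hρ₀ hr
      linarith, by
      have := min_le_right ρ₀ r
      have : 0 < min ρ₀ r := lt_min hρ₀ hr
      linarith⟩
  have hB : ∀ Y ∈ Metric.closedBall X₀ ρ, Δ ψ Y < 0 ∧
      f (Y, t₀) - φ Y ≤ f (X₀, t₀) - φ X₀ ∧ φ X₀ - η < φ Y := fun Y hY =>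
    hball Y (Metric.closedBall_subset_ball hρρ₀ hY)
  set c₀ := f (X₀, t₀) - φ X₀ with hc₀
  have hbox : IsCompact (Metric.closedBall X₀ ρ ×ˢ Icc (t₀ - r) t₀) :=
    (isCompact_closedBall _ _).prod isCompact_Icc
  have hsub : Metric.closedBall X₀ ρ ×ˢ Icc (t₀ - r) t₀ ⊆
      Metric.closedBall X₀ r ×ˢ Icc (t₀ - r) t₀ :=
    prod_mono (Metric.closedBall_subset_closedBall hρr.le) Subset.rfl
  have husc : ∀ c d : ℝ, UpperSemicontinuousOn (fun p : E × ℝ => f p + (d + c * p.2 - ψ p.1))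
      (Metric.closedBall X₀ ρ ×ˢ Icc (t₀ - r) t₀) := by
    intro c d
    refine (hf.mono hsub).add (Continuous.upperSemicontinuous ?_ |>.upperSemicontinuousOn _)
    have := hψ.continuous
    fun_prop
  have hsph : IsCompact (Metric.sphere X₀ ρ ×ˢ Icc (t₀ - r) t₀) :=
    (isCompact_sphere _ _).prod isCompact_Icc
  -- On the sphere of radius ρ the strict inequality at time `t₀` survives for a short time in the
  -- past.
  obtain ⟨σ₀, hσ₀, hσ₀neg⟩ := exists_neg_before (t₀ := t₀) hsph ((husc 0 (-c₀)).mono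
    (prod_mono Metric.sphere_subset_closedBall Subset.rfl)) (fun p hp => hp.2.2) (by
      rintro ⟨Y, t⟩ ⟨hY, -⟩ ht
      simp only at ht hY ⊢
      subst ht
      have h1 := (hB Y (Metric.sphere_subset_closedBall hY)).2.1
      have h2 : ‖Y - X₀‖ = ρ := by simpa [dist_eq_norm] using hY
      rw [hψval, h2]
      have : 0 < ε * ρ ^ 2 := by positivity
      linarith)
  obtain ⟨σ, hσ, hσσ₀, hσr⟩ : ∃ σ > 0, σ ≤ σ₀ ∧ σ < r :=
    ⟨min σ₀ r / 2, by positivity, by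
      have := min_le_left σ₀ r
      have : 0 < min σ₀ r := lt_min hσ₀ hr
      linarith, by
      have := min_le_right σ₀ r
      have : 0 < min σ₀ r := lt_min hσ₀ hr
      linarith⟩
  obtain ⟨M, hM⟩ := (husc 0 0).bddAbove_of_isCompact hbox
  have hM' : ∀ p ∈ Metric.closedBall X₀ ρ ×ˢ Icc (t₀ - r) t₀, f p - ψ p.1 ≤ M := by
    intro p hp
    have := hM (mem_image_of_mem _ hp)
    simp only [zero_mul, zero_add] at this
    linarith
  -- The penalty N (t₀ - t) is steep enough to beat the bound M at t = t₀ - σ, so the space-time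
  -- maximum avoids the bottom of the box.
  obtain ⟨N, hN0, hN⟩ : ∃ N : ℝ, 0 ≤ N ∧ M - N * σ < c₀ := by
    refine ⟨(|M - c₀| + 1) / σ, by positivity, ?_⟩
    rw [div_mul_cancel₀ _ hσ.ne']
    have := le_abs_self (M - c₀)
    linarith
  have hK : IsCompact (Metric.closedBall X₀ ρ ×ˢ Icc (t₀ - σ) t₀) :=
    (isCompact_closedBall _ _).prod isCompact_Icc
  have hKsub : Metric.closedBall X₀ ρ ×ˢ Icc (t₀ - σ) t₀ ⊆
      Metric.closedBall X₀ ρ ×ˢ Icc (t₀ - r) t₀ :=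
    prod_mono Subset.rfl (Icc_subset_Icc_left (by linarith))
  have h0mem : (X₀, t₀) ∈ Metric.closedBall X₀ ρ ×ˢ Icc (t₀ - σ) t₀ :=
    ⟨by simp [hρ.le], by simp [hσ.le]⟩
  obtain ⟨⟨X₁, t₁⟩, ⟨hX₁, ht₁⟩, hmax₁⟩ :=
    ((husc N (-(N * t₀))).mono hKsub).exists_isMaxOn ⟨_, h0mem⟩ hK
  simp only at hX₁ ht₁
  have hval : c₀ ≤ f (X₁, t₁) - ψ X₁ - N * (t₀ - t₁) := by
    have h1 := hmax₁ h0mem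
    simp only [mem_ofPred_eq, hψval X₀, sub_self, norm_zero] at h1
    simp only [hc₀]
    linarith
  have hNt : 0 ≤ N * (t₀ - t₁) := mul_nonneg hN0 (by linarith [ht₁.2])
  have hX₁b : X₁ ∈ Metric.ball X₀ ρ := by
    by_contra hcon
    have hs : X₁ ∈ Metric.sphere X₀ ρ :=
      le_antisymm (Metric.mem_closedBall.1 hX₁) (not_lt.1 hcon)
    have := hσ₀neg (X₁, t₁) ⟨hs, by simp only; constructor <;> linarith [ht₁.1, ht₁.2]⟩
      (by simp only; linarith [ht₁.1])
    simp only at this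
    linarith
  have ht₁' : t₀ - σ < t₁ := by
    rcases ht₁.1.lt_or_eq with h | h
    · exact h
    · exfalso
      have h1 := hM' (X₁, t₁) (hKsub ⟨hX₁, ht₁⟩)
      have h2 : t₀ - t₁ = σ := by linarith
      rw [h2] at hval
      simp only at h1
      linarith
  -- The maximum value is at least that at (X₀, t₀), and φ varies by less than η on the ball, so f
  -- has not dropped by η.
  have hpG : (X₁, t₁) ∈ G := by
    refine hG _ (hsub (hKsub ⟨hX₁, ht₁⟩)) ?_
    have h1 := (hB X₁ hX₁).2.2
    have h2 := hψval X₁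
    have h3 : 0 ≤ ε * ‖X₁ - X₀‖ ^ 2 := by positivity
    linarith
  have hlapX₁ := htest ψ hψ (-N) (X₁, t₁) hpG
    ⟨Metric.ball_subset_ball hρr.le hX₁b, by linarith, ht₁.2⟩ (by
      have hnhds : Metric.ball X₀ ρ ×ˢ Ioi (t₀ - σ) ∈ 𝓝 (X₁, t₁) :=
        (Metric.isOpen_ball.prod isOpen_Ioi).mem_nhds ⟨hX₁b, ht₁'⟩
      filter_upwards [mem_nhdsWithin_of_mem_nhds hnhds, self_mem_nhdsWithin] with q hq hqt
      have h1 := hmax₁ (show q ∈ Metric.closedBall X₀ ρ ×ˢ Icc (t₀ - σ) t₀ from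
        ⟨Metric.ball_subset_closedBall hq.1, le_of_lt hq.2, le_trans hqt ht₁.2⟩)
      simp only [mem_ofPred_eq] at h1
      linarith)
  exact absurd hlapX₁ (not_le.2 (hB X₁ hX₁).1)

end Penalization

/-! ### Admissible test functions ψ(X) + c t, and slicewise consequences of Kim's interior test. -/

theorem isC21On_add_mul_time {d : ℕ} {ψ : Space d → ℝ} (hψ : ContDiff ℝ 2 ψ) (c : ℝ)
    (O : Set (Space d × ℝ)) : IsC21On (fun q => ψ q.1 + c * q.2) O := by
  have hs : ∀ t, slice (fun q : Space d × ℝ => ψ q.1 + c * q.2) t = fun X => ψ X + c * t :=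
    fun t => rfl
  have hf : ∀ t, fderiv ℝ (slice (fun q : Space d × ℝ => ψ q.1 + c * q.2) t) = fderiv ℝ ψ := by
    intro t
    rw [hs]
    funext X
    exact fderiv_add_const _
  have ht : ∀ p : Space d × ℝ, timeDeriv (fun q : Space d × ℝ => ψ q.1 + c * q.2) p = c := by
    intro p
    simp [timeDeriv]
  have hψ1 : ContDiff ℝ 1 (fderiv ℝ ψ) := hψ.fderiv_right (by norm_num)
  refine ⟨fun p _ => ?_, fun p _ => ?_, ?_, ?_, ?_, ?_⟩
  · rw [hs]
    exact (hψ.add contDiff_const).contDiffAt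
  · change DifferentiableAt ℝ (fun t : ℝ => ψ p.1 + c * t) p.2
    fun_prop
  · have := hψ.continuous
    fun_prop
  · simp only [hf]
    exact (hψ1.continuous.comp continuous_fst).continuousOn
  · simp only [hf]
    exact ((hψ1.continuous_fderiv (by simp)).comp continuous_fst).continuousOn
  · rw [show timeDeriv (fun q : Space d × ℝ => ψ q.1 + c * q.2) = fun _ => c from funext ht]
    exact continuousOn_const

theorem spaceLaplacian_add_mul_time {d : ℕ} {ψ : Space d → ℝ} (hψ : ContDiff ℝ 2 ψ) (c : ℝ)
    (p : Space d × ℝ) : spaceLaplacian (fun q => ψ q.1 + c * q.2) p = Δ ψ p.1 := by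
  have h : Δ (fun X => ψ X + c * p.2) p.1 = Δ ψ p.1 + Δ (fun _ : Space d => c * p.2) p.1 :=
    hψ.contDiffAt.laplacian_add contDiffAt_const
  have h2 : Δ (fun _ : Space d => c * p.2) p.1 = 0 := by
    rw [InnerProductSpace.laplacian_const]; rfl
  rw [h2, add_zero] at h
  exact h

theorem timeDeriv_add_mul_time {d : ℕ} (ψ : Space d → ℝ) (c : ℝ) (p : Space d × ℝ) :
    timeDeriv (fun q => ψ q.1 + c * q.2) p = c := by
  simp [timeDeriv]

theorem spaceGrad_add_mul_time {d : ℕ} {ψ : Space d → ℝ} {g : Space d} {p : Space d × ℝ}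
    (h : HasFDerivAt ψ (innerSL ℝ g) p.1) (c : ℝ) :
    spaceGrad (fun q => ψ q.1 + c * q.2) p = g := by
  have h1 : HasFDerivAt (slice (fun q : Space d × ℝ => ψ q.1 + c * q.2) p.2) (innerSL ℝ g) p.1 :=
    h.add_const (c * p.2)
  have h2 : HasGradientAt (slice (fun q : Space d × ℝ => ψ q.1 + c * q.2) p.2) g p.1 := by
    rw [hasGradientAt_iff_hasFDerivAt]
    refine h1.congr_fderiv ?_
    ext v
    simp
  exact h2.gradient

theorem isOpen_openHalf (d : ℕ) : IsOpen (openHalf d) := by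
  have : Continuous (height (d := d)) := by unfold height; fun_prop
  exact isOpen_lt continuous_const this

theorem isClosed_closedHalf (d : ℕ) : IsClosed (closedHalf d) := by
  have : Continuous (height (d := d)) := by unfold height; fun_prop
  exact isClosed_le continuous_const this

theorem isOpen_openCylinder (d : ℕ) : IsOpen (openCylinder d) :=
  (isOpen_openHalf d).prod isOpen_Ioi

theorem openHalf_subset_closedHalf (d : ℕ) : openHalf d ⊆ closedHalf d := fun X h =>
  le_of_lt (show 0 < height X from h)

theorem openCylinder_subset_cylinder (d : ℕ) : openCylinder d ⊆ cylinder d (Ici 0) :=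
  prod_mono (openHalf_subset_closedHalf d) Ioi_subset_Ici_self

theorem exists_box {d : ℕ} {X : Space d} {t : ℝ} {N : Set (Space d × ℝ)} (hN : N ∈ 𝓝 (X, t)) :
    ∃ r > 0, Metric.closedBall X r ×ˢ Icc (t - r) t ⊆ N := by
  obtain ⟨r, hr, h⟩ := Metric.mem_nhds_iff.1 hN
  refine ⟨r / 2, by positivity, fun p hp => h ?_⟩
  rw [Metric.mem_ball, Prod.dist_eq, max_lt_iff]
  have h1 := Metric.mem_closedBall.1 hp.1
  refine ⟨by simp only; linarith, ?_⟩
  rw [Real.dist_eq, abs_lt]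
  have h2 := hp.2.1
  have h3 := hp.2.2
  simp only at h2 h3 ⊢
  constructor <;> linarith

/-- Taking η = U(X, t) in the penalization forces U > 0 at the perturbed maximum, so Kim's interior
test applies there although {U > 0} need not be open. -/
theorem IsKimSubsolution.isSubharmonicAt {d : ℕ} {U₀ : Space d → ℝ} {U : Space d × ℝ → ℝ}
    (hU : IsKimSubsolution U₀ U) {X : Space d} {t : ℝ} (hX : X ∈ openHalf d) (ht : 0 < t)
    (hpos : 0 < U (X, t)) : IsSubharmonicAt (fun Y => U (Y, t)) X := by
  obtain ⟨r, hr, hbox⟩ := exists_box ((isOpen_openCylinder d).mem_nhds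
    (show (X, t) ∈ openCylinder d from ⟨hX, ht⟩))
  have hbox' := hbox.trans (openCylinder_subset_cylinder d)
  refine isSubharmonicAt_slice (G := {p | 0 < U p}) hr hpos (hU.usc.mono hbox')
    (fun p _ h => by simpa using h) fun ψ hψ c p hp hpb hmax => ?_
  have hpQ : p ∈ openCylinder d := hbox ⟨Metric.ball_subset_closedBall hpb.1, Ioc_subset_Icc_self hpb.2⟩
  have h := (hU.test _ (isC21On_add_mul_time hψ c _) p
    ⟨⟨subset_closure ⟨openCylinder_subset_cylinder d hpQ, hp⟩, le_refl p.2⟩, hpQ⟩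
    (hmax.on_subset fun q hq => hq.1.2)).1 hp
  rw [spaceLaplacian_add_mul_time hψ] at h
  linarith

/-- Lower semicontinuity gives U > 0 on a whole space-time box, so every perturbed extremum is an
interior test point. -/
theorem IsKimSupersolution.isSubharmonicAt_neg {d : ℕ} {U₀ : Space d → ℝ} {U : Space d × ℝ → ℝ}
    (hU : IsKimSupersolution U₀ U) {X : Space d} {t : ℝ} (hX : X ∈ openHalf d) (ht : 0 < t)
    (hpos : 0 < U (X, t)) : IsSubharmonicAt (fun Y => -U (Y, t)) X := by
  have hQ : openCylinder d ∈ 𝓝 (X, t) := (isOpen_openCylinder d).mem_nhds ⟨hX, ht⟩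
  have hpos' : ∀ᶠ p in 𝓝 (X, t), 0 < U p := by
    have h1 := hU.lsc (X, t) (openCylinder_subset_cylinder d ⟨hX, ht⟩) 0 hpos
    rwa [nhdsWithin_eq_nhds.2 (mem_of_superset hQ (openCylinder_subset_cylinder d))] at h1
  obtain ⟨r, hr, hbox⟩ := exists_box (inter_mem hQ hpos')
  have hbox' : Metric.closedBall X r ×ˢ Icc (t - r) t ⊆ cylinder d (Ici 0) :=
    fun p hp => openCylinder_subset_cylinder d (hbox hp).1
  refine isSubharmonicAt_slice (f := fun p => -U p) (G := {p | 0 < U p}) hr one_pos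
    ?_ (fun p hp _ => (hbox hp).2) fun ψ hψ c p hp hpb hmax => ?_
  · exact continuous_neg.comp_lowerSemicontinuousOn_antitone (hU.lsc.mono hbox')
      (fun a b h => neg_le_neg h)
  have hpQ : p ∈ openCylinder d :=
    (hbox ⟨Metric.ball_subset_closedBall hpb.1, Ioc_subset_Icc_self hpb.2⟩).1
  have hψ' : ContDiff ℝ 2 fun X => -ψ X := hψ.neg
  have h := (hU.test _ (isC21On_add_mul_time hψ' (-c) _) p
    ⟨⟨subset_closure ⟨openCylinder_subset_cylinder d hpQ, hp⟩, le_refl p.2⟩, hpQ⟩ (by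
      have h1 : IsLocalMaxOn (fun q => -U q - (ψ q.1 + c * q.2)) (kimTestSet U p.2) p :=
        hmax.on_subset fun q hq => hq.1.2
      filter_upwards [h1] with q hq
      linarith)).1 hp
  rw [spaceLaplacian_add_mul_time hψ'] at h
  have h2 : Δ (fun X => -ψ X) p.1 = -Δ ψ p.1 := congrFun (InnerProductSpace.laplacian_neg (f := ψ)) p.1
  rw [h2] at h
  linarith

/-! ### Linear growth at the boundary and an interior Lipschitz estimate. -/

section Boundary

variable {E : Type*} [NormedAddCommGroup E] [InnerProductSpace ℝ E] [FiniteDimensional ℝ E]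

/-- Near a point of a set lying above a paraboloid, `ℓ + A q - (n + 1) A ℓ²` controls `q`. -/
theorem paraboloid_bound {C A ρ N ℓ q : ℝ} (hℓ : |ℓ| ≤ ρ) (hN : N * ρ ≤ 1) (hN0 : 0 ≤ N)
    (hC : 0 ≤ C) (hq : 0 ≤ q) (h : -(C * q) ≤ ℓ) : (A - 2 * C) * q ≤ ℓ + A * q - N * ℓ ^ 2 := by
  have h1 : N * ℓ ^ 2 ≤ |ℓ| := by
    have : N * ℓ ^ 2 = (N * |ℓ|) * |ℓ| := by rw [← sq_abs]; ring
    rw [this]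
    have h2 : N * |ℓ| ≤ 1 := (mul_le_mul_of_nonneg_left hℓ hN0).trans hN
    nlinarith [abs_nonneg ℓ]
  have hCq : 0 ≤ C * q := mul_nonneg hC hq
  rcases abs_cases ℓ with ⟨h2, _⟩ | ⟨h2, _⟩ <;> rw [h2] at h1 <;> nlinarith

omit [FiniteDimensional ℝ E] in
theorem abs_inner_le_norm_of_unit {ν : E} (hν : ‖ν‖ = 1) (y : E) : |⟪y, ν⟫_ℝ| ≤ ‖y‖ := by
  simpa [hν] using abs_real_inner_le_norm y ν

/-- Linear growth at a boundary point, from an exterior paraboloid. -/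
theorem exists_linear_growth {f : E → ℝ} {X₀ ν : E} {r C M : ℝ} (hν : ‖ν‖ = 1) (hr : 0 < r)
    (hC : 0 ≤ C) (hf : UpperSemicontinuousOn f (Metric.closedBall X₀ r))
    (hM : ∀ X ∈ Metric.closedBall X₀ r, f X ≤ M)
    (hext : ∀ X ∈ Metric.closedBall X₀ r, 0 < f X → -(C * ‖X - X₀‖ ^ 2) ≤ ⟪X - X₀, ν⟫_ℝ)
    (hsub : ∀ X ∈ Metric.ball X₀ r, 0 < f X → IsSubharmonicAt f X) :
    ∃ lam ≥ 0, ∃ K ≥ 0, ∃ ρ > 0, ∀ X ∈ Metric.ball X₀ ρ, 0 < f X →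
      f X ≤ lam * ⟪X - X₀, ν⟫_ℝ + K * ‖X - X₀‖ ^ 2 := by
  set n : ℝ := (Module.finrank ℝ E : ℝ) with hn
  have hn0 : 0 ≤ n := by positivity
  -- Chosen so that A - 2C = 1 in `paraboloid_bound`; N = (n + 1) A then makes the barrier strictly
  -- superharmonic.
  set A : ℝ := 2 * C + 1 with hA
  have hA0 : 0 < A := by positivity
  set N : ℝ := (n + 1) * A with hN
  have hN0 : 0 < N := by positivity
  set ρ : ℝ := min r (1 / N) with hρ
  have hρ0 : 0 < ρ := lt_min hr (by positivity)
  have hρr : ρ ≤ r := min_le_left _ _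
  have hNρ : N * ρ ≤ 1 := by
    calc N * ρ ≤ N * (1 / N) := mul_le_mul_of_nonneg_left (min_le_right _ _) hN0.le
      _ = 1 := by field_simp
  -- On the sphere of radius ρ the barrier is at least lam ρ² = |M| + 1, which exceeds f.
  set lam : ℝ := (|M| + 1) / ρ ^ 2 with hlam
  have hlam0 : 0 < lam := by positivity
  set h : E → ℝ := quad X₀ ν 0 lam (lam * A) (-(lam * N)) with hh
  have hval : ∀ X, h X = lam * (⟪X - X₀, ν⟫_ℝ + A * ‖X - X₀‖ ^ 2 - N * ⟪X - X₀, ν⟫_ℝ ^ 2) := by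
    intro X; simp only [hh, quad]; ring
  have hlap : ∀ X, Δ h X < 0 := by
    intro X
    rw [hh, laplacian_quad, hν, ← hn, hN]
    nlinarith [mul_pos hlam0 hA0]
  have hhc : Continuous h := (contDiff_quad X₀ ν 0 lam (lam * A) (-(lam * N)) (k := 0)).continuous
  set K : Set E := Metric.closedBall X₀ ρ ∩ {X | -(C * ‖X - X₀‖ ^ 2) ≤ ⟪X - X₀, ν⟫_ℝ} with hK
  have hcl : IsClosed {X : E | -(C * ‖X - X₀‖ ^ 2) ≤ ⟪X - X₀, ν⟫_ℝ} :=
    isClosed_le (by fun_prop) (by fun_prop)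
  have hKc : IsCompact K := (isCompact_closedBall _ _).inter_right hcl
  have hKsub : K ⊆ Metric.closedBall X₀ r := fun X hX => Metric.closedBall_subset_closedBall hρr hX.1
  have hlow : ∀ X ∈ K, lam * ‖X - X₀‖ ^ 2 ≤ h X := by
    intro X hX
    have h1 : ‖X - X₀‖ ≤ ρ := by simpa [dist_eq_norm] using hX.1
    have h2 := paraboloid_bound (A := A) ((abs_inner_le_norm_of_unit hν (X - X₀)).trans h1) hNρ
      hN0.le hC (sq_nonneg ‖X - X₀‖) hX.2
    rw [hval]
    refine mul_le_mul_of_nonneg_left ?_ hlam0.le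
    have : A - 2 * C = 1 := by rw [hA]; ring
    rw [this] at h2
    linarith
  have husc : UpperSemicontinuousOn (fun X => f X + -h X) K :=
    (hf.mono hKsub).add ((hhc.neg).upperSemicontinuous.upperSemicontinuousOn K)
  have hmain := nonpos_of_no_positive_max hKc husc (by
    intro X hX hpos hmax
    have hhX : 0 ≤ h X := le_trans (by positivity) (hlow X hX)
    have hfX : 0 < f X := by linarith
    have hXb : X ∈ Metric.ball X₀ ρ := by
      by_contra hcon
      have h1 : ‖X - X₀‖ = ρ := by
        rw [← dist_eq_norm]
        exact le_antisymm (Metric.mem_closedBall.1 hX.1) (not_lt.1 hcon)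
      have h2 := hlow X hX
      rw [h1, hlam, div_mul_cancel₀ _ (by positivity)] at h2
      have := hM X (hKsub hX)
      linarith [le_abs_self M]
    have hloc : IsLocalMax (fun Y => f Y - h Y) X := by
      -- K need not be a neighbourhood of X. Off K one has f ≤ 0, and continuity of h keeps -h below
      -- the positive maximum value.
      have h1 : ∀ᶠ Y in 𝓝 X, -h Y < f X - h X :=
        hhc.neg.continuousAt.eventually_lt continuousAt_const
          (by rw [Pi.neg_apply]; linarith)
      filter_upwards [h1, Metric.isOpen_ball.mem_nhds hXb] with Y hY hYb
      by_cases hYK : Y ∈ K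
      · have : f Y + -h Y ≤ f X + -h X := hmax hYK
        linarith
      · have hfY : f Y ≤ 0 := by
          by_contra! hcon
          exact hYK ⟨Metric.ball_subset_closedBall hYb,
            hext Y (Metric.ball_subset_closedBall (Metric.ball_subset_ball hρr hYb)) hcon⟩
        linarith
    have := hsub X (Metric.ball_subset_ball hρr hXb) hfX h
      (contDiff_quad _ _ _ _ _ _).contDiffAt hloc
    linarith [hlap X])
  refine ⟨lam, hlam0.le, lam * A, by positivity, ρ, hρ0, fun X hX hfX => ?_⟩
  have hXr := Metric.ball_subset_closedBall (Metric.ball_subset_ball hρr hX)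
  have h1 := hmain X ⟨Metric.ball_subset_closedBall hX, hext X hXr hfX⟩
  have h2 := hval X
  have h3 : 0 ≤ lam * (N * ⟪X - X₀, ν⟫_ℝ ^ 2) := by positivity
  linarith

/-- Interior Lipschitz estimate for bounded harmonic functions, by odd reflection. -/
theorem harmonic_sub_le {u : E → ℝ} {x₀ x : E} {R M : ℝ} (hR : 0 < R)
    (hu : InnerProductSpace.HarmonicOnNhd u (Metric.ball x₀ R))
    (hM : ∀ y ∈ Metric.ball x₀ R, |u y| ≤ M) (hx : ‖x - x₀‖ ≤ R / 4) :
    u x - u x₀ ≤ 2 * (Module.finrank ℝ E + 2) * M * ‖x - x₀‖ / R := by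
  rcases eq_or_ne x x₀ with rfl | hne
  · simp
  have hδ : 0 < ‖x - x₀‖ := norm_pos_iff.2 (sub_ne_zero.2 hne)
  set δ : ℝ := ‖x - x₀‖ with hδdef
  set e : E := δ⁻¹ • (x - x₀) with he
  have hen : ‖e‖ = 1 := by
    rw [he, norm_smul, ← hδdef, norm_inv, Real.norm_of_nonneg hδ.le, inv_mul_cancel₀ hδ.ne']
  have hxe : x - x₀ = δ • e := by rw [he, smul_inv_smul₀ hδ.ne']
  -- The midpoint of x₀ and x: reflection through the hyperplane orthogonal to e at c exchanges the
  -- two points.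
  set c : E := x₀ + (δ / 2) • e with hc
  have hM0 : 0 ≤ M := (abs_nonneg _).trans (hM x₀ (Metric.mem_ball_self hR))
  set n : ℝ := (Module.finrank ℝ E : ℝ) with hn
  have hn0 : 0 ≤ n := by positivity
  set ρ : ℝ := R / 2 with hρ
  have hρ0 : 0 < ρ := by positivity
  let σ : E ≃ₗᵢ[ℝ] E := (ℝ ∙ e)ᗮ.reflection
  have hσ : ∀ z : E, σ z = z - (2 * ⟪z, e⟫_ℝ) • e := by
    intro z
    have h1 : σ z = z - (2 : ℝ) • ((ℝ ∙ e).starProjection z) := by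
      simp only [σ]
      rw [Submodule.reflection_orthogonal_apply, Submodule.reflection_apply]
      simp [two_smul]
    rw [h1, Submodule.starProjection_unit_singleton ℝ hen, smul_smul, real_inner_comm]
  have hcx₀ : ‖c - x₀‖ = δ / 2 := by
    rw [hc, add_sub_cancel_left, norm_smul, hen, mul_one, Real.norm_of_nonneg (by positivity)]
  have hball : ∀ z : E, ‖z‖ ≤ ρ → c + z ∈ Metric.ball x₀ R := by
    intro z hz
    rw [Metric.mem_ball, dist_eq_norm]
    calc ‖c + z - x₀‖ = ‖(c - x₀) + z‖ := by congr 1; abel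
      _ ≤ ‖c - x₀‖ + ‖z‖ := norm_add_le _ _
      _ ≤ R / 8 + R / 2 := by rw [hcx₀]; linarith
      _ < R := by linarith
  -- Harmonic, bounded by 2M and zero on the hyperplane ⟪z, e⟫ = 0, so a barrier on the half ball
  -- bounds it linearly in ⟪z, e⟫.
  let g : E → ℝ := fun z => u (c + z) - u (c + σ z)
  have hcd : ∀ z : E, ‖z‖ ≤ ρ → ContDiffAt ℝ 2 u (c + z) := fun z hz => (hu _ (hball z hz)).1
  have hcd1 : ∀ z : E, ‖z‖ ≤ ρ → ContDiffAt ℝ 2 (fun y => u (c + y)) z := fun z hz =>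
    ContDiffAt.comp z (hcd z hz) (contDiff_const.add contDiff_id).contDiffAt
  have hcd2 : ∀ z : E, ‖z‖ ≤ ρ → ContDiffAt ℝ 2 (fun y => u (c + σ y)) z := fun z hz =>
    ContDiffAt.comp z (hcd (σ z) (by simpa using hz)) (contDiff_const.add σ.contDiff).contDiffAt
  have hgc : ∀ z : E, ‖z‖ ≤ ρ → ContDiffAt ℝ 2 g z := fun z hz => (hcd1 z hz).sub (hcd2 z hz)
  have hglap : ∀ z : E, ‖z‖ ≤ ρ → Δ g z = 0 := by
    intro z hz
    have h1 : Δ g z = Δ (fun y => u (c + y)) z - Δ (fun y => u (c + σ y)) z :=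
      (hcd1 z hz).laplacian_sub (hcd2 z hz)
    have h2 : Δ (fun y => u (c + y)) z = Δ u (c + z) :=
      laplacian_comp_isometry (LinearIsometryEquiv.refl ℝ E) c (hcd z hz)
    rw [h1, h2, laplacian_comp_isometry σ c (hcd (σ z) (by simpa using hz)),
      (hu _ (hball z hz)).2.self_of_nhds, (hu _ (hball (σ z) (by simpa using hz))).2.self_of_nhds]
    simp
  -- Makes the barrier at least 2M on the spherical part; the extra κ supplies strictness and is
  -- removed at the end.
  set lam : ℝ := 2 * M / ρ ^ 2 with hlam
  have hlam0 : 0 ≤ lam := by positivity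
  have hmain : ∀ κ > 0, g ((δ / 2) • e) ≤
      (lam + κ) * ((δ / 2) ^ 2 + (n + 1) * (δ / 2) * (ρ - δ / 2)) := by
    intro κ hκ
    set h : E → ℝ := quad 0 e 0 ((lam + κ) * ((n + 1) * ρ)) (lam + κ) (-((lam + κ) * (n + 1)))
      with hh
    have hval : ∀ z, h z = (lam + κ) * (‖z‖ ^ 2 + (n + 1) * ⟪z, e⟫_ℝ * (ρ - ⟪z, e⟫_ℝ)) := by
      intro z; simp only [hh, quad, sub_zero]; ring
    have hlap : ∀ z, Δ h z < 0 := by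
      intro z
      rw [hh, laplacian_quad, hen, ← hn]
      nlinarith
    have hhcd : ContDiff ℝ 2 h := contDiff_quad _ _ _ _ _ _
    set K : Set E := Metric.closedBall 0 ρ ∩ {z | 0 ≤ ⟪z, e⟫_ℝ} with hK
    have hKc : IsCompact K := (isCompact_closedBall _ _).inter_right
      (isClosed_le continuous_const (by fun_prop))
    have hKn : ∀ z ∈ K, ‖z‖ ≤ ρ := fun z hz => by simpa using hz.1
    have hcont : ContinuousOn (fun z => g z - h z) K := fun z hz =>
      ((hgc z (hKn z hz)).continuousAt.sub hhcd.continuous.continuousAt).continuousWithinAt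
    have hres := nonpos_of_no_positive_max hKc hcont.upperSemicontinuousOn (by
      intro z hz hpos hmax
      have hzn := hKn z hz
      have hze : 0 ≤ ⟪z, e⟫_ℝ := hz.2
      have hzeρ : ⟪z, e⟫_ℝ ≤ ρ :=
        (le_abs_self _).trans ((abs_inner_le_norm_of_unit hen z).trans hzn)
      have hmul : 0 ≤ (n + 1) * ⟪z, e⟫_ℝ * (ρ - ⟪z, e⟫_ℝ) :=
        mul_nonneg (by positivity) (by linarith)
      have hlκ : 0 < lam + κ := by linarith
      rcases hzn.lt_or_eq with hlt | heq
      · rcases hze.lt_or_eq with hlt' | heq'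
        · have hopen : Metric.ball (0 : E) ρ ∩ {z | 0 < ⟪z, e⟫_ℝ} ∈ 𝓝 z :=
            (Metric.isOpen_ball.inter (isOpen_lt continuous_const (by fun_prop))).mem_nhds
              ⟨by simpa using hlt, hlt'⟩
          have hloc : IsLocalMax (fun z => g z - h z) z := by
            filter_upwards [hopen] with y hy
            exact hmax (show y ∈ K from ⟨Metric.ball_subset_closedBall hy.1,
              le_of_lt (show 0 < ⟪y, e⟫_ℝ from hy.2)⟩)
          have := isSubharmonicAt_of_laplacian_nonneg (hgc z hzn) (hglap z hzn).ge h
            hhcd.contDiffAt hloc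
          linarith [hlap z]
        · have h1 : g z = 0 := by
            simp only [g, hσ z, ← heq']
            simp
          rw [h1, hval] at hpos
          have : 0 ≤ (lam + κ) * (‖z‖ ^ 2 + (n + 1) * ⟪z, e⟫_ℝ * (ρ - ⟪z, e⟫_ℝ)) := by positivity
          linarith
      · have h1 : g z ≤ 2 * M := by
          have h2 := hM _ (hball z hzn)
          have h3 := hM _ (hball (σ z) (by simpa using hzn))
          have h4 := abs_le.1 h2
          have h5 := abs_le.1 h3
          simp only [g]
          linarith [h4.2, h5.1]
        rw [hval, heq] at hpos
        have h2 : lam * ρ ^ 2 = 2 * M := by rw [hlam]; field_simp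
        nlinarith [mul_nonneg hlκ.le hmul, mul_pos hκ (pow_pos hρ0 2)])
    have hmem : (δ / 2) • e ∈ K := by
      constructor
      · rw [mem_closedBall_zero_iff, norm_smul, hen, mul_one, Real.norm_of_nonneg (by positivity)]
        linarith
      · simp only [mem_ofPred_eq, inner_smul_left, real_inner_self_eq_norm_sq, hen]
        simp only [RCLike.conj_to_real, one_pow, mul_one]
        positivity
    have h1 := hres _ hmem
    have h2 := hval ((δ / 2) • e)
    rw [norm_smul, hen, inner_smul_left, real_inner_self_eq_norm_sq, hen,
      Real.norm_of_nonneg (by positivity)] at h2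
    simp only [RCLike.conj_to_real, one_pow, mul_one] at h2
    linarith
  have hlim : g ((δ / 2) • e) ≤ lam * ((δ / 2) ^ 2 + (n + 1) * (δ / 2) * (ρ - δ / 2)) := by
    have hρδ : 0 ≤ ρ - δ / 2 := by linarith
    refine le_of_forall_pos_le_add fun ε hε => ?_
    set T := (δ / 2) ^ 2 + (n + 1) * (δ / 2) * (ρ - δ / 2) with hT
    have hT0 : 0 ≤ T := by positivity
    have h1 := hmain (ε / (T + 1)) (by positivity)
    have h2 : ε / (T + 1) * T ≤ ε := by
      rw [div_mul_eq_mul_div, div_le_iff₀ (by positivity)]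
      nlinarith
    linarith
  have hgx : g ((δ / 2) • e) = u x - u x₀ := by
    have h1 : c + (δ / 2) • e = x := by
      rw [hc, add_assoc, ← add_smul, add_halves, ← hxe]; abel
    have h2 : c + σ ((δ / 2) • e) = x₀ := by
      rw [hσ, inner_smul_left, real_inner_self_eq_norm_sq, hen, hc]
      simp only [RCLike.conj_to_real, one_pow, mul_one]
      rw [show 2 * (δ / 2) = δ / 2 + δ / 2 by ring, add_smul]
      abel
    simp only [g, h1, h2]
  rw [hgx] at hlim
  refine hlim.trans ?_
  have h1 : (δ / 2) ^ 2 + (n + 1) * (δ / 2) * (ρ - δ / 2) ≤ (n + 2) * (δ / 2) * ρ := by nlinarith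
  calc lam * ((δ / 2) ^ 2 + (n + 1) * (δ / 2) * (ρ - δ / 2))
      ≤ lam * ((n + 2) * (δ / 2) * ρ) := mul_le_mul_of_nonneg_left h1 hlam0
    _ ≤ 2 * (n + 2) * M * δ / R := by
      rw [hlam, hρ]
      apply le_of_eq
      field_simp

end Boundary

/-! ### Quantitative Hopf lemma. -/

section Hopf

variable {E : Type*} [NormedAddCommGroup E] [InnerProductSpace ℝ E] [FiniteDimensional ℝ E]

/-- The last factor shows that, for positive a and k, the barrier is strictly subharmonic outside a
small ball as soon as k is large. -/
theorem laplacian_exp_barrier (p : E) (a k b : ℝ) (X : E) :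
    Δ (fun Y => a * (Real.exp (-(k * ‖Y - p‖ ^ 2)) - b)) X =
      a * k * Real.exp (-(k * ‖X - p‖ ^ 2)) * (4 * k * ‖X - p‖ ^ 2 - 2 * Module.finrank ℝ E) := by
  have hq : (quad p (0 : E) 0 0 1 0) = fun Y => ‖Y - p‖ ^ 2 := by
    funext Y; simp [quad]
  have hg1 : ∀ u : ℝ, HasDerivAt (fun u => a * (Real.exp (-(k * u)) - b))
      (-(a * k) * Real.exp (-(k * u))) u := by
    intro u
    have h1 : HasDerivAt (fun u : ℝ => -(k * u)) (-k) u := by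
      simpa using (hasDerivAt_id u).const_mul (-k)
    refine ((h1.exp.sub_const b).const_mul a).congr_deriv ?_
    ring
  have hd : deriv (fun u => a * (Real.exp (-(k * u)) - b)) =
      fun u => -(a * k) * Real.exp (-(k * u)) := funext fun u => (hg1 u).deriv
  have hg2 : ∀ u : ℝ, HasDerivAt (fun u => -(a * k) * Real.exp (-(k * u)))
      (a * k ^ 2 * Real.exp (-(k * u))) u := by
    intro u
    have h1 : HasDerivAt (fun u : ℝ => -(k * u)) (-k) u := by
      simpa using (hasDerivAt_id u).const_mul (-k)
    refine (h1.exp.const_mul (-(a * k))).congr_deriv ?_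
    ring
  have h := laplacian_comp (q := quad p (0 : E) 0 0 1 0)
    (g := fun u => a * (Real.exp (-(k * u)) - b)) (x := X)
    (contDiff_quad _ _ _ _ _ _).contDiffAt (by fun_prop) (hasFDerivAt_quad p 0 0 0 1 0 X).fderiv
  rw [laplacian_quad, hd, (hg2 _).deriv, hq] at h
  refine h.trans ?_
  simp only [smul_zero, zero_add, norm_smul, mul_one, norm_zero]
  norm_num
  ring

set_option maxHeartbeats 1000000 in
/-- Hopf's boundary lemma, in the form of an improvement of the slope of a linear lower bound at
a boundary point with an interior paraboloid. -/
theorem exists_slope_improvement {C θ η : ℝ} (hC : 0 ≤ C) (hθ : 0 < θ) (hθ1 : θ < 1)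
    (hη : 0 < η) : ∃ c > 0, ∃ κ > 0, ∀ (g : E → ℝ) (X₀ ν : E) (Ω : Set E) (r α K s : ℝ),
      ‖ν‖ = 1 → IsOpen Ω → 0 < s → 2 * s < r → 0 ≤ K → (K + 1) * s ≤ κ →
      LowerSemicontinuousOn g (closure Ω ∩ Metric.ball X₀ r) →
      (∀ X ∈ Ω ∩ Metric.ball X₀ r, IsSubharmonicAt (fun Y => -g Y) X) →
      (∀ X ∈ closure Ω ∩ Metric.ball X₀ r, α * ⟪X - X₀, ν⟫_ℝ - K * ‖X - X₀‖ ^ 2 ≤ g X) →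
      (∀ X ∈ closure Ω ∩ Metric.ball X₀ r, X ∉ Ω → ⟪X - X₀, ν⟫_ℝ ≤ C * ‖X - X₀‖ ^ 2) →
      (∀ X ∈ closure Ω, ‖X - (X₀ + s • ν)‖ ≤ θ * s → α * ⟪X - X₀, ν⟫_ℝ + η * s ≤ g X) →
      ∃ K' ≥ 0, ∃ ρ > 0, ∀ X ∈ closure Ω ∩ Metric.ball X₀ ρ,
        (α + c) * ⟪X - X₀, ν⟫_ℝ - K' * ‖X - X₀‖ ^ 2 ≤ g X := by
  set n : ℝ := (Module.finrank ℝ E : ℝ) with hn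
  have hn0 : 0 ≤ n := by positivity
  -- Gives k θ² = n + θ², hence 4kτ - 2n ≥ 4θ² throughout the annulus θ² ≤ τ = ‖X - Z‖² / s² ≤ 1.
  set k : ℝ := n / θ ^ 2 + 1 with hk
  have hk0 : 0 < k := by positivity
  have hkθ : k * θ ^ 2 = n + θ ^ 2 := by rw [hk]; field_simp
  -- At a boundary point of Ω in the ball v ≤ 2ηkℓ ≤ K₁ ‖X - X₀‖², so this extra quadratic loss
  -- makes the barrier admissible there.
  set K₁ : ℝ := 2 * η * k * C with hK₁
  have hK₁0 : 0 ≤ K₁ := by positivity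
  -- Lower bound for s Δv in the annulus; the smallness of (K + 1) s lets it dominate the Laplacian
  -- of the quadratic error.
  set μ : ℝ := η * k * Real.exp (-k) * (4 * θ ^ 2) with hμ
  have hμ0 : 0 < μ := by positivity
  set a : ℝ := 2 * n * (1 + K₁) with ha
  have ha0 : 0 ≤ a := by positivity
  refine ⟨2 * η * k * Real.exp (-k), by positivity, μ / (a + 1), by positivity, ?_⟩
  intro g X₀ ν Ω r α K s hν hΩ hs hsr hK hKs hg hsuper hlow hbdry hball
  set Z : E := X₀ + s • ν with hZ
  have hdist : ∀ X : E, ‖X - Z‖ ^ 2 = ‖X - X₀‖ ^ 2 - 2 * s * ⟪X - X₀, ν⟫_ℝ + s ^ 2 := by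
    intro X
    have h1 : X - Z = (X - X₀) - s • ν := by rw [hZ]; abel
    rw [h1, norm_sub_sq_real, inner_smul_right, norm_smul, hν, mul_one, Real.norm_eq_abs, sq_abs]
    ring
  have hdist' : ∀ X : E, 1 - ‖X - Z‖ ^ 2 / s ^ 2 =
      (2 * s * ⟪X - X₀, ν⟫_ℝ - ‖X - X₀‖ ^ 2) / s ^ 2 := by
    intro X; rw [hdist]; field_simp; ring
  -- Zero on the outer sphere ‖X - Z‖ = s, which passes through X₀, and below the excess η s on the
  -- inner sphere. Its convexity in the exponent gives the slope 2ηk exp(-k) at X₀ in direction ν.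
  set v : E → ℝ := fun X => η * s * (Real.exp (-(k / s ^ 2 * ‖X - Z‖ ^ 2)) - Real.exp (-k)) with hv
  have hexp : ∀ X : E, Real.exp (-(k / s ^ 2 * ‖X - Z‖ ^ 2)) =
      Real.exp (-k) * Real.exp (k * (1 - ‖X - Z‖ ^ 2 / s ^ 2)) := by
    intro X; rw [← Real.exp_add]; congr 1; ring
  have hvlow : ∀ X : E, 2 * η * k * Real.exp (-k) * ⟪X - X₀, ν⟫_ℝ -
      η * k * Real.exp (-k) / s * ‖X - X₀‖ ^ 2 ≤ v X := by
    intro X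
    have h1 := Real.add_one_le_exp (k * (1 - ‖X - Z‖ ^ 2 / s ^ 2))
    have h2 : η * s * (Real.exp (-k) * (k * (1 - ‖X - Z‖ ^ 2 / s ^ 2))) ≤ v X := by
      simp only [hv, hexp X]
      refine mul_le_mul_of_nonneg_left ?_ (by positivity)
      nlinarith [Real.exp_pos (-k)]
    refine le_trans (le_of_eq ?_) h2
    rw [hdist']
    field_simp
  have hvup : ∀ X : E, ‖X - Z‖ ≤ s → v X ≤ 2 * η * k * ⟪X - X₀, ν⟫_ℝ := by
    intro X hX
    set T : ℝ := k * (1 - ‖X - Z‖ ^ 2 / s ^ 2) with hT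
    have hT0 : 0 ≤ T := by
      refine mul_nonneg hk0.le ?_
      rw [sub_nonneg, div_le_one (by positivity)]
      exact pow_le_pow_left₀ (norm_nonneg _) hX 2
    have h1 : Real.exp (-(k / s ^ 2 * ‖X - Z‖ ^ 2)) - Real.exp (-k) ≤ T := by
      have h2 := Real.add_one_le_exp (-T)
      have h3 : Real.exp (-k) = Real.exp (-(k / s ^ 2 * ‖X - Z‖ ^ 2)) * Real.exp (-T) := by
        rw [← Real.exp_add]; congr 1; rw [hT]; ring
      have h4 : Real.exp (-(k / s ^ 2 * ‖X - Z‖ ^ 2)) ≤ 1 := Real.exp_le_one_iff.2 (by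
        have : 0 ≤ k / s ^ 2 * ‖X - Z‖ ^ 2 := by positivity
        linarith)
      rw [h3]
      nlinarith [Real.exp_pos (-(k / s ^ 2 * ‖X - Z‖ ^ 2))]
    have h5 : v X ≤ η * s * T := mul_le_mul_of_nonneg_left h1 (by positivity)
    refine h5.trans ?_
    rw [hT, hdist']
    have h6 : η * s * (k * ((2 * s * ⟪X - X₀, ν⟫_ℝ - ‖X - X₀‖ ^ 2) / s ^ 2)) =
        2 * η * k * ⟪X - X₀, ν⟫_ℝ - η * k / s * ‖X - X₀‖ ^ 2 := by
      field_simp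
    rw [h6]
    have : 0 ≤ η * k / s * ‖X - X₀‖ ^ 2 := by positivity
    linarith
  -- Comparing -g with this strictly superharmonic function is the claim g ≥ αℓ - (K + K₁) ‖X - X₀‖²
  -- + v on the annulus.
  set φ : E → ℝ := fun X => quad X₀ ν 0 (-α) (K + K₁) 0 X - v X with hφ
  have hvcd : ContDiff ℝ 2 v := by
    have h1 : ContDiff ℝ 2 fun X : E => ‖X - Z‖ ^ 2 := (contDiff_id.sub contDiff_const).norm_sq ℝ
    exact contDiff_const.mul (((contDiff_const.mul h1).neg.exp).sub contDiff_const)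
  have hφcd : ContDiff ℝ 2 φ := (contDiff_quad _ _ _ _ _ _).sub hvcd
  have hφlap : ∀ X : E, θ * s ≤ ‖X - Z‖ → ‖X - Z‖ ≤ s → Δ φ X < 0 := by
    intro X h1 h2
    have h3 : Δ φ X = Δ (quad X₀ ν 0 (-α) (K + K₁) 0) X - Δ v X :=
      (contDiff_quad _ _ _ _ _ _).contDiffAt.laplacian_sub hvcd.contDiffAt
    rw [h3, laplacian_quad, hv, laplacian_exp_barrier, ← hn]
    set τ : ℝ := ‖X - Z‖ ^ 2 / s ^ 2 with hτ
    have hτ1 : τ ≤ 1 := by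
      rw [hτ, div_le_one (by positivity)]
      exact pow_le_pow_left₀ (norm_nonneg _) h2 2
    have hτ2 : θ ^ 2 ≤ τ := by
      rw [hτ, le_div_iff₀ (by positivity), ← mul_pow]
      exact pow_le_pow_left₀ (by positivity) h1 2
    have h4 : η * s * (k / s ^ 2) * Real.exp (-(k / s ^ 2 * ‖X - Z‖ ^ 2)) *
        (4 * (k / s ^ 2) * ‖X - Z‖ ^ 2 - 2 * n) =
        η * k * Real.exp (-(k * τ)) * (4 * (k * τ) - 2 * n) / s := by
      have : k / s ^ 2 * ‖X - Z‖ ^ 2 = k * τ := by rw [hτ]; ring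
      rw [mul_assoc 4, this]
      field_simp
    have h5 : μ ≤ η * k * Real.exp (-(k * τ)) * (4 * (k * τ) - 2 * n) := by
      have h6 : Real.exp (-k) ≤ Real.exp (-(k * τ)) := Real.exp_le_exp.2 (by nlinarith)
      have h7 : 4 * θ ^ 2 ≤ 4 * (k * τ) - 2 * n := by nlinarith
      rw [hμ]
      exact mul_le_mul (mul_le_mul_of_nonneg_left h6 (by positivity)) h7 (by positivity)
        (by positivity)
    have h8 : 2 * n * (K + K₁) * s < μ := by
      have h9 : 2 * n * (K + K₁) * s ≤ a * ((K + 1) * s) := by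
        have : 2 * n * (K + K₁) * s = (2 * n * s) * (K + K₁) := by ring
        rw [this, ha]
        have h10 : 2 * n * (1 + K₁) * ((K + 1) * s) = (2 * n * s) * ((1 + K₁) * (K + 1)) := by ring
        rw [h10]
        refine mul_le_mul_of_nonneg_left ?_ (by positivity)
        linarith [mul_nonneg hK hK₁0]
      refine (h9.trans (mul_le_mul_of_nonneg_left hKs ha0)).trans_lt ?_
      rw [mul_div_assoc', div_lt_iff₀ (by positivity)]
      linarith
    rw [h4]
    have h11 : 2 * n * (K + K₁) < η * k * Real.exp (-(k * τ)) * (4 * (k * τ) - 2 * n) / s := by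
      rw [lt_div_iff₀ hs]
      exact h8.trans_le h5
    linarith
  set D : Set E := closure Ω ∩ (Metric.closedBall Z s ∩ {X | θ * s ≤ ‖X - Z‖}) with hD
  have hDc : IsCompact D :=
    ((isCompact_closedBall Z s).inter_right (isClosed_le continuous_const (by fun_prop))).inter_left
      isClosed_closure
  have hDball : ∀ X ∈ Metric.closedBall Z s, X ∈ Metric.ball X₀ r := by
    intro X hX
    have h1 : ‖X - Z‖ ≤ s := by simpa [dist_eq_norm] using hX
    rw [Metric.mem_ball, dist_eq_norm]
    calc ‖X - X₀‖ = ‖(X - Z) + s • ν‖ := by congr 1; rw [hZ]; abel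
      _ ≤ ‖X - Z‖ + ‖s • ν‖ := norm_add_le _ _
      _ ≤ s + s := by
        rw [norm_smul, hν, mul_one, Real.norm_of_nonneg hs.le]; linarith
      _ < r := by linarith
  have husc : UpperSemicontinuousOn (fun X => -g X + -φ X) D := by
    have h1 : UpperSemicontinuousOn (fun X => -g X) D :=
      continuous_neg.comp_lowerSemicontinuousOn_antitone
        (hg.mono fun X hX => ⟨hX.1, hDball X hX.2.1⟩) (fun a b h => neg_le_neg h)
    exact h1.add (hφcd.continuous.neg.upperSemicontinuous.upperSemicontinuousOn D)
  have hφval : ∀ X, φ X = -(α * ⟪X - X₀, ν⟫_ℝ) + (K + K₁) * ‖X - X₀‖ ^ 2 - v X := by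
    intro X; simp only [hφ, quad]; ring
  have hmain := nonpos_of_no_positive_max hDc husc (by
    intro X hX hpos hmax
    have hXZ : ‖X - Z‖ ≤ s := by simpa [dist_eq_norm] using hX.2.1
    have hXθ : θ * s ≤ ‖X - Z‖ := hX.2.2
    have hXr := hDball X hX.2.1
    have hlowX := hlow X ⟨hX.1, hXr⟩
    have hφX := hφval X
    have hKq : 0 ≤ K * ‖X - X₀‖ ^ 2 := by positivity
    have hK₁q : 0 ≤ K₁ * ‖X - X₀‖ ^ 2 := by positivity
    have hvX : v X < η * s := by
      have h1 : Real.exp (-(k / s ^ 2 * ‖X - Z‖ ^ 2)) ≤ 1 := Real.exp_le_one_iff.2 (by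
        have : 0 ≤ k / s ^ 2 * ‖X - Z‖ ^ 2 := by positivity
        linarith)
      have h2 : 0 < η * s := by positivity
      simp only [hv]
      nlinarith [Real.exp_pos (-k)]
    have hXΩ : X ∈ Ω := by
      by_contra hcon
      have h1 := hbdry X ⟨hX.1, hXr⟩ hcon
      have h2 := hvup X hXZ
      have h3 : 2 * η * k * ⟪X - X₀, ν⟫_ℝ ≤ K₁ * ‖X - X₀‖ ^ 2 := by
        rw [hK₁, mul_assoc _ C]
        exact mul_le_mul_of_nonneg_left h1 (by positivity)
      linarith
    have hlt1 : θ * s < ‖X - Z‖ := by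
      rcases hXθ.lt_or_eq with h | h
      · exact h
      · have := hball X hX.1 h.ge
        linarith
    have hlt2 : ‖X - Z‖ < s := by
      rcases hXZ.lt_or_eq with h | h
      · exact h
      · have : v X = 0 := by
          simp only [hv, h]
          rw [div_mul_cancel₀ _ (by positivity), sub_self, mul_zero]
        linarith
    have ho1 : IsOpen {Y : E | θ * s < ‖Y - Z‖} := isOpen_lt continuous_const (by fun_prop)
    have ho2 : IsOpen {Y : E | ‖Y - Z‖ < s} := isOpen_lt (by fun_prop) continuous_const
    have hnhds : Ω ∩ ({Y | θ * s < ‖Y - Z‖} ∩ {Y | ‖Y - Z‖ < s}) ∈ 𝓝 X :=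
      (hΩ.inter (ho1.inter ho2)).mem_nhds ⟨hXΩ, hlt1, hlt2⟩
    have hloc : IsLocalMax (fun Y => -g Y - φ Y) X := by
      filter_upwards [hnhds] with Y hY
      have h1 := hmax (show Y ∈ D from ⟨subset_closure hY.1,
        by simpa [dist_eq_norm] using (show ‖Y - Z‖ < s from hY.2.2).le,
        le_of_lt (show θ * s < ‖Y - Z‖ from hY.2.1)⟩)
      simp only [mem_ofPred_eq] at h1
      linarith
    have := hsuper X ⟨hXΩ, hXr⟩ φ hφcd.contDiffAt hloc
    linarith [hφlap X hXθ hXZ])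
  refine ⟨K + K₁ + η * k * Real.exp (-k) / s + η * k * Real.exp (-k) / s, by positivity,
    (1 - θ) * s, mul_pos (by linarith) hs, fun X hX => ?_⟩
  have hXn : ‖X - X₀‖ < (1 - θ) * s := by simpa [dist_eq_norm] using hX.2
  have hXr : X ∈ Metric.ball X₀ r := by
    rw [Metric.mem_ball, dist_eq_norm]
    nlinarith
  have hq : 0 ≤ η * k * Real.exp (-k) / s * ‖X - X₀‖ ^ 2 := by positivity
  have hK₁q : 0 ≤ K₁ * ‖X - X₀‖ ^ 2 := by positivity
  -- Outside the outer ball 2sℓ ≤ ‖X - X₀‖², so the additional slope is only a quadratic error and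
  -- the old bound suffices.
  rcases le_or_gt ‖X - Z‖ s with hXZ | hXZ
  · have hXθ : θ * s ≤ ‖X - Z‖ := by
      have h1 : s ≤ ‖X - Z‖ + ‖X - X₀‖ := by
        calc s = ‖s • ν‖ := by rw [norm_smul, hν, mul_one, Real.norm_of_nonneg hs.le]
          _ = ‖(X - X₀) - (X - Z)‖ := by congr 1; rw [hZ]; abel
          _ ≤ ‖X - X₀‖ + ‖X - Z‖ := norm_sub_le _ _
          _ = _ := add_comm _ _
      linarith
    have h1 := hmain X ⟨hX.1, by simpa [dist_eq_norm] using hXZ, hXθ⟩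
    have h2 := hφval X
    have h3 := hvlow X
    linarith
  · have h1 := hlow X ⟨hX.1, hXr⟩
    have h2 : 2 * s * ⟪X - X₀, ν⟫_ℝ ≤ ‖X - X₀‖ ^ 2 := by
      have h3 : s ^ 2 ≤ ‖X - Z‖ ^ 2 := pow_le_pow_left₀ hs.le hXZ.le 2
      rw [hdist] at h3
      linarith
    have h4 : 2 * η * k * Real.exp (-k) * ⟪X - X₀, ν⟫_ℝ ≤
        η * k * Real.exp (-k) / s * ‖X - X₀‖ ^ 2 := by
      have h5 : 2 * η * k * Real.exp (-k) * ⟪X - X₀, ν⟫_ℝ =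
          η * k * Real.exp (-k) / s * (2 * s * ⟪X - X₀, ν⟫_ℝ) := by field_simp
      rw [h5]
      exact mul_le_mul_of_nonneg_left h2 (by positivity)
    linarith

end Hopf

/-! ### Existence of the normal slope of a harmonic function at a parabolic boundary point. -/

section Slope

variable {E : Type*} [NormedAddCommGroup E] [InnerProductSpace ℝ E]

/-- Near `X₀` the boundary of the open set `Ω` lies between two paraboloids with axis `ν`, which
points into `Ω`. -/
structure IsParabolicBoundaryPoint (Ω : Set E) (X₀ ν : E) (r C : ℝ) : Prop where
  norm_eq : ‖ν‖ = 1
  isOpen : IsOpen Ω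
  radius_pos : 0 < r
  nonneg : 0 ≤ C
  interior : ∀ X ∈ Metric.ball X₀ r, C * ‖X - X₀‖ ^ 2 < ⟪X - X₀, ν⟫_ℝ → X ∈ Ω
  exterior : ∀ X ∈ closure Ω ∩ Metric.ball X₀ r, -(C * ‖X - X₀‖ ^ 2) ≤ ⟪X - X₀, ν⟫_ℝ

/-- `w` is bounded below on the closure of `Ω` near `X₀` by a function of slope `α` in the
direction `ν`, up to a quadratic error. -/
def HasLowerSlope (w : E → ℝ) (Ω : Set E) (X₀ ν : E) (α : ℝ) : Prop :=
  ∃ K ≥ 0, ∃ ρ > 0, ∀ X ∈ closure Ω ∩ Metric.ball X₀ ρ,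
    α * ⟪X - X₀, ν⟫_ℝ - K * ‖X - X₀‖ ^ 2 ≤ w X

/-- `w` is harmonic in `Ω` near `X₀`, continuous up to the boundary of `Ω`, and vanishes there. -/
structure IsHarmonicVanishing (w : E → ℝ) (Ω : Set E) (X₀ : E) (r : ℝ)
    [FiniteDimensional ℝ E] : Prop where
  harmonic : ∀ X ∈ Ω ∩ Metric.ball X₀ r, InnerProductSpace.HarmonicAt w X
  continuousOn : ContinuousOn w (closure Ω)
  eq_zero : ∀ X ∈ closure Ω ∩ Metric.ball X₀ r, X ∉ Ω → w X = 0

namespace IsParabolicBoundaryPoint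

variable {Ω : Set E} {X₀ ν : E} {r C : ℝ}

theorem line_mem (h : IsParabolicBoundaryPoint Ω X₀ ν r C) {s : ℝ} (hs : 0 < s) (hsr : s < r)
    (hCs : C * s < 1) : X₀ + s • ν ∈ Ω := by
  have h1 : ‖s • ν‖ = s := by rw [norm_smul, h.norm_eq, mul_one, Real.norm_of_nonneg hs.le]
  refine h.interior _ (by rw [Metric.mem_ball, dist_eq_norm, add_sub_cancel_left, h1]; exact hsr) ?_
  rw [add_sub_cancel_left, h1, inner_smul_left, real_inner_self_eq_norm_sq, h.norm_eq]
  simp only [RCLike.conj_to_real, one_pow, mul_one]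
  nlinarith

theorem eventually_line_mem (h : IsParabolicBoundaryPoint Ω X₀ ν r C) :
    ∀ᶠ s : ℝ in 𝓝[>] 0, X₀ + s • ν ∈ Ω := by
  have h1 : ∀ᶠ s : ℝ in 𝓝[>] 0, s < r :=
    nhdsWithin_le_nhds (eventually_lt_nhds h.radius_pos)
  have h2 : ∀ᶠ s : ℝ in 𝓝[>] 0, C * s < 1 := by
    have : Tendsto (fun s : ℝ => C * s) (𝓝 0) (𝓝 0) := by
      have hc : Continuous fun s : ℝ => C * s := by fun_prop
      simpa using hc.tendsto 0
    exact nhdsWithin_le_nhds (this.eventually_lt_const one_pos)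
  filter_upwards [h1, h2, self_mem_nhdsWithin] with s h1 h2 hs using h.line_mem hs h1 h2

/-- The exterior paraboloid gives ℓ ≥ -C ‖X - X₀‖², so lowering the slope costs only a quadratic
term even where ℓ < 0. -/
theorem lowerSlope_mono (h : IsParabolicBoundaryPoint Ω X₀ ν r C) {w : E → ℝ} {α β : ℝ}
    (hα : HasLowerSlope w Ω X₀ ν α) (hβ : β ≤ α) : HasLowerSlope w Ω X₀ ν β := by
  obtain ⟨K, hK, ρ, hρ, hlow⟩ := hα
  have hC := h.nonneg
  refine ⟨K + (α - β) * C, add_nonneg hK (mul_nonneg (by linarith) hC), min ρ r,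
    lt_min hρ h.radius_pos, fun X hX => ?_⟩
  have h1 := hlow X ⟨hX.1, Metric.ball_subset_ball (min_le_left _ _) hX.2⟩
  have h2 := h.exterior X ⟨hX.1, Metric.ball_subset_ball (min_le_right _ _) hX.2⟩
  have h3 := mul_le_mul_of_nonneg_left h2 (show 0 ≤ α - β by linarith)
  linarith

theorem eventually_of_lowerSlope (h : IsParabolicBoundaryPoint Ω X₀ ν r C) {w : E → ℝ} {α : ℝ}
    (hα : HasLowerSlope w Ω X₀ ν α) {δ : ℝ} (hδ : 0 < δ) :
    ∀ᶠ s : ℝ in 𝓝[>] 0, (α - δ) * s < w (X₀ + s • ν) := by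
  obtain ⟨K, hK, ρ, hρ, hlow⟩ := hα
  have h1 : ∀ᶠ s : ℝ in 𝓝[>] 0, s < ρ := nhdsWithin_le_nhds (eventually_lt_nhds hρ)
  have h2 : ∀ᶠ s : ℝ in 𝓝[>] 0, K * s < δ := by
    have : Tendsto (fun s : ℝ => K * s) (𝓝 0) (𝓝 0) := by
      have hc : Continuous fun s : ℝ => K * s := by fun_prop
      simpa using hc.tendsto 0
    exact nhdsWithin_le_nhds (this.eventually_lt_const hδ)
  filter_upwards [h1, h2, self_mem_nhdsWithin, h.eventually_line_mem] with s h1 h2 hs hmem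
  have hs' : 0 < s := hs
  have hn : ‖s • ν‖ = s := by rw [norm_smul, h.norm_eq, mul_one, Real.norm_of_nonneg hs'.le]
  have h3 := hlow (X₀ + s • ν) ⟨subset_closure hmem, by
    rw [Metric.mem_ball, dist_eq_norm, add_sub_cancel_left, hn]; exact h1⟩
  rw [add_sub_cancel_left, hn, inner_smul_left, real_inner_self_eq_norm_sq, h.norm_eq] at h3
  simp only [RCLike.conj_to_real, one_pow, mul_one] at h3
  nlinarith

variable [FiniteDimensional ℝ E]

theorem _root_.HeleShaw.IsHarmonicVanishing.neg {w : E → ℝ} (hw : IsHarmonicVanishing w Ω X₀ r) :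
    IsHarmonicVanishing (fun X => -w X) Ω X₀ r :=
  ⟨fun X hX => (hw.harmonic X hX).neg, hw.continuousOn.neg,
    fun X hX hXΩ => by rw [hw.eq_zero X hX hXΩ, neg_zero]⟩

/-- Extension by zero is continuous across the boundary and subharmonic where positive, which puts
it within reach of `exists_linear_growth`. -/
theorem exists_upper_growth (h : IsParabolicBoundaryPoint Ω X₀ ν r C) {w : E → ℝ}
    (hw : IsHarmonicVanishing w Ω X₀ r) :
    ∃ lam ≥ 0, ∃ K ≥ 0, ∃ ρ > 0, ∀ X ∈ closure Ω ∩ Metric.ball X₀ ρ,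
      w X ≤ lam * ⟪X - X₀, ν⟫_ℝ + K * ‖X - X₀‖ ^ 2 := by
  classical
  have hr := h.radius_pos
  set f : E → ℝ := Ω.piecewise w 0 with hf
  have hsub : Metric.closedBall X₀ (r / 2) ⊆ Metric.ball X₀ r :=
    Metric.closedBall_subset_ball (by linarith)
  have hfc : ContinuousOn f (Metric.closedBall X₀ (r / 2)) := by
    refine ContinuousOn.piecewise (fun X hX => ?_) (hw.continuousOn.mono inter_subset_right)
      continuousOn_const
    refine hw.eq_zero X ⟨frontier_subset_closure hX.2, hsub hX.1⟩ ?_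
    rw [h.isOpen.frontier_eq] at hX
    exact hX.2.2
  obtain ⟨M, hM⟩ := ((isCompact_closedBall X₀ (r / 2)).bddAbove_image hfc)
  have hfpos : ∀ X, 0 < f X → X ∈ Ω := by
    intro X hX
    by_contra hcon
    simp [hf, hcon] at hX
  obtain ⟨lam, hlam, K, hK, ρ, hρ, hgrow⟩ := exists_linear_growth (f := f) (X₀ := X₀)
    (r := r / 2) (M := M) h.norm_eq (by linarith) h.nonneg hfc.upperSemicontinuousOn
    (fun X hX => hM (mem_image_of_mem f hX))
    (fun X hX hpos => h.exterior X ⟨subset_closure (hfpos X hpos), hsub hX⟩)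
    (fun X hX hpos => by
      have hXΩ := hfpos X hpos
      refine (isSubharmonicAt_of_harmonicAt
        (hw.harmonic X ⟨hXΩ, hsub (Metric.ball_subset_closedBall hX)⟩)).congr ?_
      filter_upwards [h.isOpen.mem_nhds hXΩ] with Y hY
      simp [hf, hY])
  have hC := h.nonneg
  refine ⟨lam, hlam, K + lam * C, by positivity, min ρ r, lt_min hρ hr, fun X hX => ?_⟩
  have hXρ := Metric.ball_subset_ball (min_le_left ρ r) hX.2
  have hXr := Metric.ball_subset_ball (min_le_right ρ r) hX.2
  have h3 := mul_le_mul_of_nonneg_left (h.exterior X ⟨hX.1, hXr⟩) hlam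
  have h4 : 0 ≤ K * ‖X - X₀‖ ^ 2 := by positivity
  have h5 : 0 ≤ lam * C * ‖X - X₀‖ ^ 2 := by positivity
  by_cases hXΩ : X ∈ Ω
  · have hfX : f X = w X := by simp [hf, hXΩ]
    rcases le_or_gt (f X) 0 with hneg | hpos
    · linarith
    · have := hgrow X hXρ hpos
      linarith
  · rw [hw.eq_zero X ⟨hX.1, hXr⟩ hXΩ]
    linarith

theorem exists_growth (h : IsParabolicBoundaryPoint Ω X₀ ν r C) {w : E → ℝ}
    (hw : IsHarmonicVanishing w Ω X₀ r) :
    ∃ lam ≥ 0, ∃ K ≥ 0, ∃ ρ > 0, ∀ X ∈ closure Ω ∩ Metric.ball X₀ ρ,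
      |w X| ≤ lam * ⟪X - X₀, ν⟫_ℝ + K * ‖X - X₀‖ ^ 2 := by
  obtain ⟨lam₁, hlam₁, K₁, hK₁, ρ₁, hρ₁, h₁⟩ := h.exists_upper_growth hw
  obtain ⟨lam₂, hlam₂, K₂, hK₂, ρ₂, hρ₂, h₂⟩ := h.exists_upper_growth hw.neg
  have hC := h.nonneg
  refine ⟨lam₁ + lam₂, by positivity, K₁ + K₂ + (lam₁ + lam₂) * C, by positivity,
    min (min ρ₁ ρ₂) r, lt_min (lt_min hρ₁ hρ₂) h.radius_pos, fun X hX => ?_⟩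
  have hXr := h.exterior X ⟨hX.1, Metric.ball_subset_ball (min_le_right _ _) hX.2⟩
  have h3 := h₁ X ⟨hX.1, Metric.ball_subset_ball
    ((min_le_left _ _).trans (min_le_left _ _)) hX.2⟩
  have h4 := h₂ X ⟨hX.1, Metric.ball_subset_ball
    ((min_le_left _ _).trans (min_le_right _ _)) hX.2⟩
  have h5 := mul_le_mul_of_nonneg_left hXr hlam₁
  have h6 := mul_le_mul_of_nonneg_left hXr hlam₂
  have h7 : 0 ≤ K₁ * ‖X - X₀‖ ^ 2 := by positivity
  have h8 : 0 ≤ K₂ * ‖X - X₀‖ ^ 2 := by positivity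
  have h9 : 0 ≤ lam₁ * C * ‖X - X₀‖ ^ 2 := by positivity
  have h10 : 0 ≤ lam₂ * C * ‖X - X₀‖ ^ 2 := by positivity
  rw [abs_le]
  constructor <;> linarith

/-- If `w` exceeds a lower slope `α` by a fixed amount at arbitrarily small distances along the
normal, then the lower slope can be increased by a fixed amount. -/
theorem exists_slope_gain (h : IsParabolicBoundaryPoint Ω X₀ ν r C) {w : E → ℝ}
    (hw : IsHarmonicVanishing w Ω X₀ r) {lam K₀ ρ₀ : ℝ} (hlam : 0 ≤ lam) (hK₀ : 0 ≤ K₀)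
    (hρ₀ : 0 < ρ₀) (hgrow : ∀ X ∈ closure Ω ∩ Metric.ball X₀ ρ₀,
      |w X| ≤ lam * ⟪X - X₀, ν⟫_ℝ + K₀ * ‖X - X₀‖ ^ 2) {δ : ℝ} (hδ : 0 < δ) :
    ∃ c > 0, ∀ α, |α| ≤ lam → HasLowerSlope w Ω X₀ ν α →
      (∃ᶠ s : ℝ in 𝓝[>] 0, (α + δ) * s ≤ w (X₀ + s • ν)) → HasLowerSlope w Ω X₀ ν (α + c) := by
  set n : ℝ := (Module.finrank ℝ E : ℝ) with hn
  have hn0 : 0 ≤ n := by positivity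
  set M : ℝ := 3 * lam + 3 * K₀ + 1 with hM
  have hM0 : 0 < M := by positivity
  -- So small that the Lipschitz constant 4(n + 2)M costs at most δ s / 2 over distance θ s. It
  -- depends on neither α nor s, and hence neither does the gain c.
  set θ : ℝ := min (1 / 8) (δ / (8 * (n + 2) * M)) with hθ
  have hθ0 : 0 < θ := lt_min (by norm_num) (by positivity)
  have hθ8 : θ ≤ 1 / 8 := min_le_left _ _
  have hθδ : 4 * (n + 2) * M * θ ≤ δ / 2 := by
    have h1 : θ ≤ δ / (8 * (n + 2) * M) := min_le_right _ _
    rw [le_div_iff₀ (by positivity)] at h1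
    linarith
  obtain ⟨c, hc, κ, hκ, himp⟩ := exists_slope_improvement (E := E) h.nonneg hθ0
    (by linarith) (half_pos hδ)
  refine ⟨c, hc, fun α hα ⟨K, hK, ρ, hρ, hlow⟩ hfreq => ?_⟩
  have hr := h.radius_pos
  have hC := h.nonneg
  have hev : ∀ᶠ s : ℝ in 𝓝[>] 0, 2 * s < min ρ (min ρ₀ r) ∧ s < 1 ∧ (K + 1) * s < κ ∧
      9 * C * s < 2 := by
    have htend : ∀ a : ℝ, Tendsto (fun s : ℝ => a * s) (𝓝[>] 0) (𝓝 0) := by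
      intro a
      have hc : Continuous fun s : ℝ => a * s := by fun_prop
      have := hc.tendsto 0
      rw [mul_zero] at this
      exact this.mono_left nhdsWithin_le_nhds
    refine ((htend 2).eventually_lt_const (lt_min hρ (lt_min hρ₀ hr))).and
      (Filter.Eventually.and ?_ (((htend _).eventually_lt_const hκ).and
        ((htend _).eventually_lt_const (by norm_num))))
    exact nhdsWithin_le_nhds (eventually_lt_nhds one_pos)
  obtain ⟨s, hws, ⟨hs1, hs2, hs3, hs4⟩, hs⟩ := (hfreq.and_eventually
    (hev.and self_mem_nhdsWithin)).exists
  have hs0 : 0 < s := hs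
  set Z : E := X₀ + s • ν with hZ
  have hZn : ‖s • ν‖ = s := by rw [norm_smul, h.norm_eq, mul_one, Real.norm_of_nonneg hs0.le]
  have hZin : ⟪s • ν, ν⟫_ℝ = s := by
    rw [inner_smul_left, real_inner_self_eq_norm_sq, h.norm_eq]; simp
  have hloc : ∀ X ∈ Metric.ball Z (s / 2), ‖X - X₀‖ < 3 / 2 * s ∧ s / 2 < ⟪X - X₀, ν⟫_ℝ ∧
      ⟪X - X₀, ν⟫_ℝ < 3 / 2 * s := by
    intro X hX
    have h1 : ‖X - Z‖ < s / 2 := by simpa [dist_eq_norm] using hX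
    have h2 : X - X₀ = (X - Z) + s • ν := by rw [hZ]; abel
    have h3 := abs_le.1 (abs_inner_le_norm_of_unit h.norm_eq (X - Z))
    refine ⟨?_, ?_, ?_⟩
    · rw [h2]
      refine (norm_add_le _ _).trans_lt ?_
      rw [hZn]; linarith
    · rw [h2, inner_add_left, hZin]; linarith [h3.1]
    · rw [h2, inner_add_left, hZin]; linarith [h3.2]
  have hmin1 : min ρ (min ρ₀ r) ≤ ρ := min_le_left _ _
  have hmin2 : min ρ (min ρ₀ r) ≤ ρ₀ := (min_le_right _ _).trans (min_le_left _ _)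
  have hmin3 : min ρ (min ρ₀ r) ≤ r := (min_le_right _ _).trans (min_le_right _ _)
  have hballr : ∀ X ∈ Metric.ball Z (s / 2), X ∈ Metric.ball X₀ (min ρ (min ρ₀ r)) := by
    intro X hX
    rw [Metric.mem_ball, dist_eq_norm]
    linarith [(hloc X hX).1]
  have hsqb : ∀ X ∈ Metric.ball Z (s / 2), ‖X - X₀‖ ^ 2 ≤ 9 / 4 * s * s := by
    intro X hX
    have := pow_le_pow_left₀ (norm_nonneg _) (hloc X hX).1.le 2
    linarith
  have hballΩ : ∀ X ∈ Metric.ball Z (s / 2), X ∈ Ω := by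
    intro X hX
    refine h.interior X (Metric.ball_subset_ball hmin3 (hballr X hX)) ?_
    have h1 := mul_le_mul_of_nonneg_left (hsqb X hX) hC
    have h2 := (hloc X hX).2.1
    have h3 : C * (9 / 4 * s * s) < s / 2 := by nlinarith
    linarith
  -- Harmonic of size M s on a ball of radius s / 2, and at most -δ s at its centre; the Lipschitz
  -- estimate keeps half of the excess on the ball of radius θ s.
  set u : E → ℝ := fun X => α * ⟪X - X₀, ν⟫_ℝ - w X with hu
  have hquad : quad X₀ ν 0 α 0 0 = fun X => α * ⟪X - X₀, ν⟫_ℝ := by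
    funext X; simp [quad]
  have huharm : InnerProductSpace.HarmonicOnNhd u (Metric.ball Z (s / 2)) := by
    intro X hX
    have h1 : InnerProductSpace.HarmonicAt (quad X₀ ν 0 α 0 0) X := by
      refine ⟨(contDiff_quad _ _ _ _ _ _).contDiffAt, Eventually.of_forall fun Y => ?_⟩
      rw [laplacian_quad]; simp
    rw [hquad] at h1
    exact h1.sub (hw.harmonic X ⟨hballΩ X hX,
      Metric.ball_subset_ball hmin3 (hballr X hX)⟩)
  have hub : ∀ X ∈ Metric.ball Z (s / 2), |u X| ≤ M * s := by
    intro X hX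
    have h1 := hgrow X ⟨subset_closure (hballΩ X hX),
      Metric.ball_subset_ball hmin2 (hballr X hX)⟩
    have h2 := hloc X hX
    have h3 : |α * ⟪X - X₀, ν⟫_ℝ| ≤ lam * (3 / 2 * s) := by
      rw [abs_mul, abs_of_pos (show 0 < ⟪X - X₀, ν⟫_ℝ by linarith)]
      exact mul_le_mul hα h2.2.2.le (by linarith) hlam
    have h4 : K₀ * ‖X - X₀‖ ^ 2 ≤ K₀ * (9 / 4 * s * s) :=
      mul_le_mul_of_nonneg_left (hsqb X hX) hK₀
    have h5 : K₀ * (9 / 4 * s * s) ≤ K₀ * (3 * s) :=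
      mul_le_mul_of_nonneg_left (by nlinarith) hK₀
    have h6 : lam * ⟪X - X₀, ν⟫_ℝ ≤ lam * (3 / 2 * s) :=
      mul_le_mul_of_nonneg_left h2.2.2.le hlam
    have h7 : |u X| ≤ |α * ⟪X - X₀, ν⟫_ℝ| + |w X| := abs_sub _ _
    have h8 : M * s = lam * (3 / 2 * s) + lam * (3 / 2 * s) + K₀ * (3 * s) + s := by
      rw [hM]; ring
    linarith
  have huZ : u Z ≤ -(δ * s) := by
    have h1 : Z - X₀ = s • ν := by rw [hZ]; abel
    simp only [hu]
    rw [h1, hZin]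
    linarith
  refine himp w X₀ ν Ω (min ρ (min ρ₀ r)) α K s h.norm_eq h.isOpen hs0 hs1 hK hs3.le
    (hw.continuousOn.mono inter_subset_left).lowerSemicontinuousOn
    (fun X hX => isSubharmonicAt_of_harmonicAt
      (hw.harmonic X ⟨hX.1, Metric.ball_subset_ball hmin3 hX.2⟩).neg)
    (fun X hX => hlow X ⟨hX.1, Metric.ball_subset_ball hmin1 hX.2⟩)
    (fun X hX hXΩ => ?_) (fun X hX hXZ => ?_)
  · by_contra! hcon
    exact hXΩ (h.interior X (Metric.ball_subset_ball hmin3 hX.2) hcon)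
  · have h1 := harmonic_sub_le (half_pos hs0) huharm hub (x := X) (by
      refine hXZ.trans ?_
      nlinarith)
    have h2 : 2 * (n + 2) * (M * s) * ‖X - Z‖ / (s / 2) = 4 * (n + 2) * M * ‖X - Z‖ := by
      field_simp
      ring
    rw [← hn, h2] at h1
    have h3 : 4 * (n + 2) * M * ‖X - Z‖ ≤ 4 * (n + 2) * M * (θ * s) :=
      mul_le_mul_of_nonneg_left hXZ (by positivity)
    have h4 : 4 * (n + 2) * M * (θ * s) ≤ δ / 2 * s := by
      have := mul_le_mul_of_nonneg_right hθδ hs0.le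
      linarith
    have h5 : u X = α * ⟪X - X₀, ν⟫_ℝ - w X := rfl
    linarith

/-- Take the supremum a of the lower slopes. If w(X₀ + sν) ≥ (a + δ) s for arbitrarily small s, a
lower slope within c of a could be raised by c, past the supremum. -/
theorem exists_critical_slope (h : IsParabolicBoundaryPoint Ω X₀ ν r C) {w : E → ℝ}
    (hw : IsHarmonicVanishing w Ω X₀ r) :
    ∃ a : ℝ, (∀ α < a, HasLowerSlope w Ω X₀ ν α) ∧
      ∀ δ > 0, ∀ᶠ s : ℝ in 𝓝[>] 0, w (X₀ + s • ν) < (a + δ) * s := by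
  obtain ⟨lam, hlam, K₀, hK₀, ρ₀, hρ₀, hgrow⟩ := h.exists_growth hw
  set P : Set ℝ := {α | HasLowerSlope w Ω X₀ ν α} with hP
  have hPne : -lam ∈ P := by
    refine ⟨K₀, hK₀, ρ₀, hρ₀, fun X hX => ?_⟩
    have := (abs_le.1 (hgrow X hX)).1
    linarith
  have hneg : HasLowerSlope (fun X => -w X) Ω X₀ ν (-lam) := by
    refine ⟨K₀, hK₀, ρ₀, hρ₀, fun X hX => ?_⟩
    have := (abs_le.1 (hgrow X hX)).2
    linarith
  have hPle : ∀ α ∈ P, α ≤ lam := by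
    intro α hα
    refine le_of_forall_pos_le_add fun ε hε => ?_
    obtain ⟨s, ⟨h1, h2⟩, hs⟩ := (((h.eventually_of_lowerSlope hα (half_pos hε)).and
      (h.eventually_of_lowerSlope hneg (half_pos hε))).and self_mem_nhdsWithin).exists
    have hs' : 0 < s := hs
    by_contra! hcon
    nlinarith
  have hbdd : BddAbove P := ⟨lam, hPle⟩
  refine ⟨sSup P, fun α hα => ?_, fun δ hδ => ?_⟩
  · obtain ⟨β, hβ, hαβ⟩ := exists_lt_of_lt_csSup ⟨_, hPne⟩ hα
    exact h.lowerSlope_mono hβ hαβ.le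
  · obtain ⟨c, hc, hgain⟩ := h.exists_slope_gain hw hlam hK₀ hρ₀ hgrow hδ
    by_contra hcon
    rw [not_eventually] at hcon
    obtain ⟨β, hβ, hβs⟩ := exists_lt_of_lt_csSup ⟨_, hPne⟩ (show sSup P - c < sSup P by linarith)
    -- Truncation at -lam keeps the slope in [-lam, lam], where the gain c is uniform.
    have hmaxP : max β (-lam) ∈ P := by
      rcases max_choice β (-lam) with h1 | h1 <;> rw [h1] <;> assumption
    have h1 := hgain (max β (-lam)) (abs_le.2 ⟨le_max_right _ _, hPle _ hmaxP⟩) hmaxP (by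
      refine (hcon.and_eventually self_mem_nhdsWithin).mono fun s hs => ?_
      have hs' : 0 < s := hs.2
      have h2 := not_lt.1 hs.1
      have h3 : max β (-lam) ≤ sSup P := le_csSup hbdd hmaxP
      nlinarith)
    have h2 : max β (-lam) + c ≤ sSup P := le_csSup hbdd h1
    linarith [le_max_left β (-lam)]

/-- A harmonic function vanishing on a boundary that lies between two paraboloids has a slope `L`
at the vertex, and linear bounds with slopes close to `L`. -/
theorem exists_slope (h : IsParabolicBoundaryPoint Ω X₀ ν r C) {w : E → ℝ}
    (hw : IsHarmonicVanishing w Ω X₀ r) :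
    ∃ L : ℝ, (∀ α < L, HasLowerSlope w Ω X₀ ν α) ∧
      ∀ α > L, HasLowerSlope (fun X => -w X) Ω X₀ ν (-α) := by
  obtain ⟨a, ha, ha'⟩ := h.exists_critical_slope hw
  obtain ⟨b, hb, hb'⟩ := h.exists_critical_slope hw.neg
  refine ⟨a, ha, fun α hα => hb _ ?_⟩
  -- The critical slopes a of w and b of -w bound the same normal quotients from both sides, which
  -- forces a + b ≥ 0. Thus every α > a satisfies -α < b.
  suffices -b ≤ a by linarith
  refine le_of_forall_pos_le_add fun ε hε => ?_
  obtain ⟨s, ⟨h1, h2⟩, hs⟩ := (((ha' _ (half_pos hε)).and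
      (hb' _ (half_pos hε))).and self_mem_nhdsWithin).exists
  have hs' : 0 < s := hs
  by_contra! hcon
  nlinarith

omit [FiniteDimensional ℝ E] in
theorem tendsto_slope (h : IsParabolicBoundaryPoint Ω X₀ ν r C) {w : E → ℝ} {L : ℝ}
    (hlow : ∀ α < L, HasLowerSlope w Ω X₀ ν α)
    (hup : ∀ α > L, HasLowerSlope (fun X => -w X) Ω X₀ ν (-α)) :
    Tendsto (fun s : ℝ => w (X₀ + s • ν) / s) (𝓝[>] 0) (𝓝 L) := by
  rw [tendsto_order]
  constructor
  · intro α hα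
    filter_upwards [h.eventually_of_lowerSlope (hlow ((α + L) / 2) (by linarith))
      (show 0 < (L - α) / 2 by linarith), self_mem_nhdsWithin] with s h1 hs
    rw [lt_div_iff₀ hs]
    rwa [show (α + L) / 2 - (L - α) / 2 = α by ring] at h1
  · intro α hα
    filter_upwards [h.eventually_of_lowerSlope (hup ((α + L) / 2) (by linarith))
      (show 0 < (α - L) / 2 by linarith), self_mem_nhdsWithin] with s h1 hs
    rw [div_lt_iff₀ hs]
    rw [show -((α + L) / 2) - (α - L) / 2 = -α by ring] at h1
    linarith

end IsParabolicBoundaryPoint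

end Slope

/-! ### A logarithmic barrier and the Phragmén-Lindelöf principle in the half space. -/

section PhragmenLindelof

variable {d : ℕ}

theorem inner_single_one (X : Space d) (i : Fin (d + 1)) :
    ⟪X, EuclideanSpace.single i (1 : ℝ)⟫_ℝ = X i := by
  simp [EuclideanSpace.inner_single_right]

/-- The quadratic function `x_i² + (x_{d+1} + 2)² - 1/2`. -/
noncomputable def axisQuad (i : Fin d) (X : Space d) : ℝ :=
  quad 0 (EuclideanSpace.single i.castSucc (1 : ℝ)) 0 0 0 1 X +
    quad 0 (EuclideanSpace.single (Fin.last d) (1 : ℝ)) (7 / 2) 4 0 1 X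

theorem axisQuad_eq (i : Fin d) (X : Space d) :
    axisQuad i X = X i.castSucc ^ 2 + (height X + 2) ^ 2 - 1 / 2 := by
  simp only [axisQuad, quad, sub_zero, inner_single_one, height]
  ring

theorem contDiff_axisQuad (i : Fin d) : ContDiff ℝ 2 (axisQuad (d := d) i) :=
  (contDiff_quad _ _ _ _ _ _).add (contDiff_quad _ _ _ _ _ _)

/-- The logarithm of x_i² + (x_{d+1} + 2)² is harmonic; subtracting 1/2 inside spoils the balance
|∇q|² = 4q in the right direction, since now |∇q|² = 4q + 2. -/
theorem laplacian_log_axisQuad (i : Fin d) {X : Space d} (hX : 0 < axisQuad i X) :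
    Δ (fun Y => Real.log (axisQuad i Y)) X = -(2 / axisQuad i X ^ 2) := by
  set e := EuclideanSpace.single (𝕜 := ℝ) i.castSucc (1 : ℝ) with he
  set l := EuclideanSpace.single (𝕜 := ℝ) (Fin.last d) (1 : ℝ) with hl
  set w : Space d := (2 * X i.castSucc) • e + (2 * (height X + 2)) • l with hw
  have hen : ‖e‖ = 1 := by simp [he]
  have hln : ‖l‖ = 1 := by simp [hl]
  have hfd : fderiv ℝ (axisQuad i) X = innerSL ℝ w := by
    have h1 := (hasFDerivAt_quad (0 : Space d) e 0 0 0 1 X).add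
      (hasFDerivAt_quad (0 : Space d) l (7 / 2) 4 0 1 X)
    refine (HasFDerivAt.fderiv h1).trans ?_
    rw [← map_add]
    congr 1
    rw [hw]
    simp only [he, hl, sub_zero, inner_single_one, mul_zero, zero_smul, add_zero, zero_add, height]
    congr 2 <;> ring
  have hlap : Δ (axisQuad i) X = 4 := by
    have h1 : Δ (axisQuad i) X = Δ (quad 0 e 0 0 0 1) X + Δ (quad 0 l (7 / 2) 4 0 1) X :=
      (contDiff_quad _ _ _ _ _ _).contDiffAt.laplacian_add (contDiff_quad _ _ _ _ _ _).contDiffAt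
    rw [h1, laplacian_quad, laplacian_quad, hen, hln]
    norm_num
  have hwn : ‖w‖ ^ 2 = 4 * (axisQuad i X + 1 / 2) := by
    have hel : ⟪e, l⟫_ℝ = 0 := by
      rw [hl, inner_single_one, he]
      simp [(Fin.castSucc_lt_last i).ne']
    rw [hw, norm_add_sq_real, inner_smul_left, inner_smul_right, hel, norm_smul, norm_smul, hen, hln,
      axisQuad_eq]
    simp only [mul_one, Real.norm_eq_abs, sq_abs, mul_zero]
    ring
  have hd : deriv Real.log = fun x => x⁻¹ := Real.deriv_log'
  have h := laplacian_comp (contDiff_axisQuad i).contDiffAt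
    (Real.contDiffAt_log.2 hX.ne' : ContDiffAt ℝ 2 Real.log (axisQuad i X)) hfd
  rw [hlap, hwn, hd, deriv_inv] at h
  rw [h]
  field_simp
  ring

theorem laplacian_finset_sum {E ι : Type*} [NormedAddCommGroup E] [InnerProductSpace ℝ E]
    [FiniteDimensional ℝ E] (s : Finset ι) {f : ι → E → ℝ} {x : E}
    (hf : ∀ i ∈ s, ContDiffAt ℝ 2 (f i) x) :
    Δ (fun y => ∑ i ∈ s, f i y) x = ∑ i ∈ s, Δ (f i) x := by
  classical
  induction s using Finset.induction_on with
  | empty =>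
    simp only [Finset.sum_empty]
    rw [InnerProductSpace.laplacian_const]; rfl
  | insert a s ha ih =>
    have h1 : ContDiffAt ℝ 2 (fun y => ∑ i ∈ s, f i y) x :=
      ContDiffAt.sum fun i hi => hf i (Finset.mem_insert_of_mem hi)
    have h2 : Δ (fun y => f a y + ∑ i ∈ s, f i y) x = Δ (f a) x + Δ (fun y => ∑ i ∈ s, f i y) x :=
      (hf a (Finset.mem_insert_self _ _)).laplacian_add h1
    simp only [Finset.sum_insert ha]
    rw [h2, ih fun i hi => hf i (Finset.mem_insert_of_mem hi)]

/-- A strictly superharmonic function on the half space that tends to infinity at infinity. -/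
noncomputable def logBarrier (X : Space d) : ℝ := ∑ i : Fin d, Real.log (axisQuad i X)

/-- The shift by 2 in the height is there to keep each logarithm smooth and nonnegative on the
closed half space. -/
theorem one_le_axisQuad (i : Fin d) {X : Space d} (hX : X ∈ closedHalf d) : 1 ≤ axisQuad i X := by
  have h : 0 ≤ height X := hX
  rw [axisQuad_eq]
  nlinarith [sq_nonneg (X i.castSucc), sq_nonneg (height X)]

theorem contDiffAt_logBarrier {X : Space d} (hX : X ∈ closedHalf d) :
    ContDiffAt ℝ 2 (logBarrier (d := d)) X :=
  ContDiffAt.sum fun i _ => (contDiff_axisQuad i).contDiffAt.log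
    (by linarith [one_le_axisQuad i hX])

theorem laplacian_logBarrier_neg (hd : 1 ≤ d) {X : Space d} (hX : X ∈ closedHalf d) :
    Δ (logBarrier (d := d)) X < 0 := by
  have hpos : ∀ i : Fin d, 0 < axisQuad i X := fun i => by linarith [one_le_axisQuad i hX]
  have h : Δ (logBarrier (d := d)) X = ∑ i : Fin d, -(2 / axisQuad i X ^ 2) := by
    refine (laplacian_finset_sum _ fun i _ =>
      (contDiff_axisQuad i).contDiffAt.log (hpos i).ne').trans ?_
    exact Finset.sum_congr rfl fun i _ => laplacian_log_axisQuad i (hpos i)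
  rw [h]
  refine Finset.sum_neg (fun i _ => ?_) ⟨⟨0, hd⟩, Finset.mem_univ _⟩
  have := hpos i
  have : 0 < 2 / axisQuad i X ^ 2 := by positivity
  linarith

theorem logBarrier_nonneg {X : Space d} (hX : X ∈ closedHalf d) : 0 ≤ logBarrier X :=
  Finset.sum_nonneg fun i _ => Real.log_nonneg (one_le_axisQuad i hX)

/-- Some coordinate carries at least the average of ‖X‖², and every coordinate enters some summand;
for the height this uses d ≥ 1. -/
theorem le_logBarrier (hd : 1 ≤ d) {B : ℝ} {X : Space d} (hX : X ∈ closedHalf d)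
    (hB : (d + 1) * Real.exp B ≤ ‖X‖ ^ 2) : B ≤ logBarrier X := by
  obtain ⟨j, hj⟩ : ∃ j : Fin (d + 1), Real.exp B ≤ X j ^ 2 := by
    by_contra! hcon
    have h1 : ‖X‖ ^ 2 = ∑ j, X j ^ 2 := by
      rw [EuclideanSpace.norm_sq_eq]; simp
    have h2 : ∑ j, X j ^ 2 < ∑ _j : Fin (d + 1), Real.exp B :=
      Finset.sum_lt_sum_of_nonempty Finset.univ_nonempty fun j _ => hcon j
    rw [Finset.sum_const, Finset.card_univ, Fintype.card_fin, nsmul_eq_mul] at h2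
    push_cast at h2
    linarith
  have hh : 0 ≤ height X := hX
  obtain ⟨i, hi⟩ : ∃ i : Fin d, Real.exp B ≤ axisQuad i X := by
    rcases Fin.eq_castSucc_or_eq_last j with ⟨i, rfl⟩ | rfl
    · refine ⟨i, ?_⟩
      rw [axisQuad_eq]
      nlinarith
    · refine ⟨⟨0, hd⟩, ?_⟩
      rw [axisQuad_eq]
      change Real.exp B ≤ height X ^ 2 at hj
      nlinarith [sq_nonneg (X (Fin.castSucc ⟨0, hd⟩))]
  calc B ≤ Real.log (axisQuad i X) := by
        rwa [Real.le_log_iff_exp_le (by linarith [one_le_axisQuad i hX])]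
    _ ≤ logBarrier X := Finset.single_le_sum (f := fun i => Real.log (axisQuad i X))
        (fun i _ => Real.log_nonneg (one_le_axisQuad i hX)) (Finset.mem_univ i)

/-- The Phragmén-Lindelöf principle for bounded subharmonic functions in open subsets of the half
space. -/
theorem phragmen_lindelof (hd : 1 ≤ d) {Ω : Set (Space d)} (hΩ : IsOpen Ω)
    (hΩsub : Ω ⊆ closedHalf d) {f : Space d → ℝ} {M : ℝ}
    (hf : UpperSemicontinuousOn f (closure Ω)) (hM : ∀ X ∈ closure Ω, f X ≤ M)
    (hbdry : ∀ X ∈ closure Ω, X ∉ Ω → f X ≤ 0)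
    (hsub : ∀ X ∈ Ω, 0 < f X → IsSubharmonicAt f X) : ∀ X ∈ closure Ω, f X ≤ 0 := by
  have hcl : closure Ω ⊆ closedHalf d := closure_minimal hΩsub (isClosed_closedHalf d)
  have key : ∀ ε > 0, ∀ X ∈ closure Ω, f X ≤ ε * logBarrier X := by
    intro ε hε
    -- Beyond the radius R the barrier ε `logBarrier` is at least |M| + 1 > f, so the comparison
    -- takes place on a compact set.
    set B : ℝ := (|M| + 1) / ε with hB
    set R : ℝ := Real.sqrt ((d + 1) * Real.exp B) with hR
    have hfar : ∀ X ∈ closure Ω, R ≤ ‖X‖ → f X < ε * logBarrier X := by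
      intro X hX hXR
      have h1 : (d + 1) * Real.exp B ≤ ‖X‖ ^ 2 := Real.sqrt_le_iff.1 hXR |>.2
      have h2 := mul_le_mul_of_nonneg_left (le_logBarrier hd (hcl hX) h1) hε.le
      have h3 : ε * B = |M| + 1 := by rw [hB]; field_simp
      linarith [hM X hX, le_abs_self M]
    have hcont : ContinuousOn (fun X => -(ε * logBarrier (d := d) X))
        (closure Ω ∩ Metric.closedBall 0 R) := fun X hX =>
      ((contDiffAt_logBarrier (hcl hX.1)).continuousAt.const_mul ε).neg.continuousWithinAt
    have hmain := nonpos_of_no_positive_max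
      ((isCompact_closedBall (0 : Space d) R).inter_left isClosed_closure)
      ((hf.mono inter_subset_left).add hcont.upperSemicontinuousOn) (by
        intro X hX hpos hmax
        have hXh := hcl hX.1
        have h1 : 0 ≤ ε * logBarrier X := mul_nonneg hε.le (logBarrier_nonneg hXh)
        have hXΩ : X ∈ Ω := by
          by_contra hcon
          linarith [hbdry X hX.1 hcon]
        have hXR : ‖X‖ < R := by
          by_contra! hcon
          linarith [hfar X hX.1 hcon]
        have hloc : IsLocalMax (fun Y => f Y - ε * logBarrier Y) X := by
          filter_upwards [hΩ.mem_nhds hXΩ, Metric.isOpen_ball.mem_nhds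
            (show X ∈ Metric.ball (0 : Space d) R by simpa using hXR)] with Y hY hYR
          have h2 := hmax (show Y ∈ closure Ω ∩ Metric.closedBall 0 R from
            ⟨subset_closure hY, Metric.ball_subset_closedBall hYR⟩)
          simp only [mem_ofPred_eq] at h2
          linarith
        have hcd := contDiffAt_logBarrier hXh
        have h2 := hsub X hXΩ (by linarith) _ (contDiffAt_const.mul hcd) hloc
        have h3 : Δ (fun Y => ε * logBarrier (d := d) Y) X = ε * Δ (logBarrier (d := d)) X :=
          InnerProductSpace.laplacian_smul ε hcd
        rw [h3] at h2
        nlinarith [laplacian_logBarrier_neg hd hXh])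
    intro X hX
    rcases le_or_gt R ‖X‖ with h | h
    · exact (hfar X hX h).le
    · have h1 := hmain X ⟨hX, by simpa using h.le⟩
      linarith
  intro X hX
  refine le_of_forall_pos_le_add fun ε hε => ?_
  have h0 := logBarrier_nonneg (hcl hX)
  have h1 := key (ε / (logBarrier X + 1)) (by positivity) X hX
  have h2 : ε / (logBarrier X + 1) * logBarrier X ≤ ε := by
    rw [div_mul_eq_mul_div, div_le_iff₀ (by positivity)]
    nlinarith
  linarith

end PhragmenLindelof

/-! ### Quadratic expansion of a moving interface and the position of its two sides. -/

/-- The derivative is locally Lipschitz, and the mean value inequality on the ball of radius ‖y - x‖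
turns this into a quadratic remainder. -/
theorem exists_taylor_bound {F : Type*} [NormedAddCommGroup F] [NormedSpace ℝ F] {f : F → ℝ} {x : F}
    (hf : ContDiffAt ℝ 2 f x) :
    ∃ C ≥ 0, ∃ ρ > 0, ∀ y ∈ Metric.ball x ρ,
      |f y - f x - fderiv ℝ f x (y - x)| ≤ C * ‖y - x‖ ^ 2 := by
  obtain ⟨K, s, hs, hlip⟩ :=
    (hf.fderiv_right (m := 1) (by norm_num)).exists_lipschitzOnWith
  have hd : ∀ᶠ y in 𝓝 x, DifferentiableAt ℝ f y := by
    filter_upwards [hf.eventually (by simp)] with y hy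
    exact hy.differentiableAt (by simp)
  obtain ⟨ρ, hρ, hball⟩ := Metric.mem_nhds_iff.1 (inter_mem hs hd)
  refine ⟨K, K.2, ρ, hρ, fun y hy => ?_⟩
  have hsub : Metric.closedBall x ‖y - x‖ ⊆ Metric.ball x ρ :=
    Metric.closedBall_subset_ball (by rwa [← dist_eq_norm])
  have h := (convex_closedBall x ‖y - x‖).norm_image_sub_le_of_norm_hasFDerivWithin_le'
    (f := f) (f' := fderiv ℝ f) (φ := fderiv ℝ f x) (C := K * ‖y - x‖)
    (fun z hz => ((hball (hsub hz)).2 : DifferentiableAt ℝ f z).hasFDerivAt.hasFDerivWithinAt)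
    (fun z hz => by
      have h1 := hlip.dist_le_mul z (hball (hsub hz)).1 x (mem_of_mem_nhds hs)
      rw [dist_eq_norm, dist_eq_norm] at h1
      refine h1.trans (mul_le_mul_of_nonneg_left ?_ K.2)
      simpa [dist_eq_norm] using hz)
    (Metric.mem_closedBall_self (norm_nonneg _)) (show y ∈ Metric.closedBall x ‖y - x‖ by
      rw [Metric.mem_closedBall, dist_eq_norm])
  rw [Real.norm_eq_abs] at h
  calc _ ≤ _ := h
    _ = _ := by ring

theorem fderiv_spaceTime {d : ℕ} {φ : Space d × ℝ → ℝ} {p : Space d × ℝ}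
    (hφ : DifferentiableAt ℝ φ p) (y : Space d) (s : ℝ) :
    fderiv ℝ φ p (y, s) = ⟪spaceGrad φ p, y⟫_ℝ + timeDeriv φ p * s := by
  have h1 : HasFDerivAt (slice φ p.2) ((fderiv ℝ φ p).comp (ContinuousLinearMap.inl ℝ (Space d) ℝ))
      p.1 := HasFDerivAt.comp (g := φ) p.1 (by simpa using hφ.hasFDerivAt)
        (hasFDerivAt_prodMk_left p.1 p.2)
  have h2 : ⟪spaceGrad φ p, y⟫_ℝ = fderiv ℝ φ p (y, 0) := by
    have h3 : HasGradientAt (slice φ p.2) (spaceGrad φ p) p.1 :=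
      h1.differentiableAt.hasGradientAt
    have h4 := h3.hasFDerivAt.unique h1
    have h5 := congrArg (fun T => T y) h4
    simpa using h5
  have h3 : HasFDerivAt (fun t : ℝ => φ (p.1, t))
      ((fderiv ℝ φ p).comp (ContinuousLinearMap.inr ℝ (Space d) ℝ)) p.2 :=
    HasFDerivAt.comp (g := φ) p.2 (by simpa using hφ.hasFDerivAt)
      (hasFDerivAt_prodMk_right p.1 p.2)
  have h4 : timeDeriv φ p = fderiv ℝ φ p (0, 1) := by
    rw [timeDeriv, h3.hasDerivAt.deriv]
    simp
  have h5 : (y, s) = (y, (0 : ℝ)) + s • ((0 : Space d), (1 : ℝ)) := by simp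
  rw [h2, h4, h5, map_add, map_smul, smul_eq_mul, mul_comm]

namespace TestInterface

variable {d : ℕ} {a b : ℝ}

theorem pos_subset (S : TestInterface d a b) {t : ℝ} (ht : t ∈ Icc a b) :
    S.pos t ⊆ openHalf d :=
  (subset_union_left.trans (S.separates t ht).ge).trans sdiff_subset

theorem neg_subset (S : TestInterface d a b) {t : ℝ} (ht : t ∈ Icc a b) :
    S.neg t ⊆ openHalf d :=
  (subset_union_right.trans (S.separates t ht).ge).trans sdiff_subset

theorem notMem_carrier_of_mem_neg (S : TestInterface d a b) {t : ℝ} (ht : t ∈ Icc a b)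
    {X : Space d} (hX : X ∈ S.neg t) : (X, t) ∉ S.carrier :=
  ((S.separates t ht).ge (Or.inr hX)).2

theorem notMem_neg_of_mem_closure (S : TestInterface d a b) {t : ℝ} (ht : t ∈ Icc a b)
    {X : Space d} (hX : X ∈ closure (S.pos t)) : X ∉ S.neg t := fun h =>
  ((S.disjoint t ht).closure_left (S.isOpen_neg t ht)).le_bot ⟨hX, h⟩

theorem closure_pos_subset (S : TestInterface d a b) {t : ℝ} (ht : t ∈ Icc a b) :
    closure (S.pos t) ⊆ closedHalf d :=
  closure_minimal ((S.pos_subset ht).trans (openHalf_subset_closedHalf d)) (isClosed_closedHalf d)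

theorem mem_carrier_or_bottom (S : TestInterface d a b) {t : ℝ} (ht : t ∈ Icc a b)
    {X : Space d} (hX : X ∈ closure (S.pos t)) (hX' : X ∉ S.pos t) :
    (X, t) ∈ S.carrier ∨ X ∈ bottom d := by
  rcases (show (0 : ℝ) ≤ height X from S.closure_pos_subset ht hX).lt_or_eq with h | h
  · left
    by_contra hcon
    have h1 : X ∈ openHalf d \ {X | (X, t) ∈ S.carrier} := ⟨h, hcon⟩
    rw [S.separates t ht] at h1
    exact h1.elim hX' (S.notMem_neg_of_mem_closure ht hX)
  · exact Or.inr h.symm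

theorem mem_openHalf (S : TestInterface d a b) {p : Space d × ℝ} (hp : p ∈ S.carrier) :
    p.1 ∈ openHalf d := by
  obtain ⟨δ, hδ, h⟩ := S.away p.2 (S.subset hp).2
  exact hδ.trans_le (h p.1 hp)

/-- Quantitative position of the two sides of an interface near a point of its final slice, in terms
of the normal and of the normal velocity. -/
structure HasExpansion (S : TestInterface d a b) (X₀ ν : Space d) (V C ρ : ℝ) : Prop where
  norm_eq : ‖ν‖ = 1
  nonneg : 0 ≤ C
  radius_pos : 0 < ρ
  radius_le : ρ ≤ b - a
  subset_openHalf : Metric.ball X₀ ρ ⊆ openHalf d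
  of_notMem_neg : ∀ X ∈ Metric.ball X₀ ρ, ∀ t ∈ Ioc (b - ρ) b, X ∉ S.neg t →
    -(C * (‖X - X₀‖ ^ 2 + (b - t) ^ 2)) ≤ ⟪X - X₀, ν⟫_ℝ - V * (b - t)
  of_notMem_pos : ∀ X ∈ Metric.ball X₀ ρ, ∀ t ∈ Ioc (b - ρ) b, X ∉ S.pos t →
    ⟪X - X₀, ν⟫_ℝ - V * (b - t) ≤ C * (‖X - X₀‖ ^ 2 + (b - t) ^ 2)
  isCompact : ∀ r < ρ, IsCompact
    (Metric.closedBall X₀ r ×ˢ Icc (b - r) b ∩ {p : Space d × ℝ | p.1 ∉ S.neg p.2})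

/-- Taylor's formula for φ / |∇φ| has linear part ℓ - V (t₀ - t) with t₀ the final time, and the
sign of φ tells the sides apart. Off S⁻ means φ ≥ 0, whence the compactness statement. -/
theorem exists_hasExpansion (S : TestInterface d a b) (hab : a < b) {X₀ : Space d}
    {φ : Space d × ℝ → ℝ} (hp : (X₀, b) ∈ S.carrier) (hφ : S.IsDefiningAt (X₀, b) φ) :
    ∃ C ρ, S.HasExpansion X₀ ((‖spaceGrad φ (X₀, b)‖)⁻¹ • spaceGrad φ (X₀, b))
      (timeDeriv φ (X₀, b) / ‖spaceGrad φ (X₀, b)‖) C ρ := by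
  obtain ⟨O, hO, hpO, hsm, hdef⟩ := hφ
  set p₀ : Space d × ℝ := (X₀, b) with hp₀
  set G : Space d := spaceGrad φ p₀ with hG
  have hg : 0 < ‖G‖ := norm_pos_iff.2 (hdef p₀ hpO).1
  set T : ℝ := timeDeriv φ p₀ with hT
  have hbI : b ∈ Icc a b := ⟨hab.le, le_rfl⟩
  have hφ0 : φ p₀ = 0 := ((hdef p₀ hpO).2 hbI).1.1 hp
  have hcd : ContDiffAt ℝ 2 φ p₀ :=
    ((hsm p₀ hpO).contDiffAt (hO.mem_nhds hpO)).of_le ENat.LEInfty.out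
  obtain ⟨C, hC, ρ₁, hρ₁, htay⟩ := exists_taylor_bound hcd
  obtain ⟨ρ₂, hρ₂, hρ₂O⟩ := Metric.isOpen_iff.1 hO p₀ hpO
  obtain ⟨ρ₃, hρ₃, hρ₃h⟩ := Metric.isOpen_iff.1 (isOpen_openHalf d) X₀ (S.mem_openHalf hp)
  set ρ : ℝ := min (min ρ₁ ρ₂) (min ρ₃ (b - a)) with hρ
  have hρ0 : 0 < ρ := lt_min (lt_min hρ₁ hρ₂) (lt_min hρ₃ (by linarith))
  have hl1 : ρ ≤ ρ₁ := (min_le_left _ _).trans (min_le_left _ _)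
  have hl2 : ρ ≤ ρ₂ := (min_le_left _ _).trans (min_le_right _ _)
  have hl3 : ρ ≤ ρ₃ := (min_le_right _ _).trans (min_le_left _ _)
  have hl4 : ρ ≤ b - a := (min_le_right _ _).trans (min_le_right _ _)
  have hball : ∀ X ∈ Metric.ball X₀ ρ, ∀ t ∈ Ioc (b - ρ) b, (X, t) ∈ Metric.ball p₀ ρ := by
    intro X hX t ht
    rw [Metric.mem_ball, Prod.dist_eq, max_lt_iff]
    refine ⟨hX, ?_⟩
    simp only [hp₀]
    rw [Real.dist_eq, abs_lt]
    constructor <;> linarith [ht.1, ht.2]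
  have hexp : ∀ X ∈ Metric.ball X₀ ρ, ∀ t ∈ Ioc (b - ρ) b,
      |φ (X, t) / ‖G‖ - (⟪X - X₀, ‖G‖⁻¹ • G⟫_ℝ - T / ‖G‖ * (b - t))| ≤
        C / ‖G‖ * (‖X - X₀‖ ^ 2 + (b - t) ^ 2) := by
    intro X hX t ht
    have h1 := htay (X, t) (Metric.ball_subset_ball hl1 (hball X hX t ht))
    have h2 : (X, t) - p₀ = (X - X₀, t - b) := rfl
    rw [hφ0, h2, fderiv_spaceTime (hcd.differentiableAt (by simp))] at h1
    have h3 : ‖(X - X₀, t - b)‖ ^ 2 ≤ ‖X - X₀‖ ^ 2 + (b - t) ^ 2 := by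
      rw [Prod.norm_mk, Real.norm_eq_abs]
      rcases max_choice ‖X - X₀‖ |t - b| with h | h <;> rw [h]
      · nlinarith [sq_nonneg (b - t)]
      · rw [sq_abs]; nlinarith [sq_nonneg ‖X - X₀‖]
    have h4 : φ (X, t) / ‖G‖ - (⟪X - X₀, ‖G‖⁻¹ • G⟫_ℝ - T / ‖G‖ * (b - t)) =
        (φ (X, t) - 0 - (⟪G, X - X₀⟫_ℝ + T * (t - b))) / ‖G‖ := by
      rw [inner_smul_right, real_inner_comm]
      field_simp
      ring
    rw [h4, abs_div, abs_of_pos hg, div_mul_eq_mul_div]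
    exact div_le_div_of_nonneg_right (h1.trans (mul_le_mul_of_nonneg_left h3 hC)) hg.le
  have hmem : ∀ X ∈ Metric.ball X₀ ρ, ∀ t ∈ Ioc (b - ρ) b, (X, t) ∈ O := fun X hX t ht =>
    hρ₂O (Metric.ball_subset_ball hl2 (hball X hX t ht))
  have hIcc : ∀ t ∈ Ioc (b - ρ) b, t ∈ Icc a b := fun t ht => ⟨by linarith [ht.1], ht.2⟩
  refine ⟨C / ‖G‖, ρ, ?_, by positivity, hρ0, hl4,
    (Metric.ball_subset_ball hl3).trans hρ₃h, ?_, ?_, ?_⟩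
  · rw [norm_smul, norm_inv, norm_norm, inv_mul_cancel₀ hg.ne']
  · intro X hX t ht hneg
    have h1 := abs_le.1 (hexp X hX t ht)
    have h2 : 0 ≤ φ (X, t) := by
      by_contra! hcon
      exact hneg ((((hdef _ (hmem X hX t ht)).2 (hIcc t ht)).2.2).2 hcon)
    have h3 : 0 ≤ φ (X, t) / ‖G‖ := by positivity
    linarith [h1.2]
  · intro X hX t ht hpos
    have h1 := abs_le.1 (hexp X hX t ht)
    have h2 : φ (X, t) ≤ 0 := by
      by_contra! hcon
      exact hpos ((((hdef _ (hmem X hX t ht)).2 (hIcc t ht)).2.1).2 hcon)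
    have h3 : φ (X, t) / ‖G‖ ≤ 0 := div_nonpos_of_nonpos_of_nonneg h2 hg.le
    linarith [h1.1]
  · intro r hr
    have hbox : IsCompact (Metric.closedBall X₀ r ×ˢ Icc (b - r) b) :=
      (isCompact_closedBall _ _).prod isCompact_Icc
    have hin : ∀ p ∈ Metric.closedBall X₀ r ×ˢ Icc (b - r) b,
        p.1 ∈ Metric.ball X₀ ρ ∧ p.2 ∈ Ioc (b - ρ) b := fun p hp =>
      ⟨Metric.closedBall_subset_ball hr hp.1, by linarith [hp.2.1], hp.2.2⟩
    have hc : ContinuousOn φ (Metric.closedBall X₀ r ×ˢ Icc (b - r) b) :=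
      hsm.continuousOn.mono fun p hp => hmem p.1 (hin p hp).1 p.2 (hin p hp).2
    have heq : Metric.closedBall X₀ r ×ˢ Icc (b - r) b ∩ {p : Space d × ℝ | p.1 ∉ S.neg p.2} =
        Metric.closedBall X₀ r ×ˢ Icc (b - r) b ∩ φ ⁻¹' Ici 0 := by
      ext p
      refine and_congr_right fun hp => ?_
      have h1 := ((hdef p (hmem p.1 (hin p hp).1 p.2 (hin p hp).2)).2 (hIcc _ (hin p hp).2)).2.2
      change p.1 ∉ S.neg p.2 ↔ 0 ≤ φ p
      rw [h1, not_lt]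
    rw [heq]
    exact hc.upperSemicontinuousOn.isCompact_inter_preimage_Ici hbox 0

namespace HasExpansion

variable {S : TestInterface d a b} {X₀ ν : Space d} {V C ρ : ℝ}

theorem mem_Ioc (h : S.HasExpansion X₀ ν V C ρ) : b ∈ Ioc (b - ρ) b :=
  ⟨by linarith [h.radius_pos], le_rfl⟩

theorem final_mem (h : S.HasExpansion X₀ ν V C ρ) : b ∈ Icc a b :=
  ⟨by linarith [h.radius_pos, h.radius_le], le_rfl⟩

theorem isParabolicBoundaryPoint (h : S.HasExpansion X₀ ν V C ρ) :
    IsParabolicBoundaryPoint (S.pos b) X₀ ν ρ C := by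
  refine ⟨h.norm_eq, S.isOpen_pos b h.final_mem, h.radius_pos, h.nonneg, fun X hX hlt => ?_,
    fun X hX => ?_⟩
  · by_contra hcon
    have := h.of_notMem_pos X hX b h.mem_Ioc hcon
    norm_num at this
    linarith
  · have := h.of_notMem_neg X hX.2 b h.mem_Ioc (S.notMem_neg_of_mem_closure h.final_mem hX.1)
    norm_num at this
    linarith

/-- With two different normals, a small step along ν - ν' would enter S⁺ by one expansion and S⁻ by
the other. Needed because velocity and normal may come from different defining functions. -/
theorem normal_unique (h : S.HasExpansion X₀ ν V C ρ) {ν' : Space d} {V' C' ρ' : ℝ}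
    (h' : S.HasExpansion X₀ ν' V' C' ρ') : ν = ν' := by
  by_contra hne
  have hc : ⟪ν, ν'⟫_ℝ < 1 := inner_lt_one_iff_real_of_norm_eq_one h.norm_eq h'.norm_eq |>.2 hne
  set e : Space d := ν - ν' with he
  have h1 : ⟪e, ν⟫_ℝ = 1 - ⟪ν, ν'⟫_ℝ := by
    rw [he, inner_sub_left, real_inner_self_eq_norm_sq, h.norm_eq, real_inner_comm]; norm_num
  have h2 : ⟪e, ν'⟫_ℝ = -(1 - ⟪ν, ν'⟫_ℝ) := by
    rw [he, inner_sub_left, real_inner_self_eq_norm_sq, h'.norm_eq]; ring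
  set κ : ℝ := 1 - ⟪ν, ν'⟫_ℝ with hκ
  have hκ0 : 0 < κ := by linarith
  have hev : ∀ᶠ s : ℝ in 𝓝[>] 0, ‖s • e‖ < ρ ∧ ‖s • e‖ < ρ' ∧ (C + C') * ‖e‖ ^ 2 * s < κ := by
    have t1 : Tendsto (fun s : ℝ => ‖s • e‖) (𝓝[>] 0) (𝓝 0) := by
      have hc : Continuous fun s : ℝ => ‖s • e‖ := by fun_prop
      have := hc.tendsto 0
      rw [zero_smul, norm_zero] at this
      exact this.mono_left nhdsWithin_le_nhds
    have t2 : Tendsto (fun s : ℝ => (C + C') * ‖e‖ ^ 2 * s) (𝓝[>] 0) (𝓝 0) := by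
      have hc : Continuous fun s : ℝ => (C + C') * ‖e‖ ^ 2 * s := by fun_prop
      have := hc.tendsto 0
      rw [mul_zero] at this
      exact this.mono_left nhdsWithin_le_nhds
    exact (t1.eventually_lt_const h.radius_pos).and
      ((t1.eventually_lt_const h'.radius_pos).and (t2.eventually_lt_const hκ0))
  obtain ⟨s, ⟨hs1, hs2, hs3⟩, hs⟩ := (hev.and self_mem_nhdsWithin).exists
  have hs0 : 0 < s := hs
  have hC := h.nonneg
  have hC' := h'.nonneg
  have hsn : ‖s • e‖ ^ 2 = s * (‖e‖ ^ 2 * s) := by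
    rw [norm_smul, Real.norm_of_nonneg hs0.le]; ring
  have hq : 0 ≤ ‖e‖ ^ 2 * s := by positivity
  have hpos : X₀ + s • e ∈ S.pos b := by
    refine h.isParabolicBoundaryPoint.interior _ (by simpa [dist_eq_norm] using hs1) ?_
    rw [add_sub_cancel_left, inner_smul_left, h1, hsn]
    simp only [RCLike.conj_to_real]
    nlinarith [mul_nonneg hC' hq]
  have hneg : X₀ + s • e ∈ S.neg b := by
    by_contra hcon
    have h3 := h'.of_notMem_neg _ (by simpa [dist_eq_norm] using hs2) b h'.mem_Ioc hcon
    rw [add_sub_cancel_left, inner_smul_left, h2, hsn] at h3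
    simp only [RCLike.conj_to_real] at h3
    nlinarith [mul_nonneg hC hq]
  exact (S.disjoint b h.final_mem).le_bot ⟨hpos, hneg⟩

/-- The ball of radius ρ avoids Γ₀, so the only boundary points of S⁺ in it lie on the interface. -/
theorem isHarmonicVanishing (h : S.HasExpansion X₀ ν V C ρ) {W : Space d × ℝ → ℝ}
    (hW : S.IsPotential W) : IsHarmonicVanishing (slice W b) (S.pos b) X₀ ρ := by
  refine ⟨fun X hX => hW.harmonic b h.final_mem X hX.1, hW.continuousOn b h.final_mem,
    fun X hX hXΩ => ?_⟩
  rcases S.mem_carrier_or_bottom h.final_mem hX.1 hXΩ with h1 | h1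
  · exact hW.eq_zero _ h1
  · have h2 : 0 < height X := h.subset_openHalf hX.2
    have h3 : height X = 0 := h1
    linarith

/-- Points of the final region `S⁻` stay in `S⁻` for a short time in the past. -/
theorem exists_past_neg (h : S.HasExpansion X₀ ν V C ρ) {X₁ : Space d} (hX₁ : X₁ ∈ S.neg b) :
    ∃ r > 0, r ≤ b - a ∧ ∀ X ∈ Metric.ball X₁ r, ∀ t ∈ Ioc (b - r) b, X ∈ S.neg t := by
  -- The sides are controlled in time only near the interface; elsewhere continuity in time is
  -- propagated through the connected set S(b)⁻ by showing that A is open, nonempty and relatively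
  -- closed in it.
  set A : Set (Space d) :=
    {X | ∃ r > 0, r ≤ b - a ∧ ∀ Y ∈ Metric.ball X r, ∀ t ∈ Ioc (b - r) b, Y ∈ S.neg t} with hA
  suffices hsub : S.neg b ⊆ A from hsub hX₁
  have hb := h.final_mem
  have hAo : IsOpen A := by
    rw [Metric.isOpen_iff]
    rintro X ⟨r, hr, hrb, hX⟩
    refine ⟨r / 2, half_pos hr, fun X' hX' => ⟨r / 2, half_pos hr, by linarith, fun Y hY t ht =>
      hX Y ?_ t ⟨by linarith [ht.1], ht.2⟩⟩⟩
    rw [Metric.mem_ball] at hX' hY ⊢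
    linarith [dist_triangle Y X' X]
  have hab := h.radius_le
  have hρ := h.radius_pos
  refine (S.connected_neg b hb).isPreconnected.subset_of_closure_inter_subset hAo ?_ ?_
  -- Where F < 0 the expansion forces S⁻. This holds at X₀ - sν at the final time, hence on a
  -- space-time neighbourhood, which starts the continuation.
  · let F : Space d × ℝ → ℝ := fun p => ⟪p.1 - X₀, ν⟫_ℝ - V * (b - p.2) +
        C * (‖p.1 - X₀‖ ^ 2 + (b - p.2) ^ 2)
    have hcont : Continuous F := by fun_prop
    have hev : ∀ᶠ s : ℝ in 𝓝[>] 0, s < ρ ∧ C * s < 1 := by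
      have t2 : Tendsto (fun s : ℝ => C * s) (𝓝[>] 0) (𝓝 0) := by
        have hc : Continuous fun s : ℝ => C * s := by fun_prop
        have := hc.tendsto 0
        rw [mul_zero] at this
        exact this.mono_left nhdsWithin_le_nhds
      have t1 : ∀ᶠ s : ℝ in 𝓝[>] 0, s < ρ := nhdsWithin_le_nhds (eventually_lt_nhds hρ)
      exact t1.and (t2.eventually_lt_const one_pos)
    obtain ⟨s, ⟨hs1, hs2⟩, hs⟩ := (hev.and self_mem_nhdsWithin).exists
    have hs0 : 0 < s := hs
    have hsn : ‖s • ν‖ = s := by rw [norm_smul, h.norm_eq, mul_one, Real.norm_of_nonneg hs0.le]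
    set Z : Space d := X₀ - s • ν with hZ
    have hZX : Z - X₀ = -(s • ν) := by rw [hZ]; abel
    have hZb : Z ∈ Metric.ball X₀ ρ := by
      rw [Metric.mem_ball, dist_eq_norm, hZX, norm_neg, hsn]; exact hs1
    have hZneg : F (Z, b) < 0 := by
      simp only [F]
      rw [hZX, inner_neg_left, norm_neg, hsn, inner_smul_left, real_inner_self_eq_norm_sq,
        h.norm_eq]
      simp only [RCLike.conj_to_real, one_pow, mul_one, sub_self, mul_zero, sub_zero]
      nlinarith
    have hmemO : Metric.ball X₀ ρ ×ˢ Ioi (b - ρ) ∈ 𝓝 (Z, b) :=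
      (Metric.isOpen_ball.prod isOpen_Ioi).mem_nhds ⟨hZb, by simpa using hρ⟩
    have hnegO : ∀ᶠ p in 𝓝 (Z, b), F p < 0 :=
      (hcont.tendsto (Z, b)).eventually_lt_const hZneg
    have hnhds : ∀ᶠ p in 𝓝 (Z, b), F p < 0 ∧ p ∈ Metric.ball X₀ ρ ×ˢ Ioi (b - ρ) :=
      hnegO.and hmemO
    obtain ⟨r, hr, hball⟩ := Metric.eventually_nhds_iff_ball.1 hnhds
    have hZA : Z ∈ A := by
      refine ⟨min r (b - a), lt_min hr (by linarith), min_le_right _ _, fun Y hY t ht => ?_⟩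
      have hYt : (Y, t) ∈ Metric.ball (Z, b) r := by
        rw [Metric.mem_ball, Prod.dist_eq, max_lt_iff]
        refine ⟨(Metric.ball_subset_ball (min_le_left _ _) hY), ?_⟩
        simp only
        rw [Real.dist_eq, abs_lt]
        have := min_le_left r (b - a)
        constructor <;> linarith [ht.1, ht.2]
      obtain ⟨h1, h2⟩ := hball _ hYt
      by_contra hcon
      have := h.of_notMem_neg Y h2.1 t ⟨h2.2, ht.2⟩ hcon
      simp only [F] at h1
      linarith
    refine ⟨Z, ?_, hZA⟩
    obtain ⟨r', hr', _, hZr⟩ := hZA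
    exact hZr Z (Metric.mem_ball_self hr') b ⟨by linarith, le_rfl⟩
  -- The carrier is closed, so a space-time ball about (X, b) misses it. Its time slices are
  -- connected and therefore lie on one side, which a nearby point of A identifies as S⁻.
  · rintro X ⟨hXcl, hXneg⟩
    have hopen : IsOpen (openHalf d ×ˢ (univ : Set ℝ) ∩ S.carrierᶜ) :=
      ((isOpen_openHalf d).prod isOpen_univ).inter S.isClosed.isOpen_compl
    obtain ⟨r, hr, hrsub⟩ := Metric.isOpen_iff.1 hopen (X, b)
      ⟨⟨S.neg_subset hb hXneg, mem_univ _⟩, S.notMem_carrier_of_mem_neg hb hXneg⟩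
    obtain ⟨X', hX'A, hX'X⟩ := Metric.mem_closure_iff.1 hXcl r hr
    obtain ⟨r', hr', hr'b, hX'⟩ := hX'A
    refine ⟨min r r', lt_min hr hr', (min_le_right _ _).trans hr'b, fun Y hY t ht => ?_⟩
    have hle := min_le_left r r'
    have hle' := min_le_right r r'
    have htI : t ∈ Icc a b := ⟨by linarith [ht.1], ht.2⟩
    have hsubu : Metric.ball X r ⊆ S.pos t ∪ S.neg t := by
      intro Z hZ
      rw [← S.separates t htI]
      have hZt : (Z, t) ∈ Metric.ball (X, b) r := by
        rw [Metric.mem_ball, Prod.dist_eq, max_lt_iff]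
        refine ⟨hZ, ?_⟩
        simp only
        rw [Real.dist_eq, abs_lt]
        constructor <;> linarith [ht.1, ht.2]
      exact ⟨(hrsub hZt).1.1, (hrsub hZt).2⟩
    have hX'neg : X' ∈ S.neg t := hX' X' (Metric.mem_ball_self hr') t ⟨by linarith [ht.1], ht.2⟩
    exact (convex_ball X r).isPreconnected.subset_right_of_subset_union (S.isOpen_pos t htI)
      (S.isOpen_neg t htI) (S.disjoint t htI) hsubu
      ⟨X', by rw [Metric.mem_ball, dist_comm]; exact hX'X, hX'neg⟩
      (Metric.ball_subset_ball hle hY)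

end HasExpansion

theorem IsPotential.exists_bound {S : TestInterface d a b} {W : Space d × ℝ → ℝ}
    (hW : S.IsPotential W) {t : ℝ} (ht : t ∈ Icc a b) :
    ∃ M, ∀ X ∈ closure (S.pos t), |W (X, t)| ≤ M := by
  obtain ⟨M, hM⟩ := hW.bounded t ht
  refine ⟨M, fun X hX => ?_⟩
  exact ContinuousWithinAt.closure_le hX
    (((hW.continuousOn t ht X hX).mono subset_closure).abs) continuousWithinAt_const hM

/-- The potential of a test interface is nonnegative. -/
theorem IsPotential.nonneg (hd : 1 ≤ d) {S : TestInterface d a b} {W : Space d × ℝ → ℝ}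
    (hW : S.IsPotential W) {t : ℝ} (ht : t ∈ Icc a b) :
    ∀ X ∈ closure (S.pos t), 0 ≤ W (X, t) := by
  obtain ⟨M, hMcl⟩ := hW.exists_bound ht
  have h := phragmen_lindelof hd (S.isOpen_pos t ht)
    ((S.pos_subset ht).trans (openHalf_subset_closedHalf d)) (f := fun X => -W (X, t)) (M := M)
    (hW.continuousOn t ht).neg.upperSemicontinuousOn
    (fun X hX => by linarith [(abs_le.1 (hMcl X hX)).1])
    (fun X hX hXp => by
      rcases S.mem_carrier_or_bottom ht hX hXp with h1 | h1
      · rw [hW.eq_zero _ h1]; simp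
      · rw [hW.eq_one t ht X h1]; norm_num)
    (fun X hX _ => isSubharmonicAt_of_harmonicAt (hW.harmonic t ht X hX).neg)
  intro X hX
  linarith [h X hX]

end TestInterface

/-- Space-time version of `paraboloid_bound` for a paraboloid moving with velocity `V`, tested with
a smaller velocity `V'`. -/
theorem exists_moving_paraboloid_bound {m V V' C A N : ℝ} (hm : 0 < m) (hV : V' < V) (hC : 0 ≤ C)
    (hA : 2 * m * C + 1 ≤ A) (hN : 0 ≤ N) : ∃ ρ > 0, ∀ ℓ q s : ℝ, |ℓ| ≤ ρ → 0 ≤ q → 0 ≤ s → s ≤ ρ →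
      -(C * (q + s ^ 2)) ≤ ℓ - V * s → q ≤ m * (ℓ - V' * s) + A * q - N * ℓ ^ 2 := by
  -- Half the speed gap: one half absorbs C s², the other leaves κ s ≤ p + C q.
  set κ : ℝ := (V - V') / 2 with hκ
  have hκ0 : 0 < κ := by rw [hκ]; linarith
  set B : ℝ := 1 + |V'| / κ with hB
  have hB1 : 1 ≤ B := by rw [hB]; have : 0 ≤ |V'| / κ := by positivity
                         linarith
  refine ⟨min (κ / (C + 1)) (m / 2 / (N * B + 1)), by positivity, fun ℓ q s hℓ hq hs hsρ h => ?_⟩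
  set ρ : ℝ := min (κ / (C + 1)) (m / 2 / (N * B + 1)) with hρ
  have hρ1 : C * ρ ≤ κ := by
    have h1 : ρ * (C + 1) ≤ κ := by
      rw [← le_div_iff₀ (by positivity)]; exact min_le_left _ _
    have hρ0 : 0 ≤ ρ := by positivity
    linarith
  have hρ2 : N * ρ * B ≤ m / 2 := by
    have h1 : ρ * (N * B + 1) ≤ m / 2 := by
      rw [← le_div_iff₀ (by positivity)]; exact min_le_right _ _
    have hρ0 : 0 ≤ ρ := by positivity
    linarith
  set p : ℝ := ℓ - V' * s with hp
  have hCs : C * s ^ 2 ≤ κ * s := by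
    have h1 : C * s ≤ κ := (mul_le_mul_of_nonneg_left hsρ hC).trans hρ1
    nlinarith
  have hVs : V * s = V' * s + 2 * κ * s := by rw [hκ]; ring
  have hpκ : κ * s - C * q ≤ p := by rw [hp]; linarith
  have hCq : 0 ≤ C * q := mul_nonneg hC hq
  -- The speed gap bounds s, and hence ℓ, linearly by |p| + C q. So N ℓ² is of higher order and is
  -- absorbed for small ρ.
  have hℓB : |ℓ| ≤ B * (|p| + C * q) := by
    have h1 : s ≤ (|p| + C * q) / κ := by
      rw [le_div_iff₀ hκ0]; linarith [le_abs_self p]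
    have h2 : |ℓ| ≤ |p| + |V'| * s := by
      have : ℓ = p + V' * s := by rw [hp]; ring
      rw [this]
      refine (abs_add_le _ _).trans ?_
      rw [abs_mul, abs_of_nonneg hs]
    have h3 : |V'| * s ≤ |V'| / κ * (|p| + C * q) := by
      rw [div_mul_eq_mul_div, mul_div_assoc]
      exact mul_le_mul_of_nonneg_left h1 (abs_nonneg _)
    rw [hB]
    linarith
  have hNℓ : N * ℓ ^ 2 ≤ m / 2 * (|p| + C * q) := by
    have h1 : N * ℓ ^ 2 = N * |ℓ| * |ℓ| := by rw [← sq_abs]; ring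
    have h2 : N * |ℓ| * |ℓ| ≤ N * ρ * (B * (|p| + C * q)) :=
      mul_le_mul (mul_le_mul_of_nonneg_left hℓ hN) hℓB (abs_nonneg _) (by positivity)
    have h3 : N * ρ * (B * (|p| + C * q)) ≤ m / 2 * (|p| + C * q) := by
      rw [← mul_assoc]
      exact mul_le_mul_of_nonneg_right hρ2 (by positivity)
    linarith
  have hAq : (2 * m * C + 1) * q ≤ A * q := mul_le_mul_of_nonneg_right hA hq
  have hmCq : 0 ≤ m * (C * q) := by positivity
  rcases abs_cases p with ⟨h1, h2⟩ | ⟨h1, h2⟩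
  · rw [h1] at hNℓ
    have := mul_nonneg hm.le h2
    linarith
  · rw [h1] at hNℓ
    have h3 : -(C * q) ≤ p := by
      have : 0 ≤ κ * s := by positivity
      linarith
    have h4 := mul_le_mul_of_nonneg_left h3 hm.le
    linarith

namespace TestInterface

variable {d : ℕ} {a b : ℝ}

/-- Existence of the slope of the potential at a boundary point, with linear bounds on both
sides. -/
theorem HasExpansion.exists_slope {S : TestInterface d a b} {X₀ ν : Space d} {V C ρ : ℝ}
    (h : S.HasExpansion X₀ ν V C ρ) (hp : (X₀, b) ∈ S.carrier) {W : Space d × ℝ → ℝ}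
    (hW : S.IsPotential W) :
    ∃ L, HasOneSidedDeriv W (X₀, b) ν L ∧
      (∀ α < L, HasLowerSlope (slice W b) (S.pos b) X₀ ν α) ∧
      ∀ α > L, HasLowerSlope (fun X => -slice W b X) (S.pos b) X₀ ν (-α) := by
  obtain ⟨L, h1, h2⟩ := h.isParabolicBoundaryPoint.exists_slope (h.isHarmonicVanishing hW)
  refine ⟨L, ?_, h1, h2⟩
  have h3 := h.isParabolicBoundaryPoint.tendsto_slope h1 h2
  have h4 : W (X₀, b) = 0 := hW.eq_zero _ hp
  simp only [HasOneSidedDeriv, h4, sub_zero]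
  exact h3

end TestInterface

/-! ### Subsolutions touched from above: no jump across the interface, comparison with the
potential. -/

section Subsolution

variable {d : ℕ} {U₀ : Space d → ℝ} {U : Space d × ℝ → ℝ} {t₀ τ : ℝ}
  {S : TestInterface d (t₀ - τ) t₀}

theorem eq_zero_of_mem_neg (hnn : ∀ p ∈ cylinder d (Ici 0), 0 ≤ U p) (hτ : 0 ≤ t₀ - τ)
    (htouch : ∀ t ∈ Icc (t₀ - τ) t₀, ∀ X ∈ closedHalf d, 0 < U (X, t) → X ∈ closure (S.pos t))
    {t : ℝ} (ht : t ∈ Icc (t₀ - τ) t₀) {X : Space d} (hX : X ∈ S.neg t) : U (X, t) = 0 := by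
  have hXh := openHalf_subset_closedHalf d (S.neg_subset ht hX)
  refine le_antisymm ?_ (hnn _ ⟨hXh, hτ.trans ht.1⟩)
  by_contra! hcon
  exact S.notMem_neg_of_mem_closure ht (htouch t ht X hXh hcon) hX

theorem hasFDerivAt_innerSL_gradient {E : Type*} [NormedAddCommGroup E] [InnerProductSpace ℝ E]
    [CompleteSpace E] {f : E → ℝ} {x : E} (hf : DifferentiableAt ℝ f x) :
    HasFDerivAt f (innerSL ℝ (∇ f x)) x := by
  refine hf.hasGradientAt.hasFDerivAt.congr_fderiv ?_
  ext v
  simp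

/-- The positivity set of a subsolution that is touched from above cannot jump across the
interface at the final time. -/
theorem IsKimSubsolution.notMem_closure_of_mem_neg (hU : IsKimSubsolution U₀ U) (hτ : 0 ≤ t₀ - τ)
    (htouch : ∀ t ∈ Icc (t₀ - τ) t₀, ∀ X ∈ closedHalf d, 0 < U (X, t) → X ∈ closure (S.pos t))
    (hunb : ¬ Bornology.IsBounded (S.neg t₀)) {X₀ ν : Space d} {V C ρ : ℝ}
    (hexp : S.HasExpansion X₀ ν V C ρ) :
    ∀ X ∈ S.neg t₀, (X, t₀) ∉ closure (positivitySet (Ici 0) U) := by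
  have hb := hexp.final_mem
  have ht₀ : 0 < t₀ := by linarith [hexp.radius_pos, hexp.radius_le]
  -- The closure is in space-time over all times, so J also contains limits of positive points from
  -- after `t₀`.
  set J : Set (Space d) := {X | (X, t₀) ∈ closure (positivitySet (Ici 0) U)} with hJ
  have hJc : IsClosed J := isClosed_closure.preimage (by fun_prop : Continuous fun X => (X, t₀))
  have hJb : Bornology.IsBounded J := by
    have h1 := (hU.bounded_support t₀ ht₀.le).image_fst
    exact h1.subset fun X hX => ⟨(X, t₀), ⟨hX, le_refl t₀⟩, rfl⟩
  -- Otherwise J has, near X, a boundary point touched by an exterior ball, and there Kim's free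
  -- boundary test fails.
  have claim : ∀ X ∈ J ∩ S.neg t₀, X ∈ interior J := by
    rintro X₂ ⟨hX₂J, hX₂⟩
    by_contra hint
    obtain ⟨r, hr, hrb, hpast⟩ := hexp.exists_past_neg hX₂
    have hnot : ¬ Metric.ball X₂ (r / 4) ⊆ J := fun hsub =>
      hint (mem_interior.2 ⟨_, hsub, Metric.isOpen_ball, Metric.mem_ball_self (by linarith)⟩)
    obtain ⟨z, hz, hzJ⟩ := not_subset.1 hnot
    obtain ⟨X₁, hX₁J, hX₁z⟩ := hJc.exists_infDist_eq_dist ⟨X₂, hX₂J⟩ z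
    set R : ℝ := dist z X₁ with hR
    have hR0 : 0 < R := dist_pos.2 fun h => hzJ (h ▸ hX₁J)
    have hRle : ∀ X ∈ J, R ≤ ‖X - z‖ := by
      intro X hX
      rw [← hX₁z, ← dist_eq_norm, dist_comm]
      exact Metric.infDist_le_dist_of_mem hX
    have hX₁ball : X₁ ∈ Metric.ball X₂ (r / 2) := by
      have h1 : R ≤ dist z X₂ := hX₁z ▸ Metric.infDist_le_dist_of_mem hX₂J
      have h2 : dist z X₂ < r / 4 := hz
      have h3 := dist_triangle X₁ z X₂
      rw [Metric.mem_ball]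
      rw [dist_comm X₁ z] at h3
      linarith
    set n : ℝ := (Module.finrank ℝ (Space d) : ℝ) with hn
    -- The value for which ΔΨ(X₁) = 2n - 8kR² = -1.
    set k : ℝ := (2 * n + 1) / (8 * R ^ 2) with hk
    have hk0 : 0 < k := by positivity
    -- Q is nonnegative on J and vanishes at X₁, but is subharmonic; composing with the concave g
    -- keeps these signs near X₁ and makes Ψ superharmonic there.
    let g : ℝ → ℝ := fun u => u - k * u ^ 2
    have hgcd : ContDiff ℝ 2 g := contDiff_id.sub (contDiff_const.mul (contDiff_id.pow 2))
    let Q : Space d → ℝ := quad z 0 (-R ^ 2) 0 1 0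
    have hQ : ∀ X, Q X = ‖X - z‖ ^ 2 - R ^ 2 := fun X => by simp [Q, quad]; ring
    have hQcd : ContDiff ℝ 2 Q := contDiff_quad _ _ _ _ _ _
    have hX₁R : ‖X₁ - z‖ = R := by rw [← dist_eq_norm, dist_comm]
    have hQ1 : Q X₁ = 0 := by rw [hQ, hX₁R, sub_self]
    let Ψ : Space d → ℝ := fun X => g (Q X)
    have hΨcd : ContDiff ℝ 2 Ψ := hgcd.comp hQcd
    have hg1 : deriv g = fun u => 1 - 2 * k * u := by
      funext u
      have := ((hasDerivAt_id u).sub (((hasDerivAt_id u).pow 2).const_mul k)).deriv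
      refine Eq.trans this ?_
      simp
      ring
    have hg2 : deriv (deriv g) (Q X₁) = -(2 * k) := by
      rw [hg1]
      have := (((hasDerivAt_id (Q X₁)).const_mul (2 * k)).const_sub 1).deriv
      refine Eq.trans this ?_
      simp
    have hlap : Δ Ψ X₁ < 0 := by
      have h1 := laplacian_comp (g := g) hQcd.contDiffAt hgcd.contDiffAt
        (hasFDerivAt_quad z (0 : Space d) (-R ^ 2) 0 1 0 X₁).fderiv
      have h2 : Δ Q X₁ = 2 * n := by
        simp only [Q]
        rw [laplacian_quad, ← hn]; simp
      rw [h2, hg2, hg1, hQ1] at h1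
      have h3 : Δ Ψ X₁ = _ := h1
      rw [h3, smul_zero, zero_add, norm_smul, hX₁R]
      have h4 : k * (8 * R ^ 2) = 2 * n + 1 := by rw [hk]; field_simp
      norm_num
      nlinarith
    set G : Space d := ∇ Ψ X₁ with hG
    have hgrad : HasFDerivAt Ψ (innerSL ℝ G) X₁ :=
      hasFDerivAt_innerSL_gradient (hΨcd.contDiffAt.differentiableAt (by simp))
    -- The time slope may exceed |∇Ψ|² at will, since no point of the closed positivity set lies
    -- near X₁ before `t₀`.
    set c : ℝ := ‖G‖ ^ 2 + 1 with hc
    have hX₁r : X₁ ∈ Metric.ball X₂ r := Metric.ball_subset_ball (by linarith) hX₁ball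
    have hX₁neg : X₁ ∈ S.neg t₀ := hpast X₁ hX₁r t₀ ⟨by linarith, le_rfl⟩
    have hX₁half := S.neg_subset hb hX₁neg
    have hU1 : U (X₁, t₀) = 0 := eq_zero_of_mem_neg hU.nonneg hτ htouch hb hX₁neg
    have hcyl : (X₁, t₀) ∈ cylinder d (Ici 0) :=
      ⟨openHalf_subset_closedHalf d hX₁half, ht₀.le⟩
    have hevQ : ∀ᶠ X in 𝓝 X₁, k * Q X < 1 := by
      have : ContinuousAt (fun X => k * Q X) X₁ := hQcd.continuous.continuousAt.const_mul k
      refine this.eventually_lt continuousAt_const ?_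
      rw [hQ1, mul_zero]; exact one_pos
    have htest := (hU.test _ (isC21On_add_mul_time hΨcd c _) (X₁, t₀)
      ⟨⟨hX₁J, le_refl t₀⟩, hX₁half, ht₀⟩ (by
        have hn1 : ∀ᶠ q : Space d × ℝ in 𝓝 (X₁, t₀), k * Q q.1 < 1 :=
          (continuous_fst.tendsto (X₁, t₀)).eventually hevQ
        have hn2 : Metric.ball X₂ r ×ˢ Ioi (t₀ - r) ∈ 𝓝 (X₁, t₀) :=
          (Metric.isOpen_ball.prod isOpen_Ioi).mem_nhds
            ⟨hX₁r, show t₀ - r < t₀ by linarith⟩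
        filter_upwards [mem_nhdsWithin_of_mem_nhds hn1, mem_nhdsWithin_of_mem_nhds hn2,
          self_mem_nhdsWithin] with q hq1 hq2 hq3
        obtain ⟨⟨hqcl, hqt⟩, hqQ⟩ := hq3
        have hqt' : q.2 ≤ t₀ := hqt
        have hq2' : t₀ - r < q.2 := hq2.2
        -- Strictly before `t₀` the neighbourhood lies in the open past of S⁻, where U vanishes, so
        -- it contains no limit of positive points.
        have hqeq : q.2 = t₀ := by
          by_contra hne
          have hlt : q.2 < t₀ := lt_of_le_of_ne hqt' hne
          have ho : IsOpen (Metric.ball X₂ r ×ˢ Ioo (t₀ - r) t₀) :=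
            Metric.isOpen_ball.prod isOpen_Ioo
          obtain ⟨p, hp, hpU⟩ := mem_closure_iff.1 hqcl _ ho ⟨hq2.1, hq2', hlt⟩
          have hpn := hpast p.1 hp.1 p.2 ⟨hp.2.1, hp.2.2.le⟩
          have h0 := eq_zero_of_mem_neg hU.nonneg hτ htouch
            (t := p.2) ⟨by linarith [hp.2.1], hp.2.2.le⟩ hpn
          exact hpU.2.ne' h0
        have hqX : (q.1, t₀) = q := by rw [← hqeq]
        have hqJ : q.1 ∈ J := by
          change (q.1, t₀) ∈ closure (positivitySet (Ici 0) U)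
          rw [hqX]; exact hqcl
        have hUq : U q = 0 := by
          rw [← hqX]
          exact eq_zero_of_mem_neg hU.nonneg hτ htouch hb
            (hpast q.1 hq2.1 t₀ ⟨by linarith, le_rfl⟩)
        have hΨq : 0 ≤ Ψ q.1 := by
          have h1 : 0 ≤ Q q.1 := by
            rw [hQ]
            have := pow_le_pow_left₀ hR0.le (hRle q.1 hqJ) 2
            linarith
          have h2 : Ψ q.1 = Q q.1 * (1 - k * Q q.1) := by simp only [Ψ, g]; ring
          rw [h2]
          exact mul_nonneg h1 (by linarith)
        have hΨ1 : Ψ X₁ = 0 := by simp [Ψ, g, hQ1]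
        rw [hUq, hU1, hqeq, hΨ1]
        linarith)).2
      ⟨hX₁J, subset_closure ⟨hcyl, fun h => h.2.ne' hU1⟩⟩ hU1
    rw [spaceLaplacian_add_mul_time hΨcd, timeDeriv_add_mul_time,
      spaceGrad_add_mul_time (p := (X₁, t₀)) hgrad] at htest
    rcases min_le_iff.1 htest with h | h
    · simp only at h; linarith
    · linarith
  intro X hX hXJ
  -- J is both open and closed in the connected set S(t₀)⁻; if it met this set it would contain it,
  -- against bounded support.
  have hsub : S.neg t₀ ⊆ interior J :=
    (S.connected_neg t₀ hb).isPreconnected.subset_of_closure_inter_subset isOpen_interior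
      ⟨X, hX, claim X ⟨hXJ, hX⟩⟩
      fun Y hY => claim Y ⟨closure_minimal interior_subset hJc hY.1, hY.2⟩
  exact hunb (hJb.subset (hsub.trans interior_subset))

theorem upperSemicontinuousOn_slice {U : Space d × ℝ → ℝ}
    (hU : UpperSemicontinuousOn U (cylinder d (Ici 0))) {t : ℝ} (ht : 0 ≤ t) :
    UpperSemicontinuousOn (fun X => U (X, t)) (closedHalf d) :=
  fun X hX y hy => by
    have hc : Continuous fun X : Space d => (X, t) := by fun_prop
    have hmaps : MapsTo (fun X : Space d => (X, t)) (closedHalf d) (cylinder d (Ici 0)) :=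
      fun Z hZ => ⟨hZ, ht⟩
    exact (hc.continuousWithinAt.tendsto_nhdsWithin hmaps).eventually (hU (X, t) ⟨hX, ht⟩ y hy)

/-- A subsolution that is touched from above vanishes on the final slice of the interface. -/
theorem IsKimSubsolution.eq_zero_of_mem_carrier (hU : IsKimSubsolution U₀ U) (hτ : 0 ≤ t₀ - τ)
    (hτ0 : 0 < τ)
    (htouch : ∀ t ∈ Icc (t₀ - τ) t₀, ∀ X ∈ closedHalf d, 0 < U (X, t) → X ∈ closure (S.pos t))
    {X₁ : Space d} (hX₁ : (X₁, t₀) ∈ S.carrier) : U (X₁, t₀) = 0 := by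
  obtain ⟨φ, hφ⟩ := S.smooth _ hX₁
  obtain ⟨C, ρ, hexp⟩ := S.exists_hasExpansion (by linarith) hX₁ hφ
  have hb := hexp.final_mem
  have ht₀ : 0 < t₀ := by linarith
  have hρ := hexp.radius_pos
  have hsub : Metric.closedBall X₁ (ρ / 2) ⊆ Metric.ball X₁ ρ :=
    Metric.closedBall_subset_ball (by linarith)
  have hsub' : Metric.closedBall X₁ (ρ / 2) ⊆ openHalf d := hsub.trans hexp.subset_openHalf
  have husc := (upperSemicontinuousOn_slice hU.usc ht₀.le).mono
    (hsub'.trans (openHalf_subset_closedHalf d))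
  obtain ⟨M, hM⟩ := husc.bddAbove_of_isCompact (isCompact_closedBall _ _)
  -- The growth bound also covers the vertex itself, where its right side is 0.
  obtain ⟨lam, hlam, K, hK, r, hr, hgrow⟩ := exists_linear_growth hexp.norm_eq (half_pos hρ)
    hexp.nonneg husc (fun X hX => hM (mem_image_of_mem _ hX))
    (fun X hX hpos => hexp.isParabolicBoundaryPoint.exterior X ⟨htouch t₀ hb X
      (openHalf_subset_closedHalf d (hsub' hX)) hpos, hsub hX⟩)
    (fun X hX hpos => hU.isSubharmonicAt (hsub' (Metric.ball_subset_closedBall hX)) ht₀ hpos)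
  refine le_antisymm ?_ (hU.nonneg _
    ⟨openHalf_subset_closedHalf d (S.mem_openHalf hX₁), ht₀.le⟩)
  by_contra! hcon
  have := hgrow X₁ (Metric.mem_ball_self hr) hcon
  simp at this
  linarith

/-- Bounded support makes the closed positivity set compact up to time t, and upper semicontinuity
does the rest. This is the boundedness needed for Phragmén-Lindelöf. -/
theorem IsKimSubsolution.exists_bound (hU : IsKimSubsolution U₀ U) {t : ℝ} (ht : 0 ≤ t) :
    ∃ M, ∀ X ∈ closedHalf d, U (X, t) ≤ M := by
  have hc : IsCompact (closure (positivitySet (Ici 0) U) ∩ {p | p.2 ≤ t}) :=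
    Metric.isCompact_of_isClosed_isBounded
      (isClosed_closure.inter (isClosed_le continuous_snd continuous_const))
      (hU.bounded_support t ht)
  have hcyl : closure (positivitySet (Ici 0) U) ⊆ cylinder d (Ici 0) :=
    closure_minimal (fun p hp => hp.1) ((isClosed_closedHalf d).prod isClosed_Ici)
  obtain ⟨M, hM⟩ := (hU.usc.mono (inter_subset_left.trans hcyl)).bddAbove_of_isCompact hc
  refine ⟨max M 0, fun X hX => ?_⟩
  rcases le_or_gt (U (X, t)) 0 with h | h
  · exact h.trans (le_max_right _ _)
  · exact (hM (mem_image_of_mem U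
      ⟨subset_closure (⟨⟨hX, ht⟩, h⟩ : (X, t) ∈ positivitySet (Ici 0) U), le_refl t⟩)).trans
      (le_max_left _ _)

/-- On the interface both functions vanish, on Γ₀ the order is prescribed, and where U > W ≥ 0 the
difference is subharmonic. -/
theorem IsKimSubsolution.le_potential (hd : 1 ≤ d) (hU : IsKimSubsolution U₀ U)
    (hτ : 0 ≤ t₀ - τ) (hτ0 : 0 < τ)
    (htouch : ∀ t ∈ Icc (t₀ - τ) t₀, ∀ X ∈ closedHalf d, 0 < U (X, t) → X ∈ closure (S.pos t))
    {W : Space d × ℝ → ℝ} (hW : S.IsPotential W) :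
    ∀ X ∈ closure (S.pos t₀), U (X, t₀) ≤ W (X, t₀) := by
  have hb : t₀ ∈ Icc (t₀ - τ) t₀ := ⟨by linarith, le_rfl⟩
  have ht₀ : 0 < t₀ := by linarith
  have hcl := S.closure_pos_subset hb
  have hWnn := hW.nonneg hd hb
  obtain ⟨M, hM⟩ := hU.exists_bound ht₀.le
  have h := phragmen_lindelof hd (S.isOpen_pos t₀ hb)
    ((S.pos_subset hb).trans (openHalf_subset_closedHalf d))
    (f := fun X => U (X, t₀) + -W (X, t₀)) (M := M)
    (((upperSemicontinuousOn_slice hU.usc ht₀.le).mono hcl).add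
      (hW.continuousOn t₀ hb).neg.upperSemicontinuousOn)
    (fun X hX => by linarith [hM X (hcl hX), hWnn X hX])
    (fun X hX hXp => by
      rcases S.mem_carrier_or_bottom hb hX hXp with h1 | h1
      · rw [hW.eq_zero _ h1, hU.eq_zero_of_mem_carrier hτ hτ0 htouch h1]; simp
      · rw [hW.eq_one t₀ hb X h1]
        linarith [hU.le_bottom X h1 t₀ ht₀.le])
    (fun X hX hpos => by
      have h1 : 0 < U (X, t₀) := by linarith [hWnn X (subset_closure hX)]
      exact (hU.isSubharmonicAt (S.pos_subset hb hX) ht₀ h1).add_harmonicAt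
        (hW.harmonic t₀ hb X hX).neg)
  intro X hX
  linarith [h X hX]

end Subsolution

/-- Slicewise maximum principle in a short space-time box: only the lateral boundary at the final
time has to be controlled. -/
theorem exists_nonpos_before {E : Type*} [MetricSpace E] {f : E × ℝ → ℝ} {K : Set (E × ℝ)}
    {X₀ : E} {r t₀ : ℝ} (hK : IsCompact K) (hKsub : K ⊆ Metric.closedBall X₀ r ×ˢ Iic t₀)
    (hf : UpperSemicontinuousOn f K) (hlat : ∀ p ∈ K, p.1 ∉ Metric.ball X₀ r → p.2 = t₀ → f p < 0)
    (hmax : ∀ p ∈ K, p.1 ∈ Metric.ball X₀ r → 0 < f p →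
      (∀ X, (X, p.2) ∈ K → f (X, p.2) ≤ f p) → False) :
    ∃ σ > 0, ∀ p ∈ K, t₀ - σ ≤ p.2 → f p ≤ 0 := by
  have hb : IsClosed {p : E × ℝ | p.1 ∉ Metric.ball X₀ r} :=
    (Metric.isOpen_ball.preimage continuous_fst).isClosed_compl
  -- Strictness at `t₀` on the lateral boundary passes to earlier times; after that each slice is
  -- treated alone.
  obtain ⟨σ, hσ, hneg⟩ := exists_neg_before (hK.inter_right hb) (hf.mono inter_subset_left)
    (fun p hp => (hKsub hp.1).2) (fun p hp => hlat p hp.1 hp.2)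
  refine ⟨σ, hσ, fun p hp hpσ => ?_⟩
  have hc : IsClosed {q : E × ℝ | q.2 = p.2} := isClosed_eq continuous_snd continuous_const
  refine nonpos_of_no_positive_max (hK.inter_right hc) (hf.mono inter_subset_left)
    (fun q hq hpos hqmax => ?_) p ⟨hp, rfl⟩
  have hq2 : q.2 = p.2 := hq.2
  by_cases hqb : q.1 ∈ Metric.ball X₀ r
  · exact hmax q hq.1 hqb hpos fun X hX => hqmax ⟨hX, hq2⟩
  · exact (hneg q ⟨hq.1, hqb⟩ (hq2 ▸ hpσ)).not_gt hpos

/-! ### The barrier above a subsolution and the velocity inequality. -/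

section Subsolution

variable {d : ℕ} {U₀ : Space d → ℝ} {U : Space d × ℝ → ℝ} {t₀ τ : ℝ}
  {S : TestInterface d (t₀ - τ) t₀} {X₀ ν : Space d} {V C ρ : ℝ}

/-- A paraboloid moving slower than the interface, but steeper than the potential, lies above a
subsolution that is touched from above. -/
theorem IsKimSubsolution.exists_le_paraboloid (hd : 1 ≤ d) (hU : IsKimSubsolution U₀ U)
    (hτ : 0 ≤ t₀ - τ) (hexp : S.HasExpansion X₀ ν V C ρ)
    (htouch : ∀ t ∈ Icc (t₀ - τ) t₀, ∀ X ∈ closedHalf d, 0 < U (X, t) → X ∈ closure (S.pos t))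
    {W : Space d × ℝ → ℝ} (hW : S.IsPotential W) {L' m V' : ℝ}
    (hL' : HasLowerSlope (fun X => -slice W t₀ X) (S.pos t₀) X₀ ν (-L'))
    (hm : 0 < m) (hmL : L' < m) (hV : V' < V) :
    ∃ A > 0, ∃ r ∈ Ioo 0 ρ, ∀ p ∈ Metric.closedBall X₀ r ×ˢ Icc (t₀ - r) t₀, p.1 ∉ S.neg p.2 →
      U p ≤ quad X₀ ν (-(m * V' * t₀)) m A (-((d + 2) * A)) p.1 + m * V' * p.2 := by
  obtain ⟨K, hK, ρ₂, hρ₂, hKW⟩ := hL'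
  have hC := hexp.nonneg
  have hb := hexp.final_mem
  have hρ := hexp.radius_pos
  have hρτ := hexp.radius_le
  have ht₀ : 0 < t₀ := by linarith
  have hmL0 : 0 < m - L' := by linarith
  -- The first part serves the moving paraboloid bound; the bracket lets the surplus slope m - L'
  -- absorb the error K on the lateral boundary at time `t₀`.
  set A : ℝ := 2 * m * C + 1 + (K + 2 * C * (m - L')) with hA
  have hA0 : 0 < A := by positivity
  set N : ℝ := (d + 2) * A with hN
  have hN0 : 0 ≤ N := by positivity
  obtain ⟨ρ₁, hρ₁, hpar⟩ := exists_moving_paraboloid_bound (A := A) hm hV hC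
    (by rw [hA]; nlinarith [mul_nonneg hC hmL0.le]) hN0
  set ρ₃ : ℝ := (m - L') / (N + 1) with hρ₃
  have hρ₃0 : 0 < ρ₃ := by positivity
  set r : ℝ := min (min ρ ρ₁) (min ρ₂ ρ₃) / 2 with hr
  have hr0 : 0 < r := by positivity
  have hrρ : r < ρ := by
    have : min (min ρ ρ₁) (min ρ₂ ρ₃) ≤ ρ := (min_le_left _ _).trans (min_le_left _ _)
    linarith
  have hrρ₁ : r ≤ ρ₁ := by
    have : min (min ρ ρ₁) (min ρ₂ ρ₃) ≤ ρ₁ := (min_le_left _ _).trans (min_le_right _ _)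
    linarith
  have hrρ₂ : r < ρ₂ := by
    have : min (min ρ ρ₁) (min ρ₂ ρ₃) ≤ ρ₂ := (min_le_right _ _).trans (min_le_left _ _)
    linarith
  have hrρ₃ : r ≤ ρ₃ := by
    have : min (min ρ ρ₁) (min ρ₂ ρ₃) ≤ ρ₃ := (min_le_right _ _).trans (min_le_right _ _)
    linarith
  set Ψ : Space d → ℝ := quad X₀ ν (-(m * V' * t₀)) m A (-N) with hΨ
  have hΨcd : ContDiff ℝ 2 Ψ := contDiff_quad _ _ _ _ _ _
  have hΨc : Continuous Ψ := hΨcd.continuous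
  have hΨeq : ∀ X t, Ψ X + m * V' * t =
      m * (⟪X - X₀, ν⟫_ℝ - V' * (t₀ - t)) + A * ‖X - X₀‖ ^ 2 - N * ⟪X - X₀, ν⟫_ℝ ^ 2 := by
    intro X t
    simp only [hΨ, quad]
    ring
  have hΔ : ∀ X, Δ Ψ X < 0 := by
    intro X
    rw [hΨ, laplacian_quad, hexp.norm_eq, finrank_euclideanSpace, Fintype.card_fin, hN]
    push_cast
    nlinarith
  have hlow : ∀ p ∈ Metric.closedBall X₀ r ×ˢ Icc (t₀ - r) t₀, p.1 ∉ S.neg p.2 →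
      ‖p.1 - X₀‖ ^ 2 ≤ Ψ p.1 + m * V' * p.2 := by
    rintro ⟨X, t⟩ ⟨hX, ht1, ht2⟩ hXn
    simp only at hX ht1 ht2 hXn ⊢
    have hX' : ‖X - X₀‖ ≤ r := by rwa [Metric.mem_closedBall, dist_eq_norm] at hX
    rw [hΨeq]
    refine hpar _ _ (t₀ - t) ((abs_inner_le_norm_of_unit hexp.norm_eq _).trans (hX'.trans hrρ₁))
      (by positivity) (by linarith) (by linarith) ?_
    exact hexp.of_notMem_neg X (Metric.closedBall_subset_ball hrρ hX) t ⟨by linarith, ht2⟩ hXn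
  set K₀ : Set (Space d × ℝ) :=
    Metric.closedBall X₀ r ×ˢ Icc (t₀ - r) t₀ ∩ {p : Space d × ℝ | p.1 ∉ S.neg p.2} with hK₀
  have htime : ∀ p ∈ K₀, p.2 ∈ Icc (t₀ - τ) t₀ := fun p hp => by
    have h1 : t₀ - r ≤ p.2 := hp.1.2.1
    exact ⟨by linarith, hp.1.2.2⟩
  have hhalf : ∀ p ∈ K₀, p.1 ∈ openHalf d := fun p hp =>
    hexp.subset_openHalf (Metric.closedBall_subset_ball hrρ hp.1.1)
  have hcyl : K₀ ⊆ cylinder d (Ici 0) := fun p hp =>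
    ⟨openHalf_subset_closedHalf d (hhalf p hp), hτ.trans (htime p hp).1⟩
  obtain ⟨σ, hσ, hcmp⟩ := exists_nonpos_before (f := fun p => U p + -(Ψ p.1 + m * V' * p.2))
    (K := K₀) (X₀ := X₀) (r := r) (t₀ := t₀) (hexp.isCompact r hrρ)
    (fun p hp => ⟨hp.1.1, hp.1.2.2⟩)
    ((hU.usc.mono hcyl).add
      (by fun_prop : Continuous fun p : Space d × ℝ =>
        -(Ψ p.1 + m * V' * p.2)).continuousOn.upperSemicontinuousOn)
    (by
      rintro ⟨X, t⟩ hp hXb ht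
      simp only at hXb ht ⊢
      subst ht
      have hXr : ‖X - X₀‖ = r := by
        rw [Metric.mem_ball, dist_eq_norm, not_lt] at hXb
        have := hp.1.1
        rw [Metric.mem_closedBall, dist_eq_norm] at this
        exact le_antisymm this hXb
      have hq : 0 < ‖X - X₀‖ ^ 2 := by rw [hXr]; positivity
      have hl := hlow _ hp.1 hp.2
      simp only at hl
      have hXh := openHalf_subset_closedHalf d (hhalf _ hp)
      rcases le_or_gt (U (X, t)) 0 with h0 | h0
      · linarith
      have hXcl := htouch t hb X hXh h0
      have hXρ₂ : X ∈ Metric.ball X₀ ρ₂ := by rw [Metric.mem_ball, dist_eq_norm, hXr]; exact hrρ₂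
      have h1 := hU.le_potential hd hτ (by linarith) htouch hW X hXcl
      have h2 := hKW X ⟨hXcl, hXρ₂⟩
      have h3 := hexp.isParabolicBoundaryPoint.exterior X
        ⟨hXcl, Metric.closedBall_subset_ball hrρ hp.1.1⟩
      have h4 := paraboloid_bound (A := (A - K) / (m - L')) (ρ := r) (N := N / (m - L'))
        ((abs_inner_le_norm_of_unit hexp.norm_eq (X - X₀)).trans hXr.le)
        (by
          have h5 : r * (N + 1) ≤ m - L' := by rwa [← le_div_iff₀ (by positivity)]
          rw [div_mul_eq_mul_div, div_le_one hmL0]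
          linarith)
        (by positivity) hC hq.le h3
      have h5 := mul_le_mul_of_nonneg_left h4 hmL0.le
      have h6 : (m - L') * (((A - K) / (m - L') - 2 * C) * ‖X - X₀‖ ^ 2) =
          (A - K - 2 * C * (m - L')) * ‖X - X₀‖ ^ 2 := by field_simp
      have h7 : (m - L') * (⟪X - X₀, ν⟫_ℝ + (A - K) / (m - L') * ‖X - X₀‖ ^ 2 -
          N / (m - L') * ⟪X - X₀, ν⟫_ℝ ^ 2) = (m - L') * ⟪X - X₀, ν⟫_ℝ +
          (A - K) * ‖X - X₀‖ ^ 2 - N * ⟪X - X₀, ν⟫_ℝ ^ 2 := by field_simp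
      rw [h6, h7] at h5
      have h8 : 0 < (A - K - 2 * C * (m - L')) * ‖X - X₀‖ ^ 2 := by
        refine mul_pos ?_ hq
        have : A - K - 2 * C * (m - L') = 2 * m * C + 1 := by rw [hA]; ring
        rw [this]; positivity
      have h9 := hΨeq X t
      simp only [slice] at h2
      rw [h9, sub_self, mul_zero, sub_zero]
      linarith)
    (by
      rintro ⟨X, t⟩ hp hXb hpos hmax
      simp only at hXb hpos hmax
      have hl := hlow _ hp.1 hp.2
      have ht := htime _ hp
      simp only at hl ht
      have hUpos : 0 < U (X, t) := by
        have : 0 ≤ ‖X - X₀‖ ^ 2 := by positivity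
        linarith
      have hsub := hU.isSubharmonicAt (hhalf _ hp)
        (show (0:ℝ) < t by have h1 : t₀ - r ≤ t := hp.1.2.1; linarith) hUpos
      refine (hsub Ψ hΨcd.contDiffAt ?_).not_gt (hΔ X)
      have hnear : ∀ᶠ Y in 𝓝 X, -(Ψ Y + m * V' * t) < U (X, t) + -(Ψ X + m * V' * t) := by
        refine (by fun_prop : Continuous fun Y => -(Ψ Y + m * V' * t)).continuousAt.eventually_lt
          continuousAt_const ?_
        linarith
      filter_upwards [hnear, Metric.isOpen_ball.mem_nhds hXb] with Y hY hYb
      -- Off S⁻ the slice maximum decides. In S⁻ one has U = 0, and continuity keeps -Φ below the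
      -- positive maximum value.
      by_cases hYn : Y ∈ S.neg t
      · rw [eq_zero_of_mem_neg hU.nonneg hτ htouch ht hYn]
        linarith
      · have := hmax Y ⟨⟨Metric.ball_subset_closedBall hYb, hp.1.2⟩, hYn⟩
        linarith)
  refine ⟨A, hA0, min r σ, ⟨lt_min hr0 hσ, (min_le_left _ _).trans_lt hrρ⟩, fun p hp hpn => ?_⟩
  have h1 : t₀ - min r σ ≤ p.2 := hp.2.1
  have h2 := hcmp p ⟨⟨Metric.closedBall_subset_closedBall (min_le_left _ _) hp.1,
    ⟨by linarith [min_le_left r σ], hp.2.2⟩⟩, hpn⟩ (by linarith [min_le_right r σ])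
  linarith

/-- The velocity of a test interface touching a subsolution from above is at most the slope of its
potential. -/
theorem IsKimSubsolution.velocity_le_slope (hd : 1 ≤ d) (hU : IsKimSubsolution U₀ U)
    (hτ : 0 ≤ t₀ - τ) (hexp : S.HasExpansion X₀ ν V C ρ)
    (htouch : ∀ t ∈ Icc (t₀ - τ) t₀, ∀ X ∈ closedHalf d, 0 < U (X, t) → X ∈ closure (S.pos t))
    (hunb : ¬ Bornology.IsBounded (S.neg t₀)) (hp₀ : (X₀, t₀) ∈ S.carrier)
    (hfree : (X₀, t₀) ∈ freeBoundary (Ici 0) U)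
    {W : Space d × ℝ → ℝ} (hW : S.IsPotential W) {L : ℝ} (hL0 : 0 ≤ L)
    (hL : ∀ α > L, HasLowerSlope (fun X => -slice W t₀ X) (S.pos t₀) X₀ ν (-α)) : V ≤ L := by
  by_contra! hVL
  -- Sets up L < L' < m < V' < V; L ≥ 0 makes m positive.
  obtain ⟨V', hV'1, hV'2⟩ := exists_between hVL
  obtain ⟨m, hm1, hm2⟩ := exists_between hV'1
  obtain ⟨L', hL'1, hL'2⟩ := exists_between hm1
  have hm : 0 < m := by linarith
  have hρ := hexp.radius_pos
  have hρτ := hexp.radius_le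
  have ht₀ : 0 < t₀ := by linarith
  obtain ⟨A, hA, r, ⟨hr0, hrρ⟩, hcmp⟩ :=
    hU.exists_le_paraboloid hd hτ hexp htouch hW (hL L' hL'1) hm hL'2 hV'2
  set Ψ : Space d → ℝ := quad X₀ ν (-(m * V' * t₀)) m A (-((d + 2) * A)) with hΨ
  have hΨcd : ContDiff ℝ 2 Ψ := contDiff_quad _ _ _ _ _ _
  have hgrad : HasFDerivAt Ψ (innerSL ℝ (m • ν)) X₀ := by
    have := hasFDerivAt_quad X₀ ν (-(m * V' * t₀)) m A (-((d + 2) * A)) X₀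
    simpa using this
  have hU0 : U (X₀, t₀) = 0 := hU.eq_zero_of_mem_carrier hτ (by linarith) htouch hp₀
  have hΨ0 : Ψ X₀ + m * V' * t₀ = 0 := by simp [hΨ, quad]
  have htest := (hU.test _ (isC21On_add_mul_time hΨcd (m * V') _) (X₀, t₀)
    ⟨⟨hfree.1, le_refl t₀⟩, S.mem_openHalf hp₀, ht₀⟩ (by
      have hn : Metric.ball X₀ r ×ˢ Ioi (t₀ - r) ∈ 𝓝 (X₀, t₀) :=
        (Metric.isOpen_ball.prod isOpen_Ioi).mem_nhds
          ⟨Metric.mem_ball_self hr0, show t₀ - r < t₀ by linarith⟩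
      filter_upwards [mem_nhdsWithin_of_mem_nhds hn, self_mem_nhdsWithin] with q hq1 hq2
      obtain ⟨⟨hqcl, hqt⟩, -⟩ := hq2
      have hqt' : q.2 ≤ t₀ := hqt
      have hq1' : t₀ - r < q.2 := hq1.2
      -- Before `t₀` the complement of S⁻ is closed in the box. At `t₀` limits from later times
      -- could enter, and the no-jump result is needed.
      have hqn : q.1 ∉ S.neg q.2 := by
        rcases hqt'.lt_or_eq with hlt | heq
        · have ho : IsOpen (Metric.ball X₀ r ×ˢ Ioo (t₀ - r) t₀) :=
            Metric.isOpen_ball.prod isOpen_Ioo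
          have h1 : q ∈ closure (Metric.ball X₀ r ×ˢ Ioo (t₀ - r) t₀ ∩
              positivitySet (Ici 0) U) :=
            ho.inter_closure ⟨⟨hq1.1, hq1', hlt⟩, hqcl⟩
          refine (closure_minimal ?_ (hexp.isCompact r hrρ).isClosed h1).2
          rintro p ⟨⟨hpb, hpt⟩, hpc, hpU⟩
          have hpt1 : t₀ - r < p.2 := hpt.1
          have htp : p.2 ∈ Icc (t₀ - τ) t₀ := ⟨by linarith, hpt.2.le⟩
          exact ⟨⟨Metric.ball_subset_closedBall hpb, Ioo_subset_Icc_self hpt⟩,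
            S.notMem_neg_of_mem_closure htp (htouch p.2 htp p.1 hpc.1 hpU)⟩
        · intro hmem
          rw [heq] at hmem
          refine hU.notMem_closure_of_mem_neg hτ htouch hunb hexp q.1 hmem ?_
          have : (q.1, t₀) = q := by rw [← heq]
          rwa [this]
      have := hcmp q ⟨Metric.ball_subset_closedBall hq1.1, hq1'.le, hqt'⟩ hqn
      simp only [hU0, hΨ0]
      linarith)).2 hfree hU0
  rw [spaceLaplacian_add_mul_time hΨcd, timeDeriv_add_mul_time,
    spaceGrad_add_mul_time (p := (X₀, t₀)) hgrad, hΨ, laplacian_quad, hexp.norm_eq, norm_smul,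
    hexp.norm_eq, finrank_euclideanSpace, Fintype.card_fin, Real.norm_of_nonneg hm.le] at htest
  push_cast at htest
  -- Both entries are positive: -ΔΦ = 2A and m V' - m² = m (V' - m).
  rcases min_le_iff.1 htest with h | h
  · nlinarith
  · nlinarith

end Subsolution

/-! ### Supersolutions touched from below: comparison, Hopf slope, barrier and velocity inequality.
-/

section Supersolution

variable {d : ℕ} {U₀ : Space d → ℝ} {U : Space d × ℝ → ℝ} {t₀ τ : ℝ}
  {S : TestInterface d (t₀ - τ) t₀} {X₀ ν : Space d} {V C ρ : ℝ}

theorem lowerSemicontinuousOn_slice {U : Space d × ℝ → ℝ}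
    (hU : LowerSemicontinuousOn U (cylinder d (Ici 0))) {t : ℝ} (ht : 0 ≤ t) :
    LowerSemicontinuousOn (fun X => U (X, t)) (closedHalf d) :=
  fun X hX y hy => by
    have hc : Continuous fun X : Space d => (X, t) := by fun_prop
    have hmaps : MapsTo (fun X : Space d => (X, t)) (closedHalf d) (cylinder d (Ici 0)) :=
      fun Z hZ => ⟨hZ, ht⟩
    exact (hc.continuousWithinAt.tendsto_nhdsWithin hmaps).eventually (hU (X, t) ⟨hX, ht⟩ y hy)

/-- Here U need not be bounded or vanish on the interface: U ≥ 0 there, and W - U is bounded above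
by the bound on W. -/
theorem IsKimSupersolution.potential_le (hd : 1 ≤ d) (hU : IsKimSupersolution U₀ U)
    (hτ : 0 ≤ t₀ - τ) (hτ0 : 0 < τ) (htouch : ∀ X ∈ S.pos t₀, 0 < U (X, t₀))
    {W : Space d × ℝ → ℝ} (hW : S.IsPotential W) :
    ∀ X ∈ closure (S.pos t₀), W (X, t₀) ≤ U (X, t₀) := by
  have hb : t₀ ∈ Icc (t₀ - τ) t₀ := ⟨by linarith, le_rfl⟩
  have ht₀ : 0 < t₀ := by linarith
  have hcl := S.closure_pos_subset hb
  have hnn : ∀ X ∈ closedHalf d, 0 ≤ U (X, t₀) := fun X hX => hU.nonneg _ ⟨hX, ht₀.le⟩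
  obtain ⟨M, hM⟩ := hW.exists_bound hb
  have h := phragmen_lindelof hd (S.isOpen_pos t₀ hb)
    ((S.pos_subset hb).trans (openHalf_subset_closedHalf d))
    (f := fun X => -U (X, t₀) + W (X, t₀)) (M := M)
    ((continuous_neg.comp_lowerSemicontinuousOn_antitone
      ((lowerSemicontinuousOn_slice hU.lsc ht₀.le).mono hcl) fun _ _ => neg_le_neg).add
      (hW.continuousOn t₀ hb).upperSemicontinuousOn)
    (fun X hX => by linarith [hnn X (hcl hX), (abs_le.1 (hM X hX)).2])
    (fun X hX hXp => by
      rcases S.mem_carrier_or_bottom hb hX hXp with h1 | h1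
      · rw [hW.eq_zero _ h1]
        linarith [hnn X (hcl hX)]
      · rw [hW.eq_one t₀ hb X h1]
        linarith [hU.ge_bottom X h1 t₀ ht₀.le])
    (fun X hX _ => (hU.isSubharmonicAt_neg (S.pos_subset hb hX) ht₀ (htouch X hX)).add_harmonicAt
      (hW.harmonic t₀ hb X hX))
  intro X hX
  linarith [h X hX]

/-- Quantitative Hopf lemma: a supersolution has positive slope at the boundary of a region where it
is positive. -/
theorem IsKimSupersolution.exists_pos_slope (hU : IsKimSupersolution U₀ U) (hτ : 0 ≤ t₀ - τ)
    (hexp : S.HasExpansion X₀ ν V C ρ) (htouch : ∀ X ∈ S.pos t₀, 0 < U (X, t₀)) :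
    ∃ α > 0, HasLowerSlope (fun X => U (X, t₀)) (S.pos t₀) X₀ ν α := by
  have hC := hexp.nonneg
  have hb := hexp.final_mem
  have hρ := hexp.radius_pos
  have hρτ := hexp.radius_le
  have ht₀ : 0 < t₀ := by linarith
  have hν := hexp.norm_eq
  have hcl := S.closure_pos_subset hb
  have hpt := hexp.isParabolicBoundaryPoint
  obtain ⟨c, hc, κ, hκ, himp⟩ := exists_slope_improvement (E := Space d) (C := C) (θ := 1 / 2)
    (η := 1) hC (by norm_num) (by norm_num) one_pos
  -- κ meets the smallness condition with K = 0, ρ/3 gives 2s < ρ, and the last term places the ball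
  -- of radius s/2 about X₀ + sν inside S(t₀)⁺.
  set s : ℝ := min κ (min (ρ / 3) (1 / (5 * (C + 1)))) with hs
  have hs0 : 0 < s := by positivity
  have hsκ : s ≤ κ := min_le_left _ _
  have hsρ : s ≤ ρ / 3 := (min_le_right _ _).trans (min_le_left _ _)
  have hsC : s * (5 * (C + 1)) ≤ 1 := by
    rw [← le_div_iff₀ (by positivity)]
    exact (min_le_right _ _).trans (min_le_right _ _)
  have hball : Metric.closedBall (X₀ + s • ν) (1 / 2 * s) ⊆ S.pos t₀ := by
    intro X hX
    rw [Metric.mem_closedBall, dist_eq_norm] at hX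
    set Y := X - (X₀ + s • ν) with hY
    have hXY : X - X₀ = s • ν + Y := by rw [hY]; abel
    have h1 : ‖X - X₀‖ ≤ 3 / 2 * s := by
      rw [hXY]
      refine (norm_add_le _ _).trans ?_
      rw [norm_smul, hν, mul_one, Real.norm_of_nonneg hs0.le]
      linarith
    have h2 : 1 / 2 * s ≤ ⟪X - X₀, ν⟫_ℝ := by
      rw [hXY, inner_add_left, inner_smul_left, real_inner_self_eq_norm_sq, hν]
      have := (abs_le.1 ((abs_inner_le_norm_of_unit hν Y).trans hX)).1
      simp only [RCLike.conj_to_real, one_pow, mul_one]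
      linarith
    refine hpt.interior X (by rw [Metric.mem_ball, dist_eq_norm]; linarith) (lt_of_lt_of_le ?_ h2)
    have h3 : ‖X - X₀‖ ^ 2 ≤ (3 / 2 * s) ^ 2 := pow_le_pow_left₀ (norm_nonneg _) h1 2
    have h4 := mul_le_mul_of_nonneg_left h3 hC
    nlinarith
  have hlsc := lowerSemicontinuousOn_slice hU.lsc ht₀.le
  obtain ⟨Z, hZ, hZmin⟩ := ((hlsc.mono
    ((S.pos_subset hb).trans (openHalf_subset_closedHalf d))).mono hball).exists_isMinOn
    ⟨X₀ + s • ν, Metric.mem_closedBall_self (by positivity)⟩ (isCompact_closedBall _ _)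
  have hZpos := htouch Z (hball hZ)
  -- Normalizes M U to be at least s on that ball, so the slope improvement applies with α = 0 and η
  -- = 1.
  set M : ℝ := s / U (Z, t₀) with hM
  have hM0 : 0 < M := by positivity
  obtain ⟨K, hK, r, hr, hlow⟩ := himp (fun X => M * U (X, t₀)) X₀ ν (S.pos t₀) ρ 0 0 s hν
    (S.isOpen_pos t₀ hb) hs0 (by linarith) le_rfl (by linarith)
    ((continuous_const_mul M).comp_lowerSemicontinuousOn
      (hlsc.mono (inter_subset_left.trans hcl)) (monotone_mul_left_of_nonneg hM0.le))
    (by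
      rintro X ⟨hX, -⟩ φ hφ hmax
      have h1 := hU.isSubharmonicAt_neg (S.pos_subset hb hX) ht₀ (htouch X hX)
        (M⁻¹ • φ) (contDiffAt_const.smul hφ) (by
          filter_upwards [hmax] with Y hY
          have h2 := mul_le_mul_of_nonneg_left hY (inv_pos.2 hM0).le
          simp only [Pi.smul_apply, smul_eq_mul]
          rw [mul_sub, mul_sub, mul_neg, mul_neg, inv_mul_cancel_left₀ hM0.ne',
            inv_mul_cancel_left₀ hM0.ne'] at h2
          exact h2)
      rw [InnerProductSpace.laplacian_smul _ hφ, smul_eq_mul] at h1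
      exact nonneg_of_mul_nonneg_right h1 (inv_pos.2 hM0))
    (by
      rintro X ⟨hX, -⟩
      have := mul_nonneg hM0.le (hU.nonneg (X, t₀) ⟨hcl hX, ht₀.le⟩)
      simpa using this)
    (by
      rintro X ⟨-, hX⟩ hXp
      by_contra! hcon
      exact hXp (hpt.interior X hX hcon))
    (by
      intro X _ hXs
      have h1 : U (Z, t₀) ≤ U (X, t₀) := hZmin
        (show X ∈ Metric.closedBall (X₀ + s • ν) (1 / 2 * s) by
          rwa [Metric.mem_closedBall, dist_eq_norm])
      have h2 : M * U (Z, t₀) = s := by rw [hM]; field_simp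
      have := mul_le_mul_of_nonneg_left h1 hM0.le
      linarith)
  refine ⟨c / M, by positivity, K / M, by positivity, r, hr, fun X hX => ?_⟩
  have h1 := hlow X hX
  rw [zero_add] at h1
  have h2 : c / M * ⟪X - X₀, ν⟫_ℝ - K / M * ‖X - X₀‖ ^ 2 =
      (c * ⟪X - X₀, ν⟫_ℝ - K * ‖X - X₀‖ ^ 2) / M := by field_simp
  rw [h2, div_le_iff₀' hM0]
  exact h1

/-- A paraboloid moving faster than the interface, but less steep than a supersolution that is
touched from below, lies below the supersolution. -/
theorem IsKimSupersolution.exists_paraboloid_le (hU : IsKimSupersolution U₀ U)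
    (hτ : 0 ≤ t₀ - τ) (hexp : S.HasExpansion X₀ ν V C ρ)
    (htouch : ∀ t ∈ Icc (t₀ - τ) t₀, ∀ X ∈ S.pos t, 0 < U (X, t)) {L' m V' : ℝ}
    (hL' : HasLowerSlope (fun X => U (X, t₀)) (S.pos t₀) X₀ ν L')
    (hm : 0 < m) (hmL : m < L') (hV : V < V') :
    ∃ A > 0, ∃ r > 0, ∀ p ∈ Metric.closedBall X₀ r ×ˢ Icc (t₀ - r) t₀,
      quad X₀ ν (-(m * V' * t₀)) m (-A) ((d + 2) * A) p.1 + m * V' * p.2 ≤ U p := by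
  obtain ⟨K, hK, ρ₂, hρ₂, hKU⟩ := hL'
  have hC := hexp.nonneg
  have hb := hexp.final_mem
  have hρ := hexp.radius_pos
  have hρτ := hexp.radius_le
  have ht₀ : 0 < t₀ := by linarith
  have hmL0 : 0 < L' - m := by linarith
  set A : ℝ := 2 * m * C + 1 + (K + 2 * C * (L' - m)) with hA
  have hA0 : 0 < A := by positivity
  set N : ℝ := (d + 2) * A with hN
  have hN0 : 0 ≤ N := by positivity
  -- Changing the signs of ℓ, V and V' puts the complement of S⁺ into the setting of the bound.
  obtain ⟨ρ₁, hρ₁, hpar⟩ := exists_moving_paraboloid_bound (A := A) hm (neg_lt_neg hV) hC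
    (by rw [hA]; nlinarith [mul_nonneg hC hmL0.le]) hN0
  set ρ₃ : ℝ := (L' - m) / (N + 1) with hρ₃
  have hρ₃0 : 0 < ρ₃ := by positivity
  set r : ℝ := min (min ρ ρ₁) (min ρ₂ ρ₃) / 2 with hr
  have hr0 : 0 < r := by positivity
  have hrρ : r < ρ := by
    have : min (min ρ ρ₁) (min ρ₂ ρ₃) ≤ ρ := (min_le_left _ _).trans (min_le_left _ _)
    linarith
  have hrρ₁ : r ≤ ρ₁ := by
    have : min (min ρ ρ₁) (min ρ₂ ρ₃) ≤ ρ₁ := (min_le_left _ _).trans (min_le_right _ _)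
    linarith
  have hrρ₂ : r < ρ₂ := by
    have : min (min ρ ρ₁) (min ρ₂ ρ₃) ≤ ρ₂ := (min_le_right _ _).trans (min_le_left _ _)
    linarith
  have hrρ₃ : r ≤ ρ₃ := by
    have : min (min ρ ρ₁) (min ρ₂ ρ₃) ≤ ρ₃ := (min_le_right _ _).trans (min_le_right _ _)
    linarith
  set Ψ : Space d → ℝ := quad X₀ ν (-(m * V' * t₀)) m (-A) N with hΨ
  have hΨcd : ContDiff ℝ 2 Ψ := contDiff_quad _ _ _ _ _ _
  have hΨc : Continuous Ψ := hΨcd.continuous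
  have hΨeq : ∀ X t, Ψ X + m * V' * t =
      m * (⟪X - X₀, ν⟫_ℝ - V' * (t₀ - t)) - A * ‖X - X₀‖ ^ 2 + N * ⟪X - X₀, ν⟫_ℝ ^ 2 := by
    intro X t
    simp only [hΨ, quad]
    ring
  have hΔ : ∀ X, Δ (fun Y => -Ψ Y) X < 0 := by
    intro X
    have h1 : Δ (-Ψ) X = -Δ Ψ X := by rw [InnerProductSpace.laplacian_neg]; rfl
    change Δ (-Ψ) X < 0
    rw [h1, hΨ, laplacian_quad, hexp.norm_eq, finrank_euclideanSpace, Fintype.card_fin, hN]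
    push_cast
    nlinarith
  set K₀ : Set (Space d × ℝ) := Metric.closedBall X₀ r ×ˢ Icc (t₀ - r) t₀ with hK₀
  have hlow : ∀ p ∈ K₀, p.1 ∉ S.pos p.2 → Ψ p.1 + m * V' * p.2 ≤ -‖p.1 - X₀‖ ^ 2 := by
    rintro ⟨X, t⟩ ⟨hX, ht1, ht2⟩ hXn
    simp only at hX ht1 ht2 hXn ⊢
    have hX' : ‖X - X₀‖ ≤ r := by rwa [Metric.mem_closedBall, dist_eq_norm] at hX
    have h1 := hexp.of_notMem_pos X (Metric.closedBall_subset_ball hrρ hX) t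
      ⟨by linarith, ht2⟩ hXn
    have h2 := hpar (-⟪X - X₀, ν⟫_ℝ) (‖X - X₀‖ ^ 2) (t₀ - t)
      (by rw [abs_neg]; exact (abs_inner_le_norm_of_unit hexp.norm_eq _).trans (hX'.trans hrρ₁))
      (by positivity) (by linarith) (by linarith) (by linarith)
    rw [hΨeq]
    rw [neg_sq] at h2
    linarith
  have htime : ∀ p ∈ K₀, p.2 ∈ Icc (t₀ - τ) t₀ := fun p hp => by
    have h1 : t₀ - r ≤ p.2 := hp.2.1
    exact ⟨by linarith, hp.2.2⟩
  have hhalf : ∀ p ∈ K₀, p.1 ∈ openHalf d := fun p hp =>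
    hexp.subset_openHalf (Metric.closedBall_subset_ball hrρ hp.1)
  have hcyl : K₀ ⊆ cylinder d (Ici 0) := fun p hp =>
    ⟨openHalf_subset_closedHalf d (hhalf p hp), hτ.trans (htime p hp).1⟩
  obtain ⟨σ, hσ, hcmp⟩ := exists_nonpos_before (f := fun p => -U p + (Ψ p.1 + m * V' * p.2))
    (K := K₀) (X₀ := X₀) (r := r) (t₀ := t₀) ((isCompact_closedBall _ _).prod isCompact_Icc)
    (fun p hp => ⟨hp.1, hp.2.2⟩)
    ((continuous_neg.comp_lowerSemicontinuousOn_antitone (hU.lsc.mono hcyl)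
        fun _ _ => neg_le_neg).add
      (by fun_prop : Continuous fun p : Space d × ℝ =>
        Ψ p.1 + m * V' * p.2).continuousOn.upperSemicontinuousOn)
    (by
      rintro ⟨X, t⟩ hp hXb ht
      simp only at hXb ht ⊢
      subst ht
      have hXr : ‖X - X₀‖ = r := by
        rw [Metric.mem_ball, dist_eq_norm, not_lt] at hXb
        have := hp.1
        rw [Metric.mem_closedBall, dist_eq_norm] at this
        exact le_antisymm this hXb
      have hq : 0 < ‖X - X₀‖ ^ 2 := by rw [hXr]; positivity
      have hnn := hU.nonneg _ (hcyl hp)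
      by_cases hXp : X ∈ S.pos t
      · have hXcl := subset_closure hXp
        have hXρ₂ : X ∈ Metric.ball X₀ ρ₂ := by
          rw [Metric.mem_ball, dist_eq_norm, hXr]; exact hrρ₂
        have h2 := hKU X ⟨hXcl, hXρ₂⟩
        have h3 := hexp.isParabolicBoundaryPoint.exterior X
          ⟨hXcl, Metric.closedBall_subset_ball hrρ hp.1⟩
        have h4 := paraboloid_bound (A := (A - K) / (L' - m)) (ρ := r) (N := N / (L' - m))
          ((abs_inner_le_norm_of_unit hexp.norm_eq (X - X₀)).trans hXr.le)
          (by
            have h5 : r * (N + 1) ≤ L' - m := by rwa [← le_div_iff₀ (by positivity)]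
            rw [div_mul_eq_mul_div, div_le_one hmL0]
            linarith)
          (by positivity) hC hq.le h3
        have h5 := mul_le_mul_of_nonneg_left h4 hmL0.le
        have h6 : (L' - m) * (((A - K) / (L' - m) - 2 * C) * ‖X - X₀‖ ^ 2) =
            (A - K - 2 * C * (L' - m)) * ‖X - X₀‖ ^ 2 := by field_simp
        have h7 : (L' - m) * (⟪X - X₀, ν⟫_ℝ + (A - K) / (L' - m) * ‖X - X₀‖ ^ 2 -
            N / (L' - m) * ⟪X - X₀, ν⟫_ℝ ^ 2) = (L' - m) * ⟪X - X₀, ν⟫_ℝ +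
            (A - K) * ‖X - X₀‖ ^ 2 - N * ⟪X - X₀, ν⟫_ℝ ^ 2 := by field_simp
        rw [h6, h7] at h5
        have h8 : 0 < (A - K - 2 * C * (L' - m)) * ‖X - X₀‖ ^ 2 := by
          refine mul_pos ?_ hq
          have : A - K - 2 * C * (L' - m) = 2 * m * C + 1 := by rw [hA]; ring
          rw [this]; positivity
        have h9 := hΨeq X t
        rw [h9, sub_self, mul_zero, sub_zero]
        linarith
      · have := hlow _ hp hXp
        simp only at this
        linarith)
    (by
      rintro ⟨X, t⟩ hp hXb hpos hmax
      simp only at hXb hpos hmax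
      have ht := htime _ hp
      have hnn := hU.nonneg _ (hcyl hp)
      have hXp : X ∈ S.pos t := by
        by_contra hXp
        have := hlow _ hp hXp
        simp only at this
        have h2 : 0 ≤ ‖X - X₀‖ ^ 2 := by positivity
        linarith
      have hsub := hU.isSubharmonicAt_neg (hhalf _ hp)
        (show (0:ℝ) < t by have h1 : t₀ - r ≤ t := hp.2.1; linarith) (htouch t ht X hXp)
      refine (hsub (fun Y => -Ψ Y) hΨcd.contDiffAt.neg ?_).not_gt (hΔ X)
      filter_upwards [Metric.isOpen_ball.mem_nhds hXb] with Y hYb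
      have := hmax Y ⟨Metric.ball_subset_closedBall hYb, hp.2⟩
      linarith)
  refine ⟨A, hA0, min r σ, lt_min hr0 hσ, fun p hp => ?_⟩
  have h1 : t₀ - min r σ ≤ p.2 := hp.2.1
  have h2 := hcmp p ⟨Metric.closedBall_subset_closedBall (min_le_left _ _) hp.1,
    ⟨by linarith [min_le_left r σ], hp.2.2⟩⟩ (by linarith [min_le_right r σ])
  linarith

/-- Lower semicontinuity makes {U > 0} relatively open, so a limit of points outside it cannot carry
a positive value. -/
theorem IsKimSupersolution.eq_zero_of_mem_freeBoundary (hU : IsKimSupersolution U₀ U)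
    {p : Space d × ℝ} (hp : p ∈ cylinder d (Ici 0)) (hfree : p ∈ freeBoundary (Ici 0) U) :
    U p = 0 := by
  refine le_antisymm ?_ (hU.nonneg p hp)
  by_contra! hpos
  have h1 := mem_closure_iff_frequently.1 hfree.2
  have h2 := eventually_nhdsWithin_iff.1 (hU.lsc p hp 0 hpos)
  obtain ⟨q, hq, hq'⟩ := (h1.and_eventually h2).exists
  exact hq.2 ⟨hq.1, hq' hq.1⟩

/-- The velocity of a test interface touching a supersolution from below is at least the slope of
its potential. -/
theorem IsKimSupersolution.slope_le_velocity (hd : 1 ≤ d) (hU : IsKimSupersolution U₀ U)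
    (hτ : 0 ≤ t₀ - τ) (hexp : S.HasExpansion X₀ ν V C ρ)
    (htouch : ∀ t ∈ Icc (t₀ - τ) t₀, ∀ X ∈ S.pos t, 0 < U (X, t))
    (hp₀ : (X₀, t₀) ∈ S.carrier) (hfree : (X₀, t₀) ∈ freeBoundary (Ici 0) U)
    {W : Space d × ℝ → ℝ} (hW : S.IsPotential W) {L : ℝ}
    (hL : ∀ α < L, HasLowerSlope (slice W t₀) (S.pos t₀) X₀ ν α) : L ≤ V := by
  by_contra! hVL
  have hρ := hexp.radius_pos
  have hρτ := hexp.radius_le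
  have hb := hexp.final_mem
  have ht₀ : 0 < t₀ := by linarith
  have hX₀ := S.mem_openHalf hp₀
  obtain ⟨L', hL'V, hL'⟩ : ∃ L' > max V 0,
      HasLowerSlope (fun X => U (X, t₀)) (S.pos t₀) X₀ ν L' := by
    -- For L > 0 the slope comes from U ≥ W. For L ≤ 0 also V < 0, and any positive slope of U from
    -- Hopf's lemma will do.
    rcases lt_or_ge 0 L with hLpos | hLneg
    · obtain ⟨L', h1, h2⟩ := exists_between (max_lt hVL hLpos)
      obtain ⟨K, hK, r, hr, hlow⟩ := hL L' h2
      exact ⟨L', h1, K, hK, r, hr, fun X hX => (hlow X hX).trans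
        (hU.potential_le hd hτ (by linarith) (htouch t₀ hb) hW X hX.1)⟩
    · obtain ⟨α, hα, h⟩ := hU.exists_pos_slope hτ hexp (htouch t₀ hb)
      exact ⟨α, by rw [gt_iff_lt, max_lt_iff]; constructor <;> linarith, h⟩
  obtain ⟨m, hm1, hm2⟩ := exists_between hL'V
  obtain ⟨hmV, hm⟩ := max_lt_iff.1 hm1
  obtain ⟨V', hV'1, hV'2⟩ := exists_between hmV
  obtain ⟨A, hA, r, hr0, hcmp⟩ := hU.exists_paraboloid_le hτ hexp htouch hL' hm hm2 hV'1
  set Ψ : Space d → ℝ := quad X₀ ν (-(m * V' * t₀)) m (-A) ((d + 2) * A) with hΨ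
  have hΨcd : ContDiff ℝ 2 Ψ := contDiff_quad _ _ _ _ _ _
  have hgrad : HasFDerivAt Ψ (innerSL ℝ (m • ν)) X₀ := by
    have := hasFDerivAt_quad X₀ ν (-(m * V' * t₀)) m (-A) ((d + 2) * A) X₀
    simpa using this
  have hU0 : U (X₀, t₀) = 0 := hU.eq_zero_of_mem_freeBoundary
    ⟨openHalf_subset_closedHalf d hX₀, ht₀.le⟩ hfree
  have hΨ0 : Ψ X₀ + m * V' * t₀ = 0 := by simp [hΨ, quad]
  have hν0 : m • ν ≠ 0 := smul_ne_zero hm.ne' (norm_pos_iff.1 (by rw [hexp.norm_eq]; exact one_pos))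
  have htest := (hU.test _ (isC21On_add_mul_time hΨcd (m * V') _) (X₀, t₀)
    ⟨⟨hfree.1, le_refl t₀⟩, hX₀, ht₀⟩ (by
      have hn : Metric.ball X₀ r ×ˢ Ioi (t₀ - r) ∈ 𝓝 (X₀, t₀) :=
        (Metric.isOpen_ball.prod isOpen_Ioi).mem_nhds
          ⟨Metric.mem_ball_self hr0, show t₀ - r < t₀ by linarith⟩
      filter_upwards [mem_nhdsWithin_of_mem_nhds hn, self_mem_nhdsWithin] with q hq1 hq2
      have hq1' : t₀ - r < q.2 := hq1.2
      have := hcmp q ⟨Metric.ball_subset_closedBall hq1.1, hq1'.le, hq2.1.2⟩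
      simp only [hU0, hΨ0]
      linarith)).2 hfree
    (by rw [spaceGrad_add_mul_time (p := (X₀, t₀)) hgrad]; exact hν0)
    (by
      intro δ hδ
      have hline : Tendsto (fun s : ℝ => (X₀ + s • ν, t₀)) (𝓝[>] 0) (𝓝 (X₀, t₀)) :=
        ((tendsto_line X₀ ν).mono_left nhdsWithin_le_nhds).prodMk_nhds tendsto_const_nhds
      obtain ⟨s, hs1, hs2, hs3⟩ := ((hline.eventually (Metric.ball_mem_nhds _ hδ)).and
        (hexp.isParabolicBoundaryPoint.eventually_line_mem.and self_mem_nhdsWithin)).exists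
      have hs0 : 0 < s := hs3
      refine ⟨(X₀ + s • ν, t₀), ⟨?_, ⟨openHalf_subset_closedHalf d (S.pos_subset hb hs2), ht₀.le⟩,
        htouch t₀ hb _ hs2⟩, hs1⟩
      change 0 < Ψ (X₀ + s • ν) + m * V' * t₀
      simp only [hΨ, quad, add_sub_cancel_left, inner_smul_left, real_inner_self_eq_norm_sq,
        hexp.norm_eq, norm_smul, Real.norm_of_nonneg hs0.le, RCLike.conj_to_real, one_pow, mul_one]
      have h1 : 0 < m * s := mul_pos hm hs0
      -- Along the normal the quadratic terms add up to (d + 1) A s², so Φ > 0 at points of S⁺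
      -- arbitrarily close to X₀.
      have h2 : 0 ≤ (d + 1) * A * s ^ 2 := by positivity
      linarith)
  rw [spaceLaplacian_add_mul_time hΨcd, timeDeriv_add_mul_time,
    spaceGrad_add_mul_time (p := (X₀, t₀)) hgrad, hΨ, laplacian_quad, hexp.norm_eq, norm_smul,
    hexp.norm_eq, finrank_euclideanSpace, Fintype.card_fin, Real.norm_of_nonneg hm.le] at htest
  push_cast at htest
  -- Both entries are negative: -ΔΦ = -2A and m V' - m² = m (V' - m).
  rcases le_max_iff.1 htest with h | h
  · nlinarith
  · nlinarith

end Supersolution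

/-! ### Restriction to [a, b] and conclusion. -/

theorem freeBoundary_mono {d : ℕ} {I J : Set ℝ} (h : I ⊆ J) (U : Space d × ℝ → ℝ) :
    freeBoundary I U ⊆ freeBoundary J U := by
  have hc : cylinder d I ⊆ cylinder d J := prod_mono_right h
  refine inter_subset_inter (closure_mono fun p hp => ⟨hc hp.1, hp.2⟩) (closure_mono ?_)
  exact fun p hp => ⟨hc hp.1, fun hq => hp.2 ⟨hp.1, hq.2⟩⟩

theorem pos_of_mem_interiorPositivity {d : ℕ} {a b : ℝ} {U : Space d × ℝ → ℝ} {p : Space d × ℝ}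
    (hp : p ∈ interiorPositivity a b U) : 0 < U p :=
  (mem_of_mem_nhdsWithin hp.1.1 hp.1.2).2

namespace TestInterface

variable {d : ℕ} {a b : ℝ} {S : TestInterface d a b} {X₀ ν : Space d} {V : ℝ}

/-- The normal velocity and the inward normal are those of one quadratic expansion. -/
theorem exists_hasExpansion_of_hasNormalVelocity (hab : a < b) (hp : (X₀, b) ∈ S.carrier)
    (hV : S.HasNormalVelocity (X₀, b) V) (hν : S.HasInwardNormal (X₀, b) ν) :
    ∃ C ρ, S.HasExpansion X₀ ν V C ρ := by
  obtain ⟨φ, hφ, rfl⟩ := hV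
  obtain ⟨ψ, hψ, rfl⟩ := hν
  obtain ⟨C, ρ, h⟩ := S.exists_hasExpansion hab hp hφ
  obtain ⟨C', ρ', h'⟩ := S.exists_hasExpansion hab hp hψ
  rw [← h.normal_unique h']
  exact ⟨C, ρ, h⟩

theorem HasExpansion.slope_nonneg {C ρ : ℝ} (h : S.HasExpansion X₀ ν V C ρ) (hd : 1 ≤ d)
    (hp : (X₀, b) ∈ S.carrier) {W : Space d × ℝ → ℝ} (hW : S.IsPotential W) {L : ℝ}
    (hL : HasOneSidedDeriv W (X₀, b) ν L) : 0 ≤ L := by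
  refine ge_of_tendsto hL ?_
  filter_upwards [h.isParabolicBoundaryPoint.eventually_line_mem, self_mem_nhdsWithin] with s hs hs0
  have h1 := hW.nonneg hd h.final_mem _ (subset_closure hs)
  have h2 : W (X₀, b) = 0 := hW.eq_zero _ hp
  rw [h2, sub_zero]
  exact div_nonneg h1 (le_of_lt hs0)

end TestInterface

theorem IsKimSubsolution.isViscositySubsolution {d : ℕ} (hd : 1 ≤ d) {a b : ℝ} (ha : 0 ≤ a)
    {U₀ : Space d → ℝ} {U : Space d × ℝ → ℝ} (hU : IsKimSubsolution U₀ U) :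
    IsViscositySubsolution a b U where
  usc := hU.usc.mono (prod_mono_right fun t ht => ha.trans ht.1)
  le_bottom X hX t ht := hU.le_bottom X hX t (ha.trans ht.1)
  interior_eq p hp φ hφ hmax :=
    hU.isSubharmonicAt hp.2.1 (ha.trans_lt hp.2.2.1) (pos_of_mem_interiorPositivity hp) φ hφ hmax
  test τ t₀ hτ hat htb S X₀ htouch W hW V ν hV hν := by
    have hτ0 : 0 ≤ t₀ - τ := ha.trans hat
    obtain ⟨C, ρ, hexp⟩ := TestInterface.exists_hasExpansion_of_hasNormalVelocity (by linarith)
      htouch.mem_carrier hV hν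
    obtain ⟨L, hL, -, hup⟩ := hexp.exists_slope htouch.mem_carrier hW
    -- Enlarging the time interval from [a, b] to [0, ∞) only enlarges the relative boundary, so the
    -- contact point is a free boundary point in Kim's sense.
    exact ⟨L, hL, hU.velocity_le_slope hd hτ0 hexp htouch.subset htouch.unbounded
      htouch.mem_carrier (freeBoundary_mono (fun t ht => ha.trans ht.1) U htouch.mem_freeBoundary)
      hW (hexp.slope_nonneg hd htouch.mem_carrier hW hL) hup⟩

theorem IsKimSupersolution.isViscositySupersolution {d : ℕ} (hd : 1 ≤ d) {a b : ℝ} (ha : 0 ≤ a)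
    {U₀ : Space d → ℝ} {U : Space d × ℝ → ℝ} (hU : IsKimSupersolution U₀ U) :
    IsViscositySupersolution a b U where
  lsc := hU.lsc.mono (prod_mono_right fun t ht => ha.trans ht.1)
  ge_bottom X hX t ht := hU.ge_bottom X hX t (ha.trans ht.1)
  interior_eq p hp φ hφ hmin := by
    have h1 := hU.isSubharmonicAt_neg hp.2.1 (ha.trans_lt hp.2.2.1)
      (pos_of_mem_interiorPositivity hp) (-φ) hφ.neg (by
        filter_upwards [hmin] with Y hY
        simp only [Pi.neg_apply, Prod.mk.eta] at hY ⊢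
        linarith)
    have h2 : Δ (-φ) p.1 = -Δ φ p.1 := by rw [InnerProductSpace.laplacian_neg]; rfl
    rw [h2] at h1
    linarith
  test τ t₀ hτ hat htb S X₀ htouch W hW V ν hV hν := by
    have hτ0 : 0 ≤ t₀ - τ := ha.trans hat
    obtain ⟨C, ρ, hexp⟩ := TestInterface.exists_hasExpansion_of_hasNormalVelocity (by linarith)
      htouch.mem_carrier hV hν
    obtain ⟨L, hL, hlow, -⟩ := hexp.exists_slope htouch.mem_carrier hW
    exact ⟨L, hL, hU.slope_le_velocity hd hτ0 hexp htouch.subset htouch.mem_carrier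
      (freeBoundary_mono (fun t ht => ha.trans ht.1) U htouch.mem_freeBoundary) hW hlow⟩

end HeleShaw

theorem lemma9p5 (d : ℕ) (hd : 1 ≤ d) (a b : ℝ) (ha : 0 ≤ a) (hab : a < b)
    (U₀ : HeleShaw.Space d → ℝ) (U : HeleShaw.Space d × ℝ → ℝ) :
    (HeleShaw.IsKimSubsolution U₀ U → HeleShaw.IsViscositySubsolution a b U) ∧
      (HeleShaw.IsKimSupersolution U₀ U → HeleShaw.IsViscositySupersolution a b U) :=
  ⟨fun h => h.isViscositySubsolution hd ha, fun h => h.isViscositySupersolution hd ha⟩
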